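/- Setting. A parameterized dynamic circuit $\mathcal C$ on $n$ qubits is a finite sequence of operations, each of which is (a) a parameterized single-qubit unitary gate, (b) a parameterized two-qubit unitary gate, or (c) a feedforward operation on one qubit: measure in the computational basis, do nothing on outcome $0$, apply $$U_1=\begin{pmatrix}\cos\varphi\, e^{-i\phi} & -i\sin\varphi\\ -i\sin\varphi & \cos\varphi\, e^{i\phi}\end{pmatrix}$$ on outcome $1$ (fixed $\varphi,\phi\in\mathbb R$), and forget the outcome. The parameter vector $\boldsymbol\theta\in\mathbb R^p$ is drawn from a probability distribution $\mathcal D_p$, gates depend measurably on $\boldsymbol\theta$, and $\rho(\boldsymbol\theta)=\mathcal C(\boldsymbol\theta)(|0^n\rangle\langle 0^n|)$ is the output state. A path from a feedforward operation to a qubit $j$ starts at the qubit of that operation just after it, ends in $j$ at the end of the circuit, and at each later operation either stays on its qubit or moves between two qubits on which that operation acts; its length is the number of later two-qubit gates that act on the current qubit of the path. The feedforward distance of $j$ is the minimal length of such a path ($\infty$ if there is none), and the worst-case feedforward distance is the maximum over all $n$ qubits. Theorem. Let $\alpha\in[0,1]$, $\beta\in[0,1-\alpha]$ and $f,k\in\mathbb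 N$, and assume: 1. Every component of $\boldsymbol\theta$ controls a single operation of $\mathcal C$, and the parameters of different operations are independent. 2. The ensemble is locally scrambling: for some single-qubit unitary 2-design $\mathcal E$, the law of the random channel $\mathcal C(\boldsymbol\theta)$ is unchanged when, after every operation, independent single-qubit gates drawn from $\mathcal E$ are inserted on the qubits on which that operation acts. 3. Every random two-qubit gate $U$ of the circuit has the transfer matrix $$T=\begin{pmatrix}1&\frac{4\alpha}{5}&\frac{4\alpha}{5}&0\\0&1-\alpha-\beta&\beta&0\\0&\beta&1-\alpha-\beta&0\\0&\frac{\alpha}{5}&\frac{\alpha}{5}&1\end{pmatrix},$$ that is, with $\mathtt I=I/4$ and $\mathtt S=\mathrm{SWAP}/2$ on two copies of a qubit and $(B_1,\dots,B_4)=(\mathtt{II},\mathtt{IS},\mathtt{SI},\mathtt{SS})$, one has $\mathbb E\big[W^{\otimes2}B_s W^{\dagger\otimes2}\big]=\sum_t T_{ts}B_t$ for $W=(V_1\otimes V_2)U$, with $V_1,V_2$ independent Haar-random in $\mathrm U(2)$, independent of $U$. 4. The worst-case feedforward distance of $\mathcal C$ is at most $f$. Let $H=\sum_{\boldsymbol\alpha}c_{\boldsymbol\alpha}\boldsymbol\alpha$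 (real $c_{\boldsymbol\alpha}$, sum over all $n$-qubit Pauli observables $\boldsymbol\alpha$, of weight $|\boldsymbol\alpha|$) be a $k$-local Hamiltonian, i.e. a finite sum of Hermitian operators each acting on at most $k$ qubits. Then the loss $L(\boldsymbol\theta)=\mathrm{Tr}\,\rho(\boldsymbol\theta)H$ satisfies $$\mathrm{Var}_{\boldsymbol\theta}\,L\ \ge\ \sum_{\boldsymbol\alpha\ne I}c_{\boldsymbol\alpha}^2\Big(\frac{\sin^2\varphi}{3}\Big)^{|\boldsymbol\alpha|}\Big(\frac{\alpha}{5}\Big)^{kf},$$ and in particular $$\mathrm{Var}_{\boldsymbol\theta}\,L\ \ge\ \|H_0\|_{HS}^2\Big(\frac{\sin^2\varphi}{3}\Big)^{k}\Big(\frac{\alpha}{5}\Big)^{kf},$$ where $H_0=H-2^{-n}\mathrm{Tr}(H)\,I$ is the traceless part of $H$ and $\|A\|_{HS}^2=2^{-n}\,\mathrm{Tr}(A^\dagger A)$ is the Hilbert-Schmidt norm for the normalized trace. The factors multiplying $c_{\boldsymbol\alpha}^2$ and $\|H_0\|_{HS}^2$ depend neither on the number $n$ of qubits nor on the depth or the number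 of operations of the circuit: there is no barren plateau. -/

import Mathlib

open scoped Kronecker

noncomputable section

namespace DynCircuit

/-! ### Matrices, qubits, Pauli observables -/

/-- Matrices carry the product σ-algebra. -/
instance matrixMeasurableSpace (a b : Type*) : MeasurableSpace (Matrix a b ℂ) :=
  inferInstanceAs (MeasurableSpace (a → b → ℂ))

instance matrixBorelSpace (a b : Type*) [Countable a] [Countable b] :
    BorelSpace (Matrix a b ℂ) :=
  inferInstanceAs (BorelSpace (a → b → ℂ))

/-- Labels of the computational basis of `n` qubits. -/
abbrev Bits (n : ℕ) := Fin n → Fin 2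

/-- Linear operators on `n` qubits. -/
abbrev NOp (n : ℕ) := Matrix (Bits n) (Bits n) ℂ

/-- The group `U(2)` of single-qubit unitaries. -/
abbrev U2 := Matrix.unitaryGroup (Fin 2) ℂ

/-- The group `U(4)` of two-qubit unitaries. -/
abbrev U4 := Matrix.unitaryGroup (Fin 2 × Fin 2) ℂ

/-- The operator `M` on the qubits in `A`, tensored with the identity on all other qubits. -/
def extendOp {n : ℕ} (A : Finset (Fin n)) (M : Matrix (A → Fin 2) (A → Fin 2) ℂ) : NOp n :=
  Matrix.of fun x y =>
    if ∀ j, j ∉ A → x j = y j then M (fun j => x j) (fun j => y j) else 0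

/-- The single-qubit operator `M` acting on qubit `q`, identity elsewhere. -/
def onQubit {n : ℕ} (q : Fin n) (M : Matrix (Fin 2) (Fin 2) ℂ) : NOp n :=
  Matrix.of fun x y => if ∀ j, j ≠ q → x j = y j then M (x q) (y q) else 0

/-- The two-qubit operator `M` acting on the ordered pair of qubits `(q, r)`, identity
elsewhere (meaningful for `q ≠ r`). -/
def onPair {n : ℕ} (q r : Fin n) (M : Matrix (Fin 2 × Fin 2) (Fin 2 × Fin 2) ℂ) : NOp n :=
  Matrix.of fun x y =>
    if ∀ j, j ≠ q → j ≠ r → x j = y j then M (x q, x r) (y q, y r) else 0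

/-- The Pauli matrices `I, X, Y, Z`. -/
def pauli : Fin 4 → Matrix (Fin 2) (Fin 2) ℂ :=
  ![1, !![0, 1; 1, 0], !![0, -Complex.I; Complex.I, 0], !![1, 0; 0, -1]]

/-- The `n`-qubit Pauli observable `pauli (a 0) ⊗ ⋯ ⊗ pauli (a (n-1))`. -/
def pauliString {n : ℕ} (a : Fin n → Fin 4) : NOp n :=
  Matrix.of fun x y => ∏ j, pauli (a j) (x j) (y j)

/-- The weight of a Pauli observable: the number of qubits on which it is not the identity. -/
def weight {n : ℕ} (a : Fin n → Fin 4) : ℕ := (Finset.univ.filter fun j => a j ≠ 0).card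

/-- `H` is a `k`-local Hamiltonian: a finite sum of Hermitian operators each of which acts on
at most `k` qubits. -/
def IsKLocal {n : ℕ} (k : ℕ) (H : NOp n) : Prop :=
  ∃ (r : ℕ) (h : Fin r → NOp n),
    (∀ i, (h i).IsHermitian ∧
      ∃ A : Finset (Fin n), A.card ≤ k ∧ ∃ M, h i = extendOp A M) ∧
    H = ∑ i, h i

/-- The square of the Hilbert-Schmidt norm with respect to the normalized trace `2⁻ⁿ Tr`, for
which the Pauli observables are orthonormal. -/
def hsNormSq {n : ℕ} (H : NOp n) : ℝ := (H.conjTranspose * H).trace.re / 2 ^ n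

/-- The traceless part of an observable. -/
def tracelessPart {n : ℕ} (H : NOp n) : NOp n := H - (H.trace / 2 ^ n) • (1 : NOp n)

/-! ### Haar measure, unitary 2-designs, transfer matrices -/

/-- `U(2)` is compact. -/
theorem isCompact_unitary_two : IsCompact (Set.univ : Set U2) := by
  have hemb : Topology.IsInducing (Subtype.val : U2 → Matrix (Fin 2) (Fin 2) ℂ) :=
    Topology.IsInducing.subtypeVal
  rw [hemb.isCompact_iff, Set.image_univ, Subtype.range_coe]
  have hK : IsCompact (Set.pi Set.univ fun _ : Fin 2 => Set.pi Set.univ fun _ : Fin 2 =>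
      Metric.closedBall (0 : ℂ) 1) :=
    isCompact_univ_pi fun _ => isCompact_univ_pi fun _ => isCompact_closedBall _ _
  refine IsCompact.of_isClosed_subset hK ?_ ?_
  · have : ((Matrix.unitaryGroup (Fin 2) ℂ : Submonoid _) : Set (Matrix (Fin 2) (Fin 2) ℂ))
        = {M | M * star M = 1} := by
      ext M
      exact Matrix.mem_unitaryGroup_iff
    rw [this]
    exact isClosed_eq (by fun_prop) continuous_const
  · intro M hM i _ j _
    exact mem_closedBall_zero_iff.2 (entry_norm_bound_of_unitary hM i j)

/-- The Haar probability measure on `U(2)`. -/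
def haarU2 : MeasureTheory.Measure U2 :=
  MeasureTheory.Measure.haarMeasure
    { carrier := Set.univ
      isCompact' := isCompact_unitary_two
      interior_nonempty' := by simp }

/-- Entrywise expectation of a random matrix. -/
def expect {Ω a b : Type*} [MeasurableSpace Ω] (μ : MeasureTheory.Measure Ω)
    (M : Ω → Matrix a b ℂ) : Matrix a b ℂ :=
  Matrix.of fun i j => ∫ ω, M ω i j ∂μ

/-- `W ⊗ W` acting by conjugation on an operator on two copies of a system. -/
def twoCopyConj {a : Type*} [Fintype a] (W : Matrix a a ℂ) (O : Matrix (a × a) (a × a) ℂ) :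
    Matrix (a × a) (a × a) ℂ :=
  (W ⊗ₖ W) * O * (W ⊗ₖ W).conjTranspose

/-- A single-qubit unitary 2-design: the two-copy twirl agrees with that of Haar measure. -/
def IsTwoDesign (E : MeasureTheory.Measure U2) : Prop :=
  MeasureTheory.IsProbabilityMeasure E ∧
    ∀ O : Matrix (Fin 2 × Fin 2) (Fin 2 × Fin 2) ℂ,
      expect E (fun V => twoCopyConj (V : Matrix (Fin 2) (Fin 2) ℂ) O) =
        expect haarU2 (fun V => twoCopyConj (V : Matrix (Fin 2) (Fin 2) ℂ) O)

/-- The trace-one operators `I / 4` (for `0`) and `SWAP / 2` (for `1`) on two copies of a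
qubit. -/
def replica (x : Fin 2) : Matrix (Fin 2 × Fin 2) (Fin 2 × Fin 2) ℂ :=
  if x = 0 then (1 / 4 : ℂ) • 1
  else (1 / 2 : ℂ) • Matrix.of fun a b => if a.1 = b.2 ∧ a.2 = b.1 then 1 else 0

/-- The operator `replica x.1 ⊗ replica x.2` on two copies of a pair of qubits. A basis label
`a` of the two copies is `((first qubit, second qubit), (first qubit, second qubit))`, the two
entries being the labels of the first and of the second copy. -/
def replicaPair (x : Fin 2 × Fin 2) :
    Matrix ((Fin 2 × Fin 2) × (Fin 2 × Fin 2)) ((Fin 2 × Fin 2) × (Fin 2 × Fin 2)) ℂ :=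
  Matrix.of fun a b =>
    replica x.1 (a.1.1, a.2.1) (b.1.1, b.2.1) * replica x.2 (a.1.2, a.2.2) (b.1.2, b.2.2)

/-- The ordering `II, IS, SI, SS` of the two-qubit replica operators. -/
def replicaOrder : Fin 4 → Fin 2 × Fin 2 := ![(0, 0), (0, 1), (1, 0), (1, 1)]

/-- The transfer matrix with entangling power `α` and swapping power `β`. -/
def transferMatrix (α β : ℝ) : Matrix (Fin 4) (Fin 4) ℝ :=
  !![1, 4 * α / 5, 4 * α / 5, 0;
     0, 1 - α - β, β, 0;
     0, β, 1 - α - β, 0;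
     0, α / 5, α / 5, 1]

/-- The random two-qubit unitary `U` has transfer matrix `T`: two copies of `U`, followed by
independent Haar-random single-qubit gates on both qubits, map the replica operator number `s`
on average to `∑ t, T t s • (replica operator number t)`. -/
def HasTransferMatrix {Ω : Type*} [MeasurableSpace Ω] (D : MeasureTheory.Measure Ω)
    (U : Ω → U4) (T : Matrix (Fin 4) (Fin 4) ℝ) : Prop :=
  ∀ s, expect (D.prod (haarU2.prod haarU2))
      (fun w => twoCopyConj
        (((w.2.1 : Matrix (Fin 2) (Fin 2) ℂ) ⊗ₖ (w.2.2 : Matrix (Fin 2) (Fin 2) ℂ)) *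
          (U w.1 : Matrix (Fin 2 × Fin 2) (Fin 2 × Fin 2) ℂ))
        (replicaPair (replicaOrder s))) =
    ∑ t, (T t s : ℂ) • replicaPair (replicaOrder t)

/-! ### Parameterized dynamic circuits -/

/-- Parameter vectors `θ`. -/
abbrev Params (p : ℕ) := Fin p → ℝ

/-- An operation of a parameterized dynamic circuit on `n` qubits: a parameterized single-qubit
gate, a parameterized two-qubit gate, or a (deterministically applied) measurement and
feedforward operation. Constant gates are allowed. -/
inductive Op (n p : ℕ) where
  | single (q : Fin n) (U : Params p → U2) (hU : Measurable U) : Op n p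
  | pair (q r : Fin n) (hqr : q ≠ r) (U : Params p → U4) (hU : Measurable U) : Op n p
  | feedforward (q : Fin n) : Op n p

/-- The gate `U₁` applied when the measurement outcome is `1`. -/
def feedGate (φ ψ : ℝ) : Matrix (Fin 2) (Fin 2) ℂ :=
  !![(Real.cos φ : ℂ) * Complex.exp (-(Complex.I * ψ)), -Complex.I * (Real.sin φ : ℂ);
     -Complex.I * (Real.sin φ : ℂ), (Real.cos φ : ℂ) * Complex.exp (Complex.I * ψ)]

/-- Conjugation `ρ ↦ K ρ K†`. -/
def conj {n : ℕ} (K ρ : NOp n) : NOp n := K * ρ * K.conjTranspose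

/-- The feedforward channel on qubit `q`: measure in the computational basis, do nothing on
outcome `0`, apply `U₁` on outcome `1`, and forget the outcome. -/
def feedChannel {n : ℕ} (φ ψ : ℝ) (q : Fin n) (ρ : NOp n) : NOp n :=
  conj (onQubit q !![1, 0; 0, 0]) ρ + conj (onQubit q (feedGate φ ψ * !![0, 0; 0, 1])) ρ

namespace Op

variable {n p : ℕ}

/-- The qubits on which an operation acts. -/
def support : Op n p → Finset (Fin n)
  | single q _ _ => {q}
  | pair q r _ _ _ => {q, r}
  | feedforward q => {q}

/-- The operation is a two-qubit gate. -/
def IsPair : Op n p → Prop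
  | pair _ _ _ _ _ => True
  | _ => False

/-- The operation is a feedforward operation on qubit `q`. -/
def IsFeedforwardAt (q : Fin n) : Op n p → Prop
  | feedforward q' => q' = q
  | _ => False

/-- The channel of an operation at the parameter vector `θ`. -/
def channel (φ ψ : ℝ) : Op n p → Params p → NOp n → NOp n
  | single q U _, θ, ρ => conj (onQubit q (U θ : Matrix (Fin 2) (Fin 2) ℂ)) ρ
  | pair q r _ U _, θ, ρ =>
      conj (onPair q r (U θ : Matrix (Fin 2 × Fin 2) (Fin 2 × Fin 2) ℂ)) ρ
  | feedforward q, _, ρ => feedChannel φ ψ q ρ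

/-- If the operation is a two-qubit gate, then for `θ ∼ D` it has transfer matrix `T`. -/
def PairHasTransferMatrix (D : MeasureTheory.Measure (Params p))
    (T : Matrix (Fin 4) (Fin 4) ℝ) : Op n p → Prop
  | pair _ _ _ U _ => HasTransferMatrix D U T
  | _ => True

end Op

/-- A parameterized dynamic circuit with `m` operations, in the order in which they are
applied. (A layered circuit is read off layer by layer.) -/
abbrev Circuit (n p m : ℕ) := Fin m → Op n p

namespace Circuit

variable {n p m : ℕ}

/-- The channel of the circuit at the parameter vector `θ`. -/
def run (C : Circuit n p m) (φ ψ : ℝ) (θ : Params p) (ρ : NOp n) : NOp n :=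
  Fin.foldl m (fun σ i => (C i).channel φ ψ θ σ) ρ

/-- The single-qubit unitary `v q` on every qubit `q ∈ A`, and the identity elsewhere. -/
def localUnitary (A : Finset (Fin n)) (v : Fin n → U2) : NOp n :=
  Matrix.of fun x y =>
    ∏ q, (if q ∈ A then (v q : Matrix (Fin 2) (Fin 2) ℂ) else 1) (x q) (y q)

/-- The channel of the circuit with a single-qubit gate `V i q` inserted after operation `i` on
every qubit `q` on which operation `i` acts. -/
def runWith (C : Circuit n p m) (φ ψ : ℝ) (V : Fin m → Fin n → U2) (θ : Params p)
    (ρ : NOp n) : NOp n :=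
  Fin.foldl m
    (fun σ i => conj (localUnitary (C i).support (V i)) ((C i).channel φ ψ θ σ)) ρ

/-- The matrix entries of a map on operators; they determine it when it is linear. -/
def entries (Φ : NOp n → NOp n) : Bits n → Bits n → Bits n → Bits n → ℂ :=
  fun x y x' y' => Φ (Matrix.single x y 1) x' y'

/-- Every parameter controls a single operation (parameter `i` controls operation `owner i`),
and the groups of parameters of different operations are drawn independently. -/
def IndependentlyControlled (C : Circuit n p m) (φ ψ : ℝ)
    (D : MeasureTheory.Measure (Params p)) : Prop :=
  ∃ owner : Fin p → Fin m,
    (∀ i, DependsOn ((C i).channel φ ψ) {l | owner l = i}) ∧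
    ProbabilityTheory.iIndepFun
      (fun (i : Fin m) (θ : Params p) (l : {l : Fin p // owner l = i}) => θ l) D

/-- The ensemble `θ ∼ D` is locally scrambling: for some single-qubit 2-design `E`, the law of
the circuit (as a random channel) does not change when independent single-qubit gates drawn
from `E` are inserted after every operation. -/
def LocallyScrambling (C : Circuit n p m) (φ ψ : ℝ)
    (D : MeasureTheory.Measure (Params p)) : Prop :=
  ∃ E : MeasureTheory.Measure U2, IsTwoDesign E ∧
    ProbabilityTheory.IdentDistrib
      (fun θ : Params p => entries (C.run φ ψ θ))
      (fun w : Params p × (Fin m → Fin n → U2) => entries (C.runWith φ ψ w.2 w.1))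
      D (D.prod (MeasureTheory.Measure.pi fun _ => MeasureTheory.Measure.pi fun _ => E))

/-- `l` is a path from the feedforward operation number `t` to qubit `j` at the end of the
circuit. Here `l s` is the location just before operation number `s` (only times after
operation `t` matter); each later operation either leaves the location unchanged or acts on
both the old and the new location. -/
def IsPath (C : Circuit n p m) (t : Fin m) (l : Fin (m + 1) → Fin n) (j : Fin n) : Prop :=
  (C t).IsFeedforwardAt (l t.succ) ∧
  (∀ s : Fin m, t < s →
    l s.succ = l s.castSucc ∨ (l s.castSucc ∈ (C s).support ∧ l s.succ ∈ (C s).support)) ∧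
  l (Fin.last m) = j

open Classical in
/-- The length of a path: the number of two-qubit gates encountered along it. -/
def pathLength (C : Circuit n p m) (t : Fin m) (l : Fin (m + 1) → Fin n) : ℕ :=
  (Finset.univ.filter fun s : Fin m =>
    t < s ∧ (C s).IsPair ∧ l s.castSucc ∈ (C s).support).card

/-- The feedforward distance of qubit `j`: the minimal length of a path from a feedforward
operation to `j` (`⊤` if there is no such path). -/
def feedforwardDistance (C : Circuit n p m) (j : Fin n) : ℕ∞ :=
  ⨅ (t : Fin m) (l : Fin (m + 1) → Fin n) (_ : C.IsPath t l j), (C.pathLength t l : ℕ∞)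

/-- The worst-case feedforward distance. -/
def worstFeedforwardDistance (C : Circuit n p m) : ℕ∞ := ⨆ j, C.feedforwardDistance j

/-- The loss `Tr (ρ(θ) H)`, where `ρ(θ)` is the output state on input `|0ⁿ⟩⟨0ⁿ|`. -/
def loss (C : Circuit n p m) (φ ψ : ℝ) (H : NOp n) (θ : Params p) : ℝ :=
  (C.run φ ψ θ (Matrix.single 0 0 1) * H).trace.re

end Circuit

end DynCircuit

end

/-! Local scrambling allows independent gates from a single-qubit 2-design to be inserted after
every operation without changing the law of the loss (`variance_loss`). For the circuit with these
gates, consider the Pauli coefficients `coefAt`: the traces of the intermediate state against all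
Pauli strings. Each operation acts on them by a real matrix on the labels of its one or two qubits.
The parameters of an operation, its inserted gates and the past are independent, so the second
moments E[x_a x_b] obey a closed linear recursion (`integral_step`, `stepMoment`). By
`IsTwoDesign.second_moment`, these moments vanish whenever `a` and `b` differ on a qubit that has
been acted on. Finite feedforward distance means that at the end this is every qubit, so the
variance is the sum over a ≠ 0 of c_a² E[x_a²] (`variance_sum_of_uncorrelated`).

It remains to bound E[x_a²] below by a product of local weights `b j` over the support of `a`. The
predicate `Spread` records this bound and is propagated through the circuit (`Spread.opStep`,
`evolution`). A feedforward operation is not unital: its Heisenberg action sends Z to sin²φ I +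
cos²φ Z. After averaging over X, Y and Z this resets the weight of its qubit to sin²φ/3, whatever
came before (`Spread.low_feed`). For a two-qubit gate, the `SI` and `IS` columns of the transfer
matrix give at least α/5 of the squared weight to strings that are trivial on a chosen one of the
two qubits. Hence both outputs inherit α/5 times the larger input weight (`Spread.low_pair`). Along
a shortest path the weight of every final qubit is therefore at least (sin²φ/3)(α/5)^f
(`weightAt_path`).

There is one obstacle. A qubit not yet acted on is still in the state |0⟩, where I and Z are
perfectly correlated. The cross terms may be negative, and the transfer matrix controls squares
only. For a gate that meets one such qubit, a purity estimate valid for every two-qubit unitary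
(`ancilla_bound`) gives the factors 1/3 and 1/9, which suffice because α/5 ≤ 1/5.

Finally, a k-local Hamiltonian has no Pauli coefficient of weight above k
(`IsKLocal.coeff_eq_zero`), so at most k local weights are multiplied. -/

open scoped Kronecker

noncomputable section

namespace DynCircuit

open Matrix

/-! ### Hermitian operator bases and transfer matrices -/

/-- A basis of `d × d` matrices that consists of Hermitian matrices, contains the identity, and
is complete: `∑ k, B k ⊗ B k` is `N` times the swap operator. -/
structure OpBasis (κ d : Type) [Fintype κ] [DecidableEq κ] [Fintype d] [DecidableEq d] where
  B : κ → Matrix d d ℂ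
  N : ℝ
  N_pos : 0 < N
  one : κ
  B_one : B one = 1
  herm : ∀ k, (B k)ᴴ = B k
  trace_mul : ∀ k l, (B k * B l).trace = if k = l then (N : ℂ) else 0
  complete : ∀ i j x y, ∑ k, B k i j * B k x y = if i = y ∧ j = x then (N : ℂ) else 0

namespace OpBasis

variable {κ d : Type} [Fintype κ] [DecidableEq κ] [Fintype d] [DecidableEq d] (P : OpBasis κ d)

theorem expand (M : Matrix d d ℂ) : M = ∑ k, ((M * P.B k).trace / P.N) • P.B k := by
  have hN : (P.N : ℂ) ≠ 0 := by exact_mod_cast P.N_pos.ne'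
  ext x y
  simp only [Matrix.sum_apply, Matrix.smul_apply, smul_eq_mul, Matrix.trace, Matrix.diag,
    Matrix.mul_apply, Finset.sum_div, Finset.sum_mul]
  have : ∀ k i j, M i j * P.B k j i / P.N * P.B k x y
      = M i j / P.N * (P.B k j i * P.B k x y) := by intros; ring
  simp only [this]
  rw [Finset.sum_comm]
  have h2 : ∀ i, ∑ k, ∑ j, M i j / P.N * (P.B k j i * P.B k x y)
      = ∑ j, M i j / P.N * (if j = y ∧ i = x then (P.N : ℂ) else 0) := by
    intro i
    rw [Finset.sum_comm]
    exact Finset.sum_congr rfl fun j _ => by rw [← Finset.mul_sum, P.complete]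
  simp only [h2]
  rw [Finset.sum_eq_single x, Finset.sum_eq_single y]
  · simp [hN]
  · intro b _ hb; simp [hb]
  · simp
  · intro b _ hb; simp [hb]
  · simp

theorem trace_herm_im {M : Matrix d d ℂ} (hM : Mᴴ = M) (k : κ) : ((M * P.B k).trace).im = 0 := by
  have h : star ((M * P.B k).trace) = (M * P.B k).trace := by
    rw [← Matrix.trace_conjTranspose, Matrix.conjTranspose_mul, P.herm, hM, Matrix.trace_mul_comm]
  exact Complex.conj_eq_iff_im.1 h

theorem expand_herm {M : Matrix d d ℂ} (hM : Mᴴ = M) :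
    M = ∑ k, (((M * P.B k).trace.re / P.N : ℝ) : ℂ) • P.B k := by
  conv_lhs => rw [P.expand M]
  refine Finset.sum_congr rfl fun k _ => ?_
  congr 1
  have : (M * P.B k).trace = ((M * P.B k).trace.re : ℂ) :=
    Complex.ext (by simp) (by simp [P.trace_herm_im hM])
  rw [this]; push_cast; simp

/-- Parseval's identity for Hermitian matrices. -/
theorem parseval {M : Matrix d d ℂ} (hM : Mᴴ = M) :
    ∑ i, ∑ j, Complex.normSq (M i j) = P.N * ∑ k, ((M * P.B k).trace.re / P.N) ^ 2 := by
  have h1 : (M * M).trace = ((P.N * ∑ k, ((M * P.B k).trace.re / P.N) ^ 2 : ℝ) : ℂ) := by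
    have hN : (P.N : ℂ) ≠ 0 := by exact_mod_cast P.N_pos.ne'
    have : M * M = ∑ k, (((M * P.B k).trace.re / P.N : ℝ) : ℂ) • (M * P.B k) := by
      conv_lhs => rw [P.expand_herm hM]
      -- The preceding rewrite expands both factors; the left one is folded back.
      conv_lhs => enter [1]; rw [← P.expand_herm hM]
      rw [Finset.mul_sum]
      exact Finset.sum_congr rfl fun k _ => by rw [Matrix.mul_smul]
    rw [this, Matrix.trace_sum]
    push_cast
    rw [Finset.mul_sum]
    refine Finset.sum_congr rfl fun k _ => ?_
    rw [Matrix.trace_smul, smul_eq_mul]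
    have h2 : (M * P.B k).trace = ((M * P.B k).trace.re : ℂ) :=
      Complex.ext (by simp) (by simp [P.trace_herm_im hM])
    rw [h2]
    simp only [Complex.ofReal_re]
    field_simp
  have h3 : (M * M).trace = ((∑ i, ∑ j, Complex.normSq (M i j) : ℝ) : ℂ) := by
    simp only [Matrix.trace, Matrix.diag, Matrix.mul_apply]
    push_cast
    refine Finset.sum_congr rfl fun i _ => Finset.sum_congr rfl fun j _ => ?_
    rw [← Complex.mul_conj]
    congr 1
    conv_lhs => rw [← hM]
    rfl
  exact_mod_cast h3.symm.trans h1

/-- The transfer matrix of the Heisenberg action `M ↦ U† M U` in the operator basis. -/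
def ptm (U : Matrix d d ℂ) (k l : κ) : ℝ := ((Uᴴ * P.B k * U) * P.B l).trace.re / P.N

theorem conj_herm (U : Matrix d d ℂ) (k : κ) : (Uᴴ * P.B k * U)ᴴ = Uᴴ * P.B k * U := by
  rw [Matrix.conjTranspose_mul, Matrix.conjTranspose_mul, P.herm, Matrix.conjTranspose_conjTranspose,
    Matrix.mul_assoc]

theorem conj_eq (U : Matrix d d ℂ) (k : κ) :
    Uᴴ * P.B k * U = ∑ l, (P.ptm U k l : ℂ) • P.B l :=
  P.expand_herm (P.conj_herm U k)

theorem ofReal_ptm (U : Matrix d d ℂ) (k l : κ) :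
    (P.ptm U k l : ℂ) = ((Uᴴ * P.B k * U) * P.B l).trace / P.N := by
  have h2 : ((Uᴴ * P.B k * U) * P.B l).trace = (((Uᴴ * P.B k * U) * P.B l).trace.re : ℂ) :=
      Complex.ext (by simp) (by simp [P.trace_herm_im (P.conj_herm U k)])
  rw [h2, ptm]; push_cast; rfl

/-- In the Heisenberg picture the left factor acts first, (UW)†B(UW) = W†(U†BU)W, so the order of
multiplication is preserved. -/
theorem ptm_mul (U W : Matrix d d ℂ) (k l : κ) :
    P.ptm (U * W) k l = ∑ j, P.ptm U k j * P.ptm W j l := by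
  have h : (U * W)ᴴ * P.B k * (U * W) = ∑ j, (P.ptm U k j : ℂ) • (Wᴴ * P.B j * W) := by
    have : (U * W)ᴴ * P.B k * (U * W) = Wᴴ * (Uᴴ * P.B k * U) * W := by
      rw [Matrix.conjTranspose_mul]; simp only [Matrix.mul_assoc]
    rw [this, P.conj_eq U k, Finset.mul_sum, Finset.sum_mul]
    simp
  have h2 : (P.ptm (U * W) k l : ℂ) = ((∑ j, P.ptm U k j * P.ptm W j l : ℝ) : ℂ) := by
    rw [P.ofReal_ptm, h, Finset.sum_mul, Matrix.trace_sum, Finset.sum_div]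
    push_cast
    refine Finset.sum_congr rfl fun j _ => ?_
    rw [P.ofReal_ptm W, Matrix.smul_mul, Matrix.trace_smul, smul_eq_mul, mul_div_assoc]
  exact_mod_cast h2

theorem ptm_one (k l : κ) : P.ptm 1 k l = if k = l then 1 else 0 := by
  rw [ptm]
  simp only [Matrix.conjTranspose_one, Matrix.one_mul, Matrix.mul_one, P.trace_mul]
  split_ifs
  · simp [P.N_pos.ne']
  · simp

theorem ptm_conjTranspose (U : Matrix d d ℂ) (k l : κ) : P.ptm Uᴴ k l = P.ptm U l k := by
  rw [ptm, ptm, Matrix.conjTranspose_conjTranspose]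
  congr 2
  rw [Matrix.trace_mul_comm (U * P.B k * Uᴴ)]
  rw [← Matrix.mul_assoc, ← Matrix.mul_assoc, Matrix.trace_mul_comm, ← Matrix.mul_assoc,
    ← Matrix.mul_assoc]

/-- For unitary U the transfer matrix is orthogonal: it is multiplicative, and its transpose belongs
to U†. -/
theorem sum_ptm_row {U : Matrix d d ℂ} (hU : U ∈ Matrix.unitaryGroup d ℂ) (k l : κ) :
    ∑ j, P.ptm U k j * P.ptm U l j = if k = l then 1 else 0 := by
  rw [← P.ptm_one, ← Matrix.mem_unitaryGroup_iff.1 hU, Matrix.star_eq_conjTranspose, P.ptm_mul]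
  simp only [P.ptm_conjTranspose]

theorem sum_ptm_col {U : Matrix d d ℂ} (hU : U ∈ Matrix.unitaryGroup d ℂ) (k l : κ) :
    ∑ j, P.ptm U j k * P.ptm U j l = if k = l then 1 else 0 := by
  rw [← P.ptm_one, ← Matrix.mem_unitaryGroup_iff'.1 hU, Matrix.star_eq_conjTranspose, P.ptm_mul]
  simp only [P.ptm_conjTranspose]

theorem ptm_unit_left {U : Matrix d d ℂ} (hU : U ∈ Matrix.unitaryGroup d ℂ) (l : κ) :
    P.ptm U P.one l = if P.one = l then 1 else 0 := by
  rw [← P.ptm_one, ptm, ptm, P.B_one, Matrix.mul_one, ← Matrix.star_eq_conjTranspose,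
    Matrix.mem_unitaryGroup_iff'.1 hU]
  simp

theorem abs_ptm_le {U : Matrix d d ℂ} (hU : U ∈ Matrix.unitaryGroup d ℂ) (k l : κ) :
    |P.ptm U k l| ≤ 1 := by
  have h := P.sum_ptm_row hU k k
  simp only [if_true] at h
  have h2 : P.ptm U k l * P.ptm U k l ≤ ∑ j, P.ptm U k j * P.ptm U k j :=
    Finset.single_le_sum (f := fun j => P.ptm U k j * P.ptm U k j)
      (fun j _ => mul_self_nonneg _) (Finset.mem_univ l)
  rw [h] at h2
  exact abs_le_one_iff_mul_self_le_one.2 h2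

theorem continuous_ptm (k l : κ) : Continuous fun U : Matrix d d ℂ => P.ptm U k l := by
  refine (Complex.continuous_re.comp (Continuous.matrix_trace ?_)).div_const _
  exact ((continuous_id.matrix_conjTranspose.matrix_mul continuous_const).matrix_mul
    continuous_id).matrix_mul continuous_const

end OpBasis

theorem pauli_complete (i j x y : Fin 2) :
    ∑ k, pauli k i j * pauli k x y = if i = y ∧ j = x then ((2 : ℝ) : ℂ) else 0 := by
  fin_cases i <;> fin_cases j <;> fin_cases x <;> fin_cases y <;>
    simp [pauli, Fin.sum_univ_four] <;> norm_num

theorem pauli_trace_mul (k l : Fin 4) :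
    (pauli k * pauli l).trace = if k = l then ((2 : ℝ) : ℂ) else 0 := by
  fin_cases k <;> fin_cases l <;> simp [pauli, Matrix.trace_fin_two] <;> norm_num

theorem pauli_herm (k : Fin 4) : (pauli k)ᴴ = pauli k := by
  fin_cases k <;> ext i j <;> fin_cases i <;> fin_cases j <;> simp [pauli]

/-- The Pauli basis of single-qubit operators. -/
def basis1 : OpBasis (Fin 4) (Fin 2) where
  B := pauli
  N := 2
  N_pos := by norm_num
  one := 0
  B_one := rfl
  herm := pauli_herm
  trace_mul := pauli_trace_mul
  complete := pauli_complete

/-- The Pauli basis of two-qubit operators. -/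
def basis2 : OpBasis (Fin 4 × Fin 4) (Fin 2 × Fin 2) where
  B k := pauli k.1 ⊗ₖ pauli k.2
  N := 4
  N_pos := by norm_num
  one := (0, 0)
  B_one := by simp [pauli]
  herm k := by rw [Matrix.conjTranspose_kronecker, pauli_herm, pauli_herm]
  trace_mul k l := by
    rw [← Matrix.mul_kronecker_mul, Matrix.trace_kronecker, pauli_trace_mul, pauli_trace_mul]
    simp only [Prod.ext_iff]
    split_ifs <;> simp_all <;> norm_num
  complete i j x y := by
    simp only [Matrix.kroneckerMap_apply]
    have : ∀ k : Fin 4 × Fin 4, pauli k.1 i.1 j.1 * pauli k.2 i.2 j.2 *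
        (pauli k.1 x.1 y.1 * pauli k.2 x.2 y.2)
        = (pauli k.1 i.1 j.1 * pauli k.1 x.1 y.1) * (pauli k.2 i.2 j.2 * pauli k.2 x.2 y.2) := by
      intros; ring
    simp only [this]
    rw [← Finset.univ_product_univ, Finset.sum_product]
    simp only [← Finset.mul_sum, ← Finset.sum_mul, pauli_complete]
    simp only [Prod.ext_iff]
    split_ifs <;> simp_all <;> norm_num

theorem ptm_kronecker (V W : Matrix (Fin 2) (Fin 2) ℂ) (k l : Fin 4 × Fin 4) :
    basis2.ptm (V ⊗ₖ W) k l = basis1.ptm V k.1 l.1 * basis1.ptm W k.2 l.2 := by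
  have h : (basis2.ptm (V ⊗ₖ W) k l : ℂ)
      = ((basis1.ptm V k.1 l.1 * basis1.ptm W k.2 l.2 : ℝ) : ℂ) := by
    push_cast
    rw [basis2.ofReal_ptm, basis1.ofReal_ptm, basis1.ofReal_ptm]
    simp only [basis1, basis2, Matrix.conjTranspose_kronecker, ← Matrix.mul_kronecker_mul,
      Matrix.trace_kronecker]
    push_cast
    ring
  exact_mod_cast h

end DynCircuit

namespace DynCircuit

open Matrix MeasureTheory

/-! ### Twirling over a single-qubit 2-design -/

instance : CompactSpace U2 := ⟨isCompact_unitary_two⟩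

instance : IsProbabilityMeasure haarU2 :=
  ⟨by simpa [haarU2] using Measure.haarMeasure_self (G := U2) (K₀ :=
    { carrier := Set.univ
      isCompact' := isCompact_unitary_two
      interior_nonempty' := by simp })⟩

instance : haarU2.IsMulLeftInvariant := by unfold haarU2; infer_instance

theorem integrable_of_continuous {E : Measure U2} [IsProbabilityMeasure E] {F : Type*}
    [NormedAddCommGroup F] [SecondCountableTopology F] {f : U2 → F} (hf : Continuous f) : Integrable f E := by
  let _ : MeasurableSpace F := borel F
  have _ : BorelSpace F := ⟨rfl⟩
  exact hf.integrable_of_hasCompactSupport (HasCompactSupport.of_compactSpace f)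

theorem OpBasis.ptm_of_conj {κ d : Type} [Fintype κ] [DecidableEq κ] [Fintype d] [DecidableEq d]
    (P : OpBasis κ d) {U : Matrix d d ℂ} {k k' : κ} {s : ℝ}
    (h : Uᴴ * P.B k * U = (s : ℂ) • P.B k') (l : κ) :
    P.ptm U k l = if k' = l then s else 0 := by
  rw [OpBasis.ptm, h, Matrix.smul_mul, Matrix.trace_smul, P.trace_mul]
  have := P.N_pos.ne'
  split_ifs
  · simp [this]
  · simp

/-- The transfer matrix of a single-qubit unitary in the Pauli basis. -/
def rot (V : U2) (a c : Fin 4) : ℝ := basis1.ptm (V : Matrix (Fin 2) (Fin 2) ℂ) a c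

theorem continuous_rot (a c : Fin 4) : Continuous fun V => rot V a c :=
  (basis1.continuous_ptm a c).comp continuous_subtype_val

theorem rot_mul (V W : U2) (a c : Fin 4) : rot (V * W) a c = ∑ b, rot V a b * rot W b c :=
  basis1.ptm_mul _ _ _ _

theorem rot_zero_left (V : U2) (c : Fin 4) : rot V 0 c = if 0 = c then 1 else 0 :=
  basis1.ptm_unit_left V.2 c

theorem sum_rot_col (V : U2) (c d : Fin 4) :
    ∑ a, rot V a c * rot V a d = if c = d then 1 else 0 := basis1.sum_ptm_col V.2 c d

theorem sum_rot_row (V : U2) (c d : Fin 4) :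
    ∑ a, rot V c a * rot V d a = if c = d then 1 else 0 := basis1.sum_ptm_row V.2 c d

theorem abs_rot_le (V : U2) (a c : Fin 4) : |rot V a c| ≤ 1 := basis1.abs_ptm_le V.2 a c

theorem integrable_rot_mul (E : Measure U2) [IsProbabilityMeasure E] (a c b d : Fin 4) :
    Integrable (fun V => rot V a c * rot V b d) E :=
  integrable_of_continuous ((continuous_rot a c).mul (continuous_rot b d))

/-- Left invariance of Haar measure under a Clifford gate, whose transfer matrix is a signed
permutation, becomes a symmetry of the second moments in their row labels. -/
theorem haar_signed_perm (W : U2) (σ : Fin 4 → Fin 4) (s : Fin 4 → ℝ)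
    (h : ∀ a b, rot W a b = if σ a = b then s a else 0) (a c b d : Fin 4) :
    ∫ V, rot V a c * rot V b d ∂haarU2
      = s a * s b * ∫ V, rot V (σ a) c * rot V (σ b) d ∂haarU2 := by
  rw [← integral_mul_left_eq_self _ W, ← integral_const_mul]
  congr 1
  ext V
  simp only [rot_mul, h, ite_mul, zero_mul, Finset.sum_ite_eq, Finset.mem_univ, if_true]
  ring

/-- The sign that conjugation by `X` (for `0`) or `Z` gives to the Pauli matrices. -/
def pauliSign : Fin 2 → Fin 4 → ℝ := ![![1, 1, -1, -1], ![1, -1, -1, 1]]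

theorem pauliX_mem : pauli 1 ∈ Matrix.unitaryGroup (Fin 2) ℂ := by
  rw [Matrix.mem_unitaryGroup_iff, Matrix.star_eq_conjTranspose, pauli_herm]
  ext i j; fin_cases i <;> fin_cases j <;> simp [pauli, Matrix.mul_apply]

theorem pauliZ_mem : pauli 3 ∈ Matrix.unitaryGroup (Fin 2) ℂ := by
  rw [Matrix.mem_unitaryGroup_iff, Matrix.star_eq_conjTranspose, pauli_herm]
  ext i j; fin_cases i <;> fin_cases j <;> simp [pauli, Matrix.mul_apply]

theorem rot_pauliX (a b : Fin 4) :
    rot ⟨pauli 1, pauliX_mem⟩ a b = if id a = b then pauliSign 0 a else 0 := by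
  refine basis1.ptm_of_conj ?_ b
  rw [pauli_herm]
  ext i j
  fin_cases a <;> fin_cases i <;> fin_cases j <;>
    simp [basis1, pauli, pauliSign, Matrix.mul_apply]

theorem rot_pauliZ (a b : Fin 4) :
    rot ⟨pauli 3, pauliZ_mem⟩ a b = if id a = b then pauliSign 1 a else 0 := by
  refine basis1.ptm_of_conj ?_ b
  rw [pauli_herm]
  ext i j
  fin_cases a <;> fin_cases i <;> fin_cases j <;>
    simp [basis1, pauli, pauliSign, Matrix.mul_apply]

/-- A Clifford gate that permutes the non-identity Pauli matrices cyclically. -/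
def cyclicGate : Matrix (Fin 2) (Fin 2) ℂ :=
  !![(1 - Complex.I) / 2, (-1 - Complex.I) / 2; (1 - Complex.I) / 2, (1 + Complex.I) / 2]

theorem cyclicGate_mem : cyclicGate ∈ Matrix.unitaryGroup (Fin 2) ℂ := by
  rw [Matrix.mem_unitaryGroup_iff]
  ext i j
  fin_cases i <;> fin_cases j <;>
    simp [cyclicGate, Matrix.mul_apply, Matrix.star_apply, map_ofNat] <;> ring_nf <;> norm_num

theorem rot_cyclicGate (a b : Fin 4) :
    rot ⟨cyclicGate, cyclicGate_mem⟩ a b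
      = if (![0, 3, 1, 2] : Fin 4 → Fin 4) a = b then (1 : Fin 4 → ℝ) a else 0 := by
  refine basis1.ptm_of_conj ?_ b
  ext i j
  fin_cases a <;> fin_cases i <;> fin_cases j <;>
    simp [basis1, pauli, cyclicGate, Matrix.mul_apply, map_ofNat] <;> ring_nf <;> norm_num <;> ring

/-- The second moments of the transfer matrix of a single-qubit 2-design: probabilities of
the transitions between diagonal Pauli labels. -/
def twirl1 (a e : Fin 4) : ℝ :=
  if a = 0 then (if e = 0 then 1 else 0) else (if e = 0 then 0 else 1 / 3)

/-- Three Clifford symmetries suffice. Invariance under X and Z kills the moments with a ≠ b by a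
sign, and the cyclic gate makes the rows 1, 2, 3 equal. Orthogonality of the columns then fixes
their common value, once the known row 0 is subtracted. -/
theorem haar_second_moment (a c b d : Fin 4) :
    ∫ V, rot V a c * rot V b d ∂haarU2 = if a = b ∧ c = d then twirl1 a c else 0 := by
  have hX := haar_signed_perm _ _ _ rot_pauliX
  have hZ := haar_signed_perm _ _ _ rot_pauliZ
  have hC := haar_signed_perm _ _ _ rot_cyclicGate
  simp only [id] at hX hZ
  by_cases hab : a = b
  · subst hab
    simp only [true_and]
    by_cases ha : a = 0
    · subst ha
      simp only [rot_zero_left, twirl1, if_true]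
      by_cases hc : c = d
      · subst hc
        by_cases hc0 : c = 0 <;> simp [hc0, eq_comm]
      · rw [if_neg hc]
        by_cases hc0 : 0 = c
        · simp [← hc0, show ¬ 0 = d from fun h => hc (hc0.symm.trans h)]
        · simp [hc0]
    · have hs : ∑ a, ∫ V, rot V a c * rot V a d ∂haarU2 = if c = d then 1 else 0 := by
        rw [← integral_finsetSum _ fun i _ => integrable_rot_mul _ _ _ _ _]
        simp [sum_rot_col]
      have h0 : ∫ V, rot V 0 c * rot V 0 d ∂haarU2 = if c = 0 ∧ d = 0 then 1 else 0 := by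
        simp only [rot_zero_left]
        by_cases hc0 : c = 0 <;> by_cases hd0 : d = 0 <;> simp [hc0, hd0, eq_comm]
      have h1 := hC 1 c 1 d
      have h2 := hC 2 c 2 d
      simp only [Pi.one_apply, one_mul, Matrix.cons_val] at h1 h2
      rw [Fin.sum_univ_four, h0] at hs
      have ha' : ∫ V, rot V a c * rot V a d ∂haarU2 = ∫ V, rot V 1 c * rot V 1 d ∂haarU2 := by
        fin_cases a
        · exact absurd rfl ha
        · rfl
        · exact h2
        · exact h1.symm
      rw [ha', twirl1, if_neg ha]
      rw [h2, ← h1] at hs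
      by_cases hc : c = d
      · subst hc
        by_cases hc0 : c = 0 <;> simp [hc0] at hs ⊢ <;> linarith
      · rw [if_neg hc] at hs ⊢
        rw [if_neg (by rintro ⟨rfl, rfl⟩; exact hc rfl)] at hs
        linarith
  · rw [if_neg (fun h => hab h.1)]
    have h1 := hX a c b d
    have h2 := hZ a c b d
    generalize ∫ V, rot V a c * rot V b d ∂haarU2 = J at h1 h2
    fin_cases a <;> fin_cases b <;> first
      | exact absurd rfl hab
      | (simp [pauliSign] at h1 h2; linarith)

theorem ofReal_rot (V : U2) (a c : Fin 4) :
    (rot V a c : ℂ) = (pauli a * ((V : Matrix (Fin 2) (Fin 2) ℂ) * pauli c *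
      (V : Matrix (Fin 2) (Fin 2) ℂ)ᴴ)).trace / 2 := by
  rw [rot, basis1.ofReal_ptm]
  congr 1
  simp only [basis1]
  rw [Matrix.mul_assoc, Matrix.mul_assoc, Matrix.trace_mul_comm]
  simp only [Matrix.mul_assoc]

/-- A product of two entries of `rot V` is a fixed linear functional of a two-copy conjugation. This
is what carries the Haar moments over to an arbitrary 2-design. -/
theorem rot_mul_rot_eq (V : U2) (a c b d : Fin 4) :
    ((rot V a c * rot V b d : ℝ) : ℂ) = ∑ x, ∑ y, ((pauli a ⊗ₖ pauli b) x y / 4) *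
      twoCopyConj (V : Matrix (Fin 2) (Fin 2) ℂ) (pauli c ⊗ₖ pauli d) y x := by
  have h : twoCopyConj (V : Matrix (Fin 2) (Fin 2) ℂ) (pauli c ⊗ₖ pauli d)
      = ((V : Matrix (Fin 2) (Fin 2) ℂ) * pauli c * (V : Matrix (Fin 2) (Fin 2) ℂ)ᴴ) ⊗ₖ
        ((V : Matrix (Fin 2) (Fin 2) ℂ) * pauli d * (V : Matrix (Fin 2) (Fin 2) ℂ)ᴴ) := by
    rw [twoCopyConj, Matrix.conjTranspose_kronecker, ← Matrix.mul_kronecker_mul,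
      ← Matrix.mul_kronecker_mul]
  have h2 : ((pauli a ⊗ₖ pauli b) * twoCopyConj (V : Matrix (Fin 2) (Fin 2) ℂ)
      (pauli c ⊗ₖ pauli d)).trace = 4 * (rot V a c * rot V b d : ℝ) := by
    rw [h, ← Matrix.mul_kronecker_mul, Matrix.trace_kronecker]
    push_cast
    rw [ofReal_rot, ofReal_rot]
    ring
  have h3 : ((rot V a c * rot V b d : ℝ) : ℂ) = ((pauli a ⊗ₖ pauli b) *
      twoCopyConj (V : Matrix (Fin 2) (Fin 2) ℂ) (pauli c ⊗ₖ pauli d)).trace / 4 := by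
    rw [h2]; ring
  rw [h3, Matrix.trace, Finset.sum_div]
  refine Finset.sum_congr rfl fun x _ => ?_
  rw [Matrix.diag, Matrix.mul_apply, Finset.sum_div]
  exact Finset.sum_congr rfl fun y _ => by ring

theorem integral_rot_mul_eq (E : Measure U2) [IsProbabilityMeasure E] (a c b d : Fin 4) :
    ((∫ V, rot V a c * rot V b d ∂E : ℝ) : ℂ) =
      ∑ x, ∑ y, ((pauli a ⊗ₖ pauli b) x y / 4) *
        expect E (fun V => twoCopyConj (V : Matrix (Fin 2) (Fin 2) ℂ) (pauli c ⊗ₖ pauli d)) y x := by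
  have hint : ∀ x y, Integrable (fun V : U2 => ((pauli a ⊗ₖ pauli b) x y / 4) *
      twoCopyConj (V : Matrix (Fin 2) (Fin 2) ℂ) (pauli c ⊗ₖ pauli d) y x) E := by
    intro x y
    refine integrable_of_continuous (continuous_const.mul ?_)
    unfold twoCopyConj
    have hk : Continuous fun V : U2 =>
        (V : Matrix (Fin 2) (Fin 2) ℂ) ⊗ₖ (V : Matrix (Fin 2) (Fin 2) ℂ) := by
      refine continuous_matrix fun i j => ?_
      simp only [Matrix.kroneckerMap_apply]
      exact (continuous_subtype_val.matrix_elem _ _).mul (continuous_subtype_val.matrix_elem _ _)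
    exact ((hk.matrix_mul continuous_const).matrix_mul hk.matrix_conjTranspose).matrix_elem _ _
  rw [← integral_complex_ofReal]
  simp only [rot_mul_rot_eq]
  rw [integral_finsetSum _ fun x _ => integrable_finsetSum _ fun y _ => hint x y]
  refine Finset.sum_congr rfl fun x _ => ?_
  rw [integral_finsetSum _ fun y _ => hint x y]
  refine Finset.sum_congr rfl fun y _ => ?_
  exact integral_const_mul _ _

theorem IsTwoDesign.second_moment {E : Measure U2} (hE : IsTwoDesign E) (a c b d : Fin 4) :
    ∫ V, rot V a c * rot V b d ∂E = if a = b ∧ c = d then twirl1 a c else 0 := by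
  have := hE.1
  rw [← haar_second_moment]
  have h := integral_rot_mul_eq E a c b d
  rw [hE.2, ← integral_rot_mul_eq haarU2] at h
  exact_mod_cast h

end DynCircuit

namespace DynCircuit

open Matrix MeasureTheory

/-! ### A qubit that enters a two-qubit gate in the state `|0⟩` -/

/-- The squared length of the Heisenberg image of the Pauli operator number `c` when the second
input qubit is in the state `|0⟩`. -/
def ancillaWeight (U : Matrix (Fin 2 × Fin 2) (Fin 2 × Fin 2) ℂ) (c : Fin 4 × Fin 4) : ℝ :=
  ∑ a, (basis2.ptm U c (a, 0) + basis2.ptm U c (a, 3)) ^ 2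

/-- Since I + Z = 2|0⟩⟨0|, the sum over labels 0 and 3 compresses the second qubit to |0⟩; Parseval
on the first qubit does the rest. -/
theorem ancillaWeight_eq (U : Matrix (Fin 2 × Fin 2) (Fin 2 × Fin 2) ℂ) (c : Fin 4 × Fin 4) :
    2 * ancillaWeight U c
      = ∑ i, ∑ j, Complex.normSq ((Uᴴ * basis2.B c * U) (i, 0) (j, 0)) := by
  set M := Uᴴ * basis2.B c * U with hM
  have hMh : Mᴴ = M := basis2.conj_herm U c
  set n : Matrix (Fin 2) (Fin 2) ℂ := Matrix.of fun i j => M (i, 0) (j, 0) with hn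
  have hnh : nᴴ = n := by
    ext i j
    exact congrFun (congrFun hMh (i, 0)) (j, 0)
  have h := basis1.parseval hnh
  have hN : basis1.N = 2 := rfl
  rw [hN] at h
  change _ = ∑ i, ∑ j, Complex.normSq (n i j)
  rw [h, ancillaWeight]
  congr 1
  refine Finset.sum_congr rfl fun a _ => ?_
  congr 1
  rw [OpBasis.ptm, OpBasis.ptm, ← add_div, ← Complex.add_re, ← Matrix.trace_add, ← Matrix.mul_add,
    ← hM]
  have hB : basis2.B (a, 0) + basis2.B (a, 3) = pauli a ⊗ₖ !![2, 0; 0, 0] := by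
    simp only [basis2]
    rw [← Matrix.kronecker_add]
    congr 1
    ext i j; fin_cases i <;> fin_cases j <;> simp [pauli] <;> norm_num
  rw [hB]
  have : (M * (pauli a ⊗ₖ !![2, 0; 0, 0])).trace = 2 * (n * pauli a).trace := by
    simp [Matrix.trace, Matrix.mul_apply, Fintype.sum_prod_type, Fin.sum_univ_two, hn]
    ring
  rw [this]
  have h4 : basis2.N = 4 := rfl
  have h1 : basis1.B a = pauli a := rfl
  rw [h4, h1]
  simp
  ring

theorem basis2_mem (c : Fin 4 × Fin 4) : basis2.B c ∈ Matrix.unitaryGroup (Fin 2 × Fin 2) ℂ := by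
  have h : ∀ a, pauli a * pauli a = 1 := by
    intro a
    ext i j
    fin_cases a <;> fin_cases i <;> fin_cases j <;> simp [pauli, Matrix.mul_apply]
  rw [Matrix.mem_unitaryGroup_iff, Matrix.star_eq_conjTranspose, basis2.herm]
  simp only [basis2]
  rw [← Matrix.mul_kronecker_mul, h, h, Matrix.one_kronecker_one]

theorem sum_normSq_row {d : Type} [Fintype d] [DecidableEq d] {U : Matrix d d ℂ}
    (hU : U ∈ Matrix.unitaryGroup d ℂ) (x : d) : ∑ y, Complex.normSq (U x y) = 1 := by
  have h := congrFun (congrFun (Matrix.mem_unitaryGroup_iff.1 hU) x) x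
  rw [Matrix.mul_apply, Matrix.one_apply_eq] at h
  have : ((∑ y, Complex.normSq (U x y) : ℝ) : ℂ) = 1 := by
    rw [← h]; push_cast
    exact Finset.sum_congr rfl fun y _ => by rw [Matrix.star_apply, ← Complex.mul_conj]; rfl
  exact_mod_cast this

/-- The Heisenberg image of a Pauli operator is unitary, and the compression keeps part of two of
its rows, each of norm one. -/
theorem ancillaWeight_le_one {U : Matrix (Fin 2 × Fin 2) (Fin 2 × Fin 2) ℂ}
    (hU : U ∈ Matrix.unitaryGroup (Fin 2 × Fin 2) ℂ) (c : Fin 4 × Fin 4) :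
    ancillaWeight U c ≤ 1 := by
  have hM : Uᴴ * basis2.B c * U ∈ Matrix.unitaryGroup (Fin 2 × Fin 2) ℂ :=
    mul_mem (mul_mem (Unitary.star_mem hU) (basis2_mem c)) hU
  have h := ancillaWeight_eq U c
  have h0 := sum_normSq_row hM (0, 0)
  have h1 := sum_normSq_row hM (1, 0)
  simp only [Fintype.sum_prod_type, Fin.sum_univ_two] at h h0 h1
  have hp := fun i j => Complex.normSq_nonneg ((Uᴴ * basis2.B c * U) i j)
  linarith [hp (0, 0) (0, 1), hp (0, 0) (1, 1), hp (1, 0) (0, 1), hp (1, 0) (1, 1)]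

/-- For each of the four labels `a`, the sum of two orthonormal columns of the transfer matrix has
squared norm 2. -/
theorem sum_ancillaWeight {U : Matrix (Fin 2 × Fin 2) (Fin 2 × Fin 2) ℂ}
    (hU : U ∈ Matrix.unitaryGroup (Fin 2 × Fin 2) ℂ) : ∑ c, ancillaWeight U c = 8 := by
  unfold ancillaWeight
  rw [Finset.sum_comm]
  have : ∀ a, ∑ c, (basis2.ptm U c (a, 0) + basis2.ptm U c (a, 3)) ^ 2 = 2 := by
    intro a
    have h0 := basis2.sum_ptm_col hU (a, 0) (a, 0)
    have h1 := basis2.sum_ptm_col hU (a, 3) (a, 3)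
    have h2 := basis2.sum_ptm_col hU (a, 0) (a, 3)
    simp only [if_true] at h0 h1
    rw [if_neg (by simp)] at h2
    have : ∀ c, (basis2.ptm U c (a, 0) + basis2.ptm U c (a, 3)) ^ 2
        = basis2.ptm U c (a, 0) * basis2.ptm U c (a, 0)
          + basis2.ptm U c (a, 3) * basis2.ptm U c (a, 3)
          + 2 * (basis2.ptm U c (a, 0) * basis2.ptm U c (a, 3)) := by intros; ring
    simp only [this]
    rw [Finset.sum_add_distrib, Finset.sum_add_distrib, ← Finset.mul_sum, h0, h1, h2]
    norm_num
  simp only [this]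
  norm_num

theorem ancillaWeight_one {U : Matrix (Fin 2 × Fin 2) (Fin 2 × Fin 2) ℂ}
    (hU : U ∈ Matrix.unitaryGroup (Fin 2 × Fin 2) ℂ) : ancillaWeight U (0, 0) = 1 := by
  have h := fun l => basis2.ptm_unit_left hU l
  have h1 : basis2.one = (0, 0) := rfl
  rw [h1] at h
  simp [ancillaWeight, h]

/-- The reduced state of an isometry from one to two qubits has at least the minimal purity. -/
theorem two_le_purity (u : Fin 2 → Fin 2 → Fin 2 → ℂ)
    (hu : ∀ j, ∑ i, ∑ k, Complex.normSq (u i k j) = 1) :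
    2 ≤ ∑ j, ∑ j', ∑ i, ∑ i', Complex.normSq (∑ k, star (u i k j) * u i' k j') := by
  -- Regrouping the quartic sum turns it into the squared Hilbert-Schmidt norm of a 2 × 2 Gram
  -- matrix in `k`. Its trace is p + q = 2, so the diagonal alone contributes p² + q² ≥ 2.
  have h : ∑ j, ∑ j', ∑ i, ∑ i', Complex.normSq (∑ k, star (u i k j) * u i' k j')
      = ∑ k, ∑ k', Complex.normSq (∑ i, ∑ j, star (u i k j) * u i k' j) := by
    have hc : ((∑ j, ∑ j', ∑ i, ∑ i', Complex.normSq (∑ k, star (u i k j) * u i' k j') : ℝ) : ℂ)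
      = ((∑ k, ∑ k', Complex.normSq (∑ i, ∑ j, star (u i k j) * u i k' j) : ℝ) : ℂ) := by
      push_cast
      simp only [← Complex.mul_conj, Fin.sum_univ_two, map_add, map_mul, ← starRingEnd_apply,
        Complex.conj_conj]
      ring
    exact_mod_cast hc
  rw [h]
  have hd : ∀ k, (∑ i, ∑ j, Complex.normSq (u i k j)) ^ 2
      = Complex.normSq (∑ i, ∑ j, star (u i k j) * u i k j) := by
    intro k
    have : ∑ i, ∑ j, star (u i k j) * u i k j = ((∑ i, ∑ j, Complex.normSq (u i k j) : ℝ) : ℂ) := by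
      push_cast
      refine Finset.sum_congr rfl fun i _ => Finset.sum_congr rfl fun j _ => ?_
      rw [mul_comm, ← Complex.mul_conj]; rfl
    rw [this, Complex.normSq_ofReal]; ring
  have h0 := hu 0
  have h1 := hu 1
  have hd0 := hd 0
  have hd1 := hd 1
  simp only [Fin.sum_univ_two] at h0 h1 hd0 hd1 ⊢
  have hp1 := Complex.normSq_nonneg (star (u 0 0 0) * u 0 1 0 + star (u 0 0 1) * u 0 1 1 +
    (star (u 1 0 0) * u 1 1 0 + star (u 1 0 1) * u 1 1 1))
  have hp2 := Complex.normSq_nonneg (star (u 0 1 0) * u 0 0 0 + star (u 0 1 1) * u 0 0 1 +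
    (star (u 1 1 0) * u 1 0 0 + star (u 1 1 1) * u 1 0 1))
  set p := Complex.normSq (u 0 0 0) + Complex.normSq (u 0 0 1) +
    (Complex.normSq (u 1 0 0) + Complex.normSq (u 1 0 1)) with hpdef
  set q := Complex.normSq (u 0 1 0) + Complex.normSq (u 0 1 1) +
    (Complex.normSq (u 1 1 0) + Complex.normSq (u 1 1 1)) with hqdef
  have hpq : p + q = 2 := by rw [hpdef, hqdef]; linarith
  rw [← hd0, ← hd1]
  nlinarith [sq_nonneg (p - q)]

theorem sum_normSq_pauli (Y : Fin 2 → Fin 2 → ℂ) :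
    ∑ P, Complex.normSq (∑ i, ∑ i', pauli P i i' * Y i i')
      = 2 * ∑ i, ∑ i', Complex.normSq (Y i i') := by
  have hc : ((∑ P, Complex.normSq (∑ i, ∑ i', pauli P i i' * Y i i') : ℝ) : ℂ)
      = ((2 * ∑ i, ∑ i', Complex.normSq (Y i i') : ℝ) : ℂ) := by
    push_cast
    simp [← Complex.mul_conj, Fin.sum_univ_two, Fin.sum_univ_four, pauli]
    ring_nf
    simp
    ring
  exact_mod_cast hc

/-- With the second input fixed to |0⟩, `U` is an isometry from one qubit to two. Summing over all
Pauli operators on the first output yields the purity sum of `two_le_purity`. -/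
theorem sum_ancillaWeight_left {U : Matrix (Fin 2 × Fin 2) (Fin 2 × Fin 2) ℂ}
    (hU : U ∈ Matrix.unitaryGroup (Fin 2 × Fin 2) ℂ) : 2 ≤ ∑ P, ancillaWeight U (P, 0) := by
  have hcol : ∀ j : Fin 2, ∑ i, ∑ k, Complex.normSq (U (i, k) (j, 0)) = 1 := by
    intro j
    have := sum_normSq_row (Unitary.star_mem hU) (j, 0)
    rw [Fintype.sum_prod_type] at this
    simpa [Matrix.star_apply] using this
  have h := two_le_purity (fun i k j => U (i, k) (j, 0)) hcol
  have h2 : 2 * ∑ P, ancillaWeight U (P, 0) = 2 * ∑ j, ∑ j', ∑ i, ∑ i',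
      Complex.normSq (∑ k, star (U (i, k) (j, 0)) * U (i', k) (j', 0)) := by
    rw [Finset.mul_sum]
    simp only [ancillaWeight_eq]
    rw [Finset.sum_comm, Finset.mul_sum]
    refine Finset.sum_congr rfl fun j _ => ?_
    rw [Finset.sum_comm, Finset.mul_sum]
    refine Finset.sum_congr rfl fun j' _ => ?_
    rw [← sum_normSq_pauli fun i i' => ∑ k, star (U (i, k) (j, 0)) * U (i', k) (j', 0)]
    refine Finset.sum_congr rfl fun P _ => ?_
    congr 1
    have h0 : pauli 0 = 1 := rfl
    simp [Matrix.mul_apply, Fintype.sum_prod_type, Fin.sum_univ_two, basis2, h0]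
    ring
  linarith

/-- Exchanging the tensor factors at the output or at the input only relabels the transfer matrix,
so the estimates for one qubit transfer to the other. -/
theorem OpBasis.ptm_reindex {κ d : Type} [Fintype κ] [DecidableEq κ] [Fintype d] [DecidableEq d]
    (P : OpBasis κ d) (U : Matrix d d ℂ) (e e' : d ≃ d) (s s' : κ → κ)
    (hs : ∀ k, (P.B k).submatrix e e = P.B (s k))
    (hs' : ∀ k, (P.B k).submatrix e' e' = P.B (s' k)) (k l : κ) :
    P.ptm (U.submatrix e e') (s k) (s' l) = P.ptm U k l := by
  rw [OpBasis.ptm, OpBasis.ptm, ← hs, ← hs', Matrix.conjTranspose_submatrix,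
    Matrix.submatrix_mul_equiv, Matrix.submatrix_mul_equiv, Matrix.submatrix_mul_equiv]
  congr 2
  exact Equiv.sum_comp e' fun i => (Uᴴ * P.B k * U * P.B l) i i

theorem basis2_swap (k : Fin 4 × Fin 4) :
    (basis2.B k).submatrix (Equiv.prodComm _ _) (Equiv.prodComm _ _) = basis2.B k.swap := by
  ext i j
  simp [basis2, mul_comm]

theorem submatrix_mem_unitary {U : Matrix (Fin 2 × Fin 2) (Fin 2 × Fin 2) ℂ}
    (hU : U ∈ Matrix.unitaryGroup (Fin 2 × Fin 2) ℂ)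
    (e e' : Fin 2 × Fin 2 ≃ Fin 2 × Fin 2) :
    U.submatrix e e' ∈ Matrix.unitaryGroup (Fin 2 × Fin 2) ℂ := by
  rw [Matrix.mem_unitaryGroup_iff, Matrix.star_eq_conjTranspose, Matrix.conjTranspose_submatrix,
    Matrix.submatrix_mul_equiv, ← Matrix.star_eq_conjTranspose, Matrix.mem_unitaryGroup_iff.1 hU,
    Matrix.submatrix_one_equiv]

theorem sum_ancillaWeight_right {U : Matrix (Fin 2 × Fin 2) (Fin 2 × Fin 2) ℂ}
    (hU : U ∈ Matrix.unitaryGroup (Fin 2 × Fin 2) ℂ) : 2 ≤ ∑ P, ancillaWeight U (0, P) := by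
  have h := sum_ancillaWeight_left
    (submatrix_mem_unitary hU (Equiv.prodComm _ _) (Equiv.refl _))
  have h2 : ∀ P, ancillaWeight (U.submatrix (Equiv.prodComm _ _) (Equiv.refl _)) (P, 0)
      = ancillaWeight U (0, P) := by
    intro P
    unfold ancillaWeight
    have h3 := basis2.ptm_reindex U (Equiv.prodComm _ _) (Equiv.refl _) Prod.swap id basis2_swap
      (fun k => by simp) (0, P)
    simp only [Prod.swap_prod_mk, id] at h3
    simp only [h3]
  simpa only [h2] using h

/-- Transition probabilities of a pair of independent 2-design gates between diagonal Pauli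
labels. -/
def twirl2 (e j : Fin 4 × Fin 4) : ℝ := twirl1 e.1 j.1 * twirl1 e.2 j.2

theorem twirl1_nonneg (a e : Fin 4) : 0 ≤ twirl1 a e := by
  unfold twirl1; split_ifs <;> norm_num

theorem twirl2_nonneg (a e : Fin 4 × Fin 4) : 0 ≤ twirl2 a e :=
  mul_nonneg (twirl1_nonneg _ _) (twirl1_nonneg _ _)

/-- If `e` lives on one qubit, the twirl averages over three labels. Their total weight is at least
2 - 1 = 1, the identity being removed from a sum of at least 2. If `e` lives on both qubits, the
nine labels without an identity have total weight at least 8 - 1 - 6 = 1, since the identity weighs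
1 and the six one-sided labels weigh at most 1 each. -/
theorem ancilla_bound {U : Matrix (Fin 2 × Fin 2) (Fin 2 × Fin 2) ℂ}
    (hU : U ∈ Matrix.unitaryGroup (Fin 2 × Fin 2) ℂ) (e : Fin 4 × Fin 4) (he : e ≠ 0) :
    (if e.1 ≠ 0 ∧ e.2 ≠ 0 then 1 / 9 else 1 / 3 : ℝ) ≤ ∑ j, twirl2 e j * ancillaWeight U j := by
  have h1 := sum_ancillaWeight hU
  have h2 := sum_ancillaWeight_left hU
  have h3 := sum_ancillaWeight_right hU
  have h4 := ancillaWeight_one hU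
  have h5 := ancillaWeight_le_one hU
  obtain ⟨x, y⟩ := e
  rw [Fintype.sum_prod_type] at h1 ⊢
  simp only [Fin.sum_univ_four] at h1 h2 h3 ⊢
  by_cases hx : x = 0 <;> by_cases hy : y = 0
  · subst hx hy; exact absurd rfl he
  · simp [twirl2, twirl1, hx, hy]; linarith
  · simp [twirl2, twirl1, hx, hy]; linarith
  · simp [twirl2, twirl1, hx, hy]
    linarith [h5 (1, 0), h5 (2, 0), h5 (3, 0), h5 (0, 1), h5 (0, 2), h5 (0, 3)]

/-- The analogue of `ancillaWeight` when the first input qubit is in the state `|0⟩`. -/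
def ancillaWeight' (U : Matrix (Fin 2 × Fin 2) (Fin 2 × Fin 2) ℂ) (c : Fin 4 × Fin 4) : ℝ :=
  ∑ a, (basis2.ptm U c (0, a) + basis2.ptm U c (3, a)) ^ 2

theorem ancilla_bound' {U : Matrix (Fin 2 × Fin 2) (Fin 2 × Fin 2) ℂ}
    (hU : U ∈ Matrix.unitaryGroup (Fin 2 × Fin 2) ℂ) (e : Fin 4 × Fin 4) (he : e ≠ 0) :
    (if e.1 ≠ 0 ∧ e.2 ≠ 0 then 1 / 9 else 1 / 3 : ℝ) ≤ ∑ j, twirl2 e j * ancillaWeight' U j := by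
  have h := ancilla_bound (submatrix_mem_unitary hU (Equiv.refl _) (Equiv.prodComm _ _)) e he
  have h2 : ∀ c, ancillaWeight (U.submatrix (Equiv.refl _) (Equiv.prodComm _ _)) c
      = ancillaWeight' U c := by
    intro c
    unfold ancillaWeight ancillaWeight'
    have h3 := basis2.ptm_reindex U (Equiv.refl _) (Equiv.prodComm _ _) id Prod.swap
      (fun k => by simp) basis2_swap c
    simp only [id, Prod.forall, Prod.swap_prod_mk] at h3
    simp only [h3]
  simpa only [h2] using h

end DynCircuit

namespace DynCircuit

open Matrix MeasureTheory

/-! ### Consequences of the transfer matrix -/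

/-- The Pauli label `k` vanishes wherever `s` does. -/
def Below (s : Fin 2 × Fin 2) (k : Fin 4 × Fin 4) : Prop :=
  (s.1 = 0 → k.1 = 0) ∧ (s.2 = 0 → k.2 = 0)

instance (s : Fin 2 × Fin 2) (k : Fin 4 × Fin 4) : Decidable (Below s k) := by
  unfold Below; infer_instance

/-- I/4 detects only the identity label, while SWAP/2 is a quarter of the sum of P ⊗ P and detects
all labels equally. -/
theorem trace_replica (x : Fin 2) (a b : Fin 4) :
    ((pauli a ⊗ₖ pauli b) * replica x).trace = if a = b ∧ (x = 0 → a = 0) then 1 else 0 := by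
  fin_cases x
  · simp only [replica]
    simp only [Fin.zero_eta, if_true, Matrix.mul_smul, Matrix.mul_one, Matrix.trace_smul,
      Matrix.trace_kronecker]
    fin_cases a <;> fin_cases b <;> simp [pauli, Matrix.trace_fin_two] <;> norm_num
  · have h : ((pauli a ⊗ₖ pauli b) * replica 1).trace = (pauli a * pauli b).trace / 2 := by
      simp [replica, Matrix.trace, Matrix.mul_apply, Fintype.sum_prod_type, Fin.sum_univ_two]
      ring
    simp only [Fin.mk_one]
    rw [h, pauli_trace_mul]
    split_ifs <;> simp_all

theorem replicaPair_eq (s : Fin 2 × Fin 2) :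
    replicaPair s = (replica s.1 ⊗ₖ replica s.2).submatrix
      (Equiv.prodProdProdComm _ _ _ _) (Equiv.prodProdProdComm _ _ _ _) := by
  ext a b; rfl

theorem basis2_kron (k l : Fin 4 × Fin 4) :
    basis2.B k ⊗ₖ basis2.B l = ((pauli k.1 ⊗ₖ pauli l.1) ⊗ₖ (pauli k.2 ⊗ₖ pauli l.2)).submatrix
      (Equiv.prodProdProdComm _ _ _ _) (Equiv.prodProdProdComm _ _ _ _) := by
  ext a b
  simp [basis2, Equiv.prodProdProdComm]
  ring

theorem trace_submatrix_equiv' {d d' : Type} [Fintype d] [Fintype d'] (e : d' ≃ d)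
    (M : Matrix d d ℂ) : (M.submatrix e e).trace = M.trace :=
  Equiv.sum_comp e fun i => M i i

theorem trace_replicaPair (s : Fin 2 × Fin 2) (k l : Fin 4 × Fin 4) :
    ((basis2.B k ⊗ₖ basis2.B l) * replicaPair s).trace = if k = l ∧ Below s k then 1 else 0 := by
  rw [replicaPair_eq, basis2_kron, Matrix.submatrix_mul_equiv, trace_submatrix_equiv',
    ← Matrix.mul_kronecker_mul, Matrix.trace_kronecker, trace_replica, trace_replica]
  simp only [Below, Prod.ext_iff]
  split_ifs <;> first
    | (simp; done)
    | (exfalso; grind)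

/-- Cyclicity of the trace moves W onto the Pauli operators. The replica operator then removes the
off-diagonal terms and the labels outside its support pattern. -/
theorem trace_twoCopyConj (W : Matrix (Fin 2 × Fin 2) (Fin 2 × Fin 2) ℂ) (s : Fin 2 × Fin 2)
    (e : Fin 4 × Fin 4) :
    ((basis2.B e ⊗ₖ basis2.B e) * twoCopyConj W (replicaPair s)).trace
      = ((∑ k, if Below s k then basis2.ptm W e k ^ 2 else 0 : ℝ) : ℂ) := by
  have h1 : ((basis2.B e ⊗ₖ basis2.B e) * twoCopyConj W (replicaPair s)).trace
      = (((Wᴴ * basis2.B e * W) ⊗ₖ (Wᴴ * basis2.B e * W)) * replicaPair s).trace := by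
    rw [twoCopyConj, ← Matrix.mul_assoc, Matrix.trace_mul_comm, ← Matrix.mul_assoc,
      ← Matrix.mul_assoc, Matrix.conjTranspose_kronecker, ← Matrix.mul_kronecker_mul,
      ← Matrix.mul_kronecker_mul]
  rw [h1, basis2.conj_eq]
  have h2 : (∑ l, (basis2.ptm W e l : ℂ) • basis2.B l) ⊗ₖ (∑ l, (basis2.ptm W e l : ℂ) • basis2.B l)
      = ∑ k, ∑ l, ((basis2.ptm W e k : ℂ) * basis2.ptm W e l) • (basis2.B k ⊗ₖ basis2.B l) := by
    ext x y
    simp only [Matrix.kroneckerMap_apply, Matrix.sum_apply, Matrix.smul_apply, smul_eq_mul,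
      Finset.sum_mul_sum]
    exact Finset.sum_congr rfl fun i _ => Finset.sum_congr rfl fun j _ => by ring
  rw [h2, Finset.sum_mul, Matrix.trace_sum]
  push_cast
  refine Finset.sum_congr rfl fun k _ => ?_
  rw [Finset.sum_mul, Matrix.trace_sum]
  simp only [Matrix.smul_mul, Matrix.trace_smul, trace_replicaPair, smul_eq_mul]
  rw [Finset.sum_eq_single k]
  · by_cases h : Below s k <;> simp [h, sq]
  · intro b _ hb; simp [Ne.symm hb]
  · simp

theorem isCompact_unitary_four : IsCompact (Set.univ : Set U4) := by
  rw [Topology.IsInducing.subtypeVal.isCompact_iff, Set.image_univ, Subtype.range_coe]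
  refine IsCompact.of_isClosed_subset (isCompact_univ_pi fun _ : Fin 2 × Fin 2 =>
    isCompact_univ_pi fun _ : Fin 2 × Fin 2 => isCompact_closedBall (0 : ℂ) 1) ?_ ?_
  · have : ((Matrix.unitaryGroup (Fin 2 × Fin 2) ℂ : Submonoid _) :
        Set (Matrix (Fin 2 × Fin 2) (Fin 2 × Fin 2) ℂ)) = {M | M * star M = 1} := by
      ext M
      exact Matrix.mem_unitaryGroup_iff
    rw [this]
    exact isClosed_eq (by fun_prop) continuous_const
  · intro M hM i _ j _
    exact mem_closedBall_zero_iff.2 (entry_norm_bound_of_unitary hM i j)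

instance (a b : Type) [Countable a] [Countable b] : SecondCountableTopology (Matrix a b ℂ) :=
  inferInstanceAs (SecondCountableTopology (a → b → ℂ))

instance : SecondCountableTopology U2 := TopologicalSpace.Subtype.secondCountableTopology _

instance : CompactSpace U4 := ⟨isCompact_unitary_four⟩

theorem integrable_comp_gate {Ω : Type*} [MeasurableSpace Ω] (D : Measure Ω)
    [IsProbabilityMeasure D] {U : Ω → U4} (hU : Measurable U) {F : Type*}
    [NormedAddCommGroup F] [SecondCountableTopology F]
    {f : U4 × (U2 × U2) → F} (hf : Continuous f) :
    Integrable (fun w : Ω × (U2 × U2) => f (U w.1, w.2)) (D.prod (haarU2.prod haarU2)) := by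
  let _ : MeasurableSpace F := borel F
  have _ : BorelSpace F := ⟨rfl⟩
  obtain ⟨C, hC⟩ := (isCompact_univ (X := U4 × (U2 × U2))).exists_bound_of_continuousOn
    hf.continuousOn
  refine Integrable.of_bound (C := C) ?_ (Filter.Eventually.of_forall fun w => hC _ (Set.mem_univ _))
  exact (hf.measurable.comp ((hU.comp measurable_fst).prodMk measurable_snd)).aestronglyMeasurable

/-- The transfer matrix of a two-qubit unitary in the Pauli basis. -/
def rot2 (U : U4) (a c : Fin 4 × Fin 4) : ℝ :=
  basis2.ptm (U : Matrix (Fin 2 × Fin 2) (Fin 2 × Fin 2) ℂ) a c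

theorem continuous_rot2 (a c : Fin 4 × Fin 4) : Continuous fun V => rot2 V a c :=
  (basis2.continuous_ptm a c).comp continuous_subtype_val

theorem abs_rot2_le (V : U4) (a c : Fin 4 × Fin 4) : |rot2 V a c| ≤ 1 := basis2.abs_ptm_le V.2 a c

/-- The gate `(V₁ ⊗ V₂) U`. -/
def dressed (z : U4 × (U2 × U2)) : Matrix (Fin 2 × Fin 2) (Fin 2 × Fin 2) ℂ :=
  ((z.2.1 : Matrix (Fin 2) (Fin 2) ℂ) ⊗ₖ (z.2.2 : Matrix (Fin 2) (Fin 2) ℂ)) *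
    (z.1 : Matrix (Fin 2 × Fin 2) (Fin 2 × Fin 2) ℂ)

theorem continuous_dressed : Continuous dressed := by
  unfold dressed
  refine Continuous.matrix_mul ?_ (continuous_subtype_val.comp continuous_fst)
  refine continuous_matrix fun i j => ?_
  simp only [Matrix.kroneckerMap_apply]
  exact ((continuous_subtype_val.comp (continuous_fst.comp continuous_snd)).matrix_elem _ _).mul
    ((continuous_subtype_val.comp (continuous_snd.comp continuous_snd)).matrix_elem _ _)

theorem ptm_dressed (z : U4 × (U2 × U2)) (e k : Fin 4 × Fin 4) :
    basis2.ptm (dressed z) e k = ∑ j, (rot z.2.1 e.1 j.1 * rot z.2.2 e.2 j.2) * rot2 z.1 j k := by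
  rw [dressed, basis2.ptm_mul]
  simp only [ptm_kronecker]
  rfl

/-- The two Haar gates are independent of each other and of U, and their second moments remove the
cross terms between different intermediate labels. -/
theorem integral_ptm_dressed_sq {Ω : Type*} [MeasurableSpace Ω] (D : Measure Ω)
    [IsProbabilityMeasure D] {U : Ω → U4} (hU : Measurable U) (e k : Fin 4 × Fin 4) :
    ∫ w : Ω × (U2 × U2), basis2.ptm (dressed (U w.1, w.2)) e k ^ 2 ∂(D.prod (haarU2.prod haarU2))
      = ∑ j, twirl2 e j * ∫ ω, rot2 (U ω) j k ^ 2 ∂D := by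
  have h1 : ∀ z : U4 × (U2 × U2), basis2.ptm (dressed z) e k ^ 2 = ∑ i, ∑ j,
      (rot2 z.1 i k * rot2 z.1 j k) * ((rot z.2.1 e.1 i.1 * rot z.2.1 e.1 j.1) *
        (rot z.2.2 e.2 i.2 * rot z.2.2 e.2 j.2)) := by
    intro z
    rw [ptm_dressed, sq, Finset.sum_mul_sum]
    exact Finset.sum_congr rfl fun i _ => Finset.sum_congr rfl fun j _ => by ring
  have hint : ∀ i j : Fin 4 × Fin 4, Integrable (fun w : Ω × (U2 × U2) =>
      (rot2 (U w.1) i k * rot2 (U w.1) j k) * ((rot w.2.1 e.1 i.1 * rot w.2.1 e.1 j.1) *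
        (rot w.2.2 e.2 i.2 * rot w.2.2 e.2 j.2))) (D.prod (haarU2.prod haarU2)) := by
    intro i j
    refine integrable_comp_gate D hU (f := fun z : U4 × (U2 × U2) =>
      (rot2 z.1 i k * rot2 z.1 j k) * ((rot z.2.1 e.1 i.1 * rot z.2.1 e.1 j.1) *
        (rot z.2.2 e.2 i.2 * rot z.2.2 e.2 j.2))) ?_
    have ha := fun i => (continuous_rot2 i k).comp (continuous_fst (X := U4) (Y := U2 × U2))
    have hb := fun i => (continuous_rot e.1 i).comp
      ((continuous_fst (X := U2) (Y := U2)).comp (continuous_snd (X := U4) (Y := U2 × U2)))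
    have hc := fun i => (continuous_rot e.2 i).comp
      ((continuous_snd (X := U2) (Y := U2)).comp (continuous_snd (X := U4) (Y := U2 × U2)))
    exact ((ha i).mul (ha j)).mul (((hb _).mul (hb _)).mul ((hc _).mul (hc _)))
  simp only [h1]
  rw [integral_finsetSum _ fun i _ => integrable_finsetSum _ fun j _ => hint i j]
  refine Finset.sum_congr rfl fun i _ => ?_
  rw [integral_finsetSum _ fun j _ => hint i j]
  have h2 : ∀ j : Fin 4 × Fin 4, ∫ w : Ω × (U2 × U2),
      (rot2 (U w.1) i k * rot2 (U w.1) j k) * ((rot w.2.1 e.1 i.1 * rot w.2.1 e.1 j.1) *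
        (rot w.2.2 e.2 i.2 * rot w.2.2 e.2 j.2)) ∂(D.prod (haarU2.prod haarU2))
      = if i = j then twirl2 e i * ∫ ω, rot2 (U ω) i k ^ 2 ∂D else 0 := by
    intro j
    rw [integral_prod_mul (fun ω => rot2 (U ω) i k * rot2 (U ω) j k)
      (fun v : U2 × U2 => (rot v.1 e.1 i.1 * rot v.1 e.1 j.1) * (rot v.2 e.2 i.2 * rot v.2 e.2 j.2)),
      integral_prod_mul (fun v => rot v e.1 i.1 * rot v e.1 j.1)
      (fun v => rot v e.2 i.2 * rot v e.2 j.2), haar_second_moment, haar_second_moment]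
    simp only [true_and, Prod.ext_iff, twirl2]
    split_ifs with h1 h2 h3 h4 h5
    · obtain rfl : i = j := Prod.ext h1 h2
      simp only [← sq]; ring
    all_goals simp_all
  simp only [h2, Finset.sum_ite_eq, Finset.mem_univ, if_true]

/-- The defining equation of the transfer matrix is paired with B_e ⊗ B_e, which translates it into
mean squares of Pauli transfer entries. -/
theorem transfer_identity {Ω : Type*} [MeasurableSpace Ω] (D : Measure Ω)
    [IsProbabilityMeasure D] {U : Ω → U4} (hU : Measurable U) {T : Matrix (Fin 4) (Fin 4) ℝ}
    (hT : HasTransferMatrix D U T) (e : Fin 4 × Fin 4) (s : Fin 4) :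
    ∑ j, twirl2 e j * ∑ k, (if Below (replicaOrder s) k then ∫ ω, rot2 (U ω) j k ^ 2 ∂D else 0)
      = ∑ t, if Below (replicaOrder t) e then T t s else 0 := by
  have hpt : ∀ z : U4 × (U2 × U2),
      ((∑ k, if Below (replicaOrder s) k then basis2.ptm (dressed z) e k ^ 2 else 0 : ℝ) : ℂ)
        = ∑ x, ∑ y, (basis2.B e ⊗ₖ basis2.B e) x y *
          twoCopyConj (dressed z) (replicaPair (replicaOrder s)) y x := by
    intro z
    rw [← trace_twoCopyConj]
    simp only [Matrix.trace, Matrix.diag, Matrix.mul_apply]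
  have hcont : ∀ x y, Continuous fun z => twoCopyConj (dressed z) (replicaPair (replicaOrder s)) y x := by
    intro x y
    have hk : Continuous fun z => dressed z ⊗ₖ dressed z := by
      refine continuous_matrix fun i j => ?_
      simp only [Matrix.kroneckerMap_apply]
      exact (continuous_dressed.matrix_elem _ _).mul (continuous_dressed.matrix_elem _ _)
    exact ((hk.matrix_mul continuous_const).matrix_mul hk.matrix_conjTranspose).matrix_elem _ _
  have hptm : ∀ k, Continuous fun z => basis2.ptm (dressed z) e k ^ 2 := fun k =>
    ((basis2.continuous_ptm e k).comp continuous_dressed).pow 2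
  have hint : ∀ x y, Integrable (fun w : Ω × (U2 × U2) => (basis2.B e ⊗ₖ basis2.B e) x y *
      twoCopyConj (dressed (U w.1, w.2)) (replicaPair (replicaOrder s)) y x)
      (D.prod (haarU2.prod haarU2)) := fun x y =>
    integrable_comp_gate D hU (f := fun z => (basis2.B e ⊗ₖ basis2.B e) x y *
      twoCopyConj (dressed z) (replicaPair (replicaOrder s)) y x) (continuous_const.mul (hcont x y))
  have hL : ((∫ w : Ω × (U2 × U2), (∑ k, if Below (replicaOrder s) k then
        basis2.ptm (dressed (U w.1, w.2)) e k ^ 2 else 0) ∂(D.prod (haarU2.prod haarU2)) : ℝ) : ℂ)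
      = ((∑ t, if Below (replicaOrder t) e then T t s else 0 : ℝ) : ℂ) := by
    rw [← integral_complex_ofReal]
    simp only [hpt]
    rw [integral_finsetSum _ fun x _ => integrable_finsetSum _ fun y _ => hint x y]
    have : ∀ x, ∫ w : Ω × (U2 × U2), ∑ y, (basis2.B e ⊗ₖ basis2.B e) x y *
          twoCopyConj (dressed (U w.1, w.2)) (replicaPair (replicaOrder s)) y x
            ∂(D.prod (haarU2.prod haarU2))
        = ∑ y, (basis2.B e ⊗ₖ basis2.B e) x y *
          (∑ t, (T t s : ℂ) • replicaPair (replicaOrder t)) y x := by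
      intro x
      rw [integral_finsetSum _ fun y _ => hint x y]
      refine Finset.sum_congr rfl fun y _ => ?_
      rw [integral_const_mul, ← hT s]
      rfl
    simp only [this]
    have h3 : ∑ x, ∑ y, (basis2.B e ⊗ₖ basis2.B e) x y *
          (∑ t, (T t s : ℂ) • replicaPair (replicaOrder t)) y x
        = ((basis2.B e ⊗ₖ basis2.B e) * ∑ t, (T t s : ℂ) • replicaPair (replicaOrder t)).trace := by
      simp only [Matrix.trace, Matrix.diag, Matrix.mul_apply]
    rw [h3, Finset.mul_sum, Matrix.trace_sum]
    push_cast
    refine Finset.sum_congr rfl fun t _ => ?_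
    rw [Matrix.mul_smul, Matrix.trace_smul, trace_replicaPair]
    by_cases h : Below (replicaOrder t) e <;> simp [h]
  have hL' := Complex.ofReal_injective hL
  rw [← hL', integral_finsetSum]
  · simp only [Finset.mul_sum]
    rw [Finset.sum_comm]
    refine Finset.sum_congr rfl fun k _ => ?_
    split_ifs
    · rw [integral_ptm_dressed_sq D hU]
    · simp
  · intro k _
    split_ifs
    · exact integrable_comp_gate D hU (hptm k)
    · exact integrable_zero _ _ _

theorem rot2_zero_left (V : U4) (c : Fin 4 × Fin 4) : rot2 V 0 c = if 0 = c then 1 else 0 :=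
  basis2.ptm_unit_left V.2 c

/-- This reads off the `SI` column. For `e` supported on the first, the second or both qubits, the
admissible rows sum to 1 - α - β + α/5, β + α/5 and α/5 respectively. -/
theorem transfer_bound_left {Ω : Type*} [MeasurableSpace Ω] (D : Measure Ω)
    [IsProbabilityMeasure D] {U : Ω → U4} (hU : Measurable U) {α β : ℝ}
    (hα : α ∈ Set.Icc (0 : ℝ) 1) (hβ : β ∈ Set.Icc (0 : ℝ) (1 - α))
    (hT : HasTransferMatrix D U (transferMatrix α β)) (e : Fin 4 × Fin 4) (he : e ≠ 0) :
    α / 5 ≤ ∑ j, twirl2 e j * ∑ c, ∫ ω, rot2 (U ω) j (c, 0) ^ 2 ∂D := by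
  have h := transfer_identity D hU hT e 2
  have h2 : ∀ j, ∑ k, (if Below (replicaOrder 2) k then ∫ ω, rot2 (U ω) j k ^ 2 ∂D else 0)
      = ∑ c, ∫ ω, rot2 (U ω) j (c, 0) ^ 2 ∂D := by
    intro j
    rw [Fintype.sum_prod_type]
    refine Finset.sum_congr rfl fun c _ => ?_
    rw [Finset.sum_eq_single 0]
    · simp [Below, replicaOrder]
    · intro b _ hb; simp [Below, replicaOrder, hb]
    · simp
  simp only [h2] at h
  rw [h]
  obtain ⟨x, y⟩ := e
  obtain ⟨h1, h2⟩ := hα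
  obtain ⟨h3, h4⟩ := hβ
  by_cases hx : x = 0 <;> by_cases hy : y = 0
  · subst hx hy; exact absurd rfl he
  all_goals
    simp [Fin.sum_univ_four, Below, replicaOrder, transferMatrix, hx, hy]
    try linarith

theorem transfer_bound_right {Ω : Type*} [MeasurableSpace Ω] (D : Measure Ω)
    [IsProbabilityMeasure D] {U : Ω → U4} (hU : Measurable U) {α β : ℝ}
    (hα : α ∈ Set.Icc (0 : ℝ) 1) (hβ : β ∈ Set.Icc (0 : ℝ) (1 - α))
    (hT : HasTransferMatrix D U (transferMatrix α β)) (e : Fin 4 × Fin 4) (he : e ≠ 0) :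
    α / 5 ≤ ∑ j, twirl2 e j * ∑ c, ∫ ω, rot2 (U ω) j (0, c) ^ 2 ∂D := by
  have h := transfer_identity D hU hT e 1
  have h2 : ∀ j, ∑ k, (if Below (replicaOrder 1) k then ∫ ω, rot2 (U ω) j k ^ 2 ∂D else 0)
      = ∑ c, ∫ ω, rot2 (U ω) j (0, c) ^ 2 ∂D := by
    intro j
    rw [Fintype.sum_prod_type, Finset.sum_eq_single 0]
    · simp [Below, replicaOrder]
    · intro b _ hb; simp [Below, replicaOrder, hb]
    · simp
  simp only [h2] at h
  rw [h]
  obtain ⟨x, y⟩ := e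
  obtain ⟨h1, h2⟩ := hα
  obtain ⟨h3, h4⟩ := hβ
  by_cases hx : x = 0 <;> by_cases hy : y = 0
  · subst hx hy; exact absurd rfl he
  all_goals
    simp [Fin.sum_univ_four, Below, replicaOrder, transferMatrix, hx, hy]
    try linarith

end DynCircuit

namespace DynCircuit

open Matrix MeasureTheory

/-! ### Heisenberg picture of the operations on `n` qubits -/

variable {n : ℕ}

/-- Matrix products with an operator on one qubit reduce to a sum over the bit of that qubit. -/
theorem sum_agree_one (q : Fin n) (x : Bits n) (F : Bits n → ℂ) :
    (∑ z, if ∀ j, j ≠ q → x j = z j then F z else 0) = ∑ u, F (Function.update x q u) := by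
  rw [← Finset.sum_filter]
  refine Finset.sum_nbij' (fun z => z q) (fun u => Function.update x q u) (by simp) ?_ ?_ ?_ ?_
  · intro u _
    simp only [Finset.mem_filter, Finset.mem_univ, true_and]
    intro j hj; simp [hj]
  · intro z hz
    simp only [Finset.mem_filter, Finset.mem_univ, true_and] at hz
    ext j
    by_cases hj : j = q
    · subst hj; simp
    · simp [hj, hz j hj]
  · intro u _; simp
  · intro z hz
    simp only [Finset.mem_filter, Finset.mem_univ, true_and] at hz
    congr 1
    ext j
    by_cases hj : j = q
    · subst hj; simp
    · simp [hj, hz j hj]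

theorem sum_agree_two {q r : Fin n} (hqr : q ≠ r) (x : Bits n) (F : Bits n → ℂ) :
    (∑ z, if ∀ j, j ≠ q → j ≠ r → x j = z j then F z else 0)
      = ∑ u : Fin 2 × Fin 2, F (Function.update (Function.update x q u.1) r u.2) := by
  have key : ∀ z : Bits n, (∀ j, j ≠ q → j ≠ r → x j = z j) →
      Function.update (Function.update x q (z q)) r (z r) = z := by
    intro z hz
    ext j
    by_cases hr : j = r
    · subst hr; simp
    · by_cases hj : j = q
      · subst hj; simp [hr]
      · simp [hj, hr, hz j hj hr]
  rw [← Finset.sum_filter]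
  refine Finset.sum_nbij' (fun z => (z q, z r))
    (fun u => Function.update (Function.update x q u.1) r u.2) (by simp) ?_ ?_ ?_ ?_
  · intro u _
    simp only [Finset.mem_filter, Finset.mem_univ, true_and]
    intro j hj hr; simp [hj, hr]
  · intro z hz
    simp only [Finset.mem_filter, Finset.mem_univ, true_and] at hz
    exact key z hz
  · intro u _; simp [hqr]
  · intro z hz
    simp only [Finset.mem_filter, Finset.mem_univ, true_and] at hz
    rw [key z hz]

/-- `N` on qubit `q`, tensored with the Pauli matrices of the string `a` elsewhere. -/
def fill1 (q : Fin n) (a : Fin n → Fin 4) (N : Matrix (Fin 2) (Fin 2) ℂ) : NOp n :=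
  Matrix.of fun x y => N (x q) (y q) * ∏ j ∈ Finset.univ.erase q, pauli (a j) (x j) (y j)

/-- `N` on the qubits `(q, r)`, tensored with the Pauli matrices of the string `a` elsewhere. -/
def fill2 (q r : Fin n) (a : Fin n → Fin 4) (N : Matrix (Fin 2 × Fin 2) (Fin 2 × Fin 2) ℂ) :
    NOp n :=
  Matrix.of fun x y => N (x q, x r) (y q, y r) *
    ∏ j ∈ (Finset.univ.erase q).erase r, pauli (a j) (x j) (y j)

theorem fill1_pauli (q : Fin n) (a : Fin n → Fin 4) (k : Fin 4) :
    fill1 q a (pauli k) = pauliString (Function.update a q k) := by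
  ext x y
  simp only [fill1, pauliString, Matrix.of_apply]
  rw [← Finset.mul_prod_erase Finset.univ _ (Finset.mem_univ q)]
  congr 1
  · simp
  · refine Finset.prod_congr rfl fun j hj => ?_
    simp [Finset.ne_of_mem_erase hj]

theorem fill2_pauli {q r : Fin n} (hqr : q ≠ r) (a : Fin n → Fin 4) (k : Fin 4 × Fin 4) :
    fill2 q r a (pauli k.1 ⊗ₖ pauli k.2)
      = pauliString (Function.update (Function.update a q k.1) r k.2) := by
  ext x y
  simp only [fill2, pauliString, Matrix.of_apply, Matrix.kroneckerMap_apply]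
  rw [← Finset.mul_prod_erase Finset.univ _ (Finset.mem_univ q),
    ← Finset.mul_prod_erase (Finset.univ.erase q) _ (Finset.mem_erase.2 ⟨hqr.symm, Finset.mem_univ r⟩),
    mul_assoc]
  congr 1
  · simp [hqr]
  · congr 1
    · simp
    · refine Finset.prod_congr rfl fun j hj => ?_
      have h1 := Finset.ne_of_mem_erase hj
      have h2 := Finset.ne_of_mem_erase (Finset.mem_of_mem_erase hj)
      simp [h1, h2]

theorem onQubit_mul_fill1 (q : Fin n) (a : Fin n → Fin 4) (M N : Matrix (Fin 2) (Fin 2) ℂ) :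
    onQubit q M * fill1 q a N = fill1 q a (M * N) := by
  ext x y
  simp only [Matrix.mul_apply, onQubit, fill1, Matrix.of_apply, ite_mul, zero_mul]
  rw [sum_agree_one q x fun z => M (x q) (z q) * (N (z q) (y q) *
    ∏ j ∈ Finset.univ.erase q, pauli (a j) (z j) (y j)), Finset.sum_mul]
  refine Finset.sum_congr rfl fun u _ => ?_
  rw [Function.update_self, mul_assoc]
  congr 2
  exact Finset.prod_congr rfl fun j hj => by simp [Finset.ne_of_mem_erase hj]

theorem fill1_mul_onQubit (q : Fin n) (a : Fin n → Fin 4) (M N : Matrix (Fin 2) (Fin 2) ℂ) :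
    fill1 q a N * onQubit q M = fill1 q a (N * M) := by
  ext x y
  simp only [Matrix.mul_apply, onQubit, fill1, Matrix.of_apply, mul_ite, mul_zero]
  simp only [eq_comm (b := y _)]
  rw [sum_agree_one q y fun z => (N (x q) (z q) *
    ∏ j ∈ Finset.univ.erase q, pauli (a j) (x j) (z j)) * M (z q) (y q), Finset.sum_mul]
  refine Finset.sum_congr rfl fun u _ => ?_
  rw [Function.update_self, mul_right_comm]
  congr 1
  exact Finset.prod_congr rfl fun j hj => by simp [Finset.ne_of_mem_erase hj]

theorem onPair_mul_fill2 {q r : Fin n} (hqr : q ≠ r) (a : Fin n → Fin 4)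
    (M N : Matrix (Fin 2 × Fin 2) (Fin 2 × Fin 2) ℂ) :
    onPair q r M * fill2 q r a N = fill2 q r a (M * N) := by
  ext x y
  simp only [Matrix.mul_apply, onPair, fill2, Matrix.of_apply, ite_mul, zero_mul]
  rw [sum_agree_two hqr x fun z => M (x q, x r) (z q, z r) * (N (z q, z r) (y q, y r) *
    ∏ j ∈ (Finset.univ.erase q).erase r, pauli (a j) (z j) (y j)), Finset.sum_mul]
  refine Finset.sum_congr rfl fun u _ => ?_
  rw [Function.update_self, Function.update_of_ne hqr, Function.update_self, mul_assoc]
  congr 2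
  refine Finset.prod_congr rfl fun j hj => ?_
  have h1 := Finset.ne_of_mem_erase hj
  have h2 := Finset.ne_of_mem_erase (Finset.mem_of_mem_erase hj)
  simp [h1, h2]

theorem fill2_mul_onPair {q r : Fin n} (hqr : q ≠ r) (a : Fin n → Fin 4)
    (M N : Matrix (Fin 2 × Fin 2) (Fin 2 × Fin 2) ℂ) :
    fill2 q r a N * onPair q r M = fill2 q r a (N * M) := by
  ext x y
  simp only [Matrix.mul_apply, onPair, fill2, Matrix.of_apply, mul_ite, mul_zero]
  simp only [eq_comm (b := y _)]
  rw [sum_agree_two hqr y fun z => (N (x q, x r) (z q, z r) *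
    ∏ j ∈ (Finset.univ.erase q).erase r, pauli (a j) (x j) (z j)) * M (z q, z r) (y q, y r),
    Finset.sum_mul]
  refine Finset.sum_congr rfl fun u _ => ?_
  rw [Function.update_self, Function.update_of_ne hqr, Function.update_self, mul_right_comm]
  congr 1
  refine Finset.prod_congr rfl fun j hj => ?_
  have h1 := Finset.ne_of_mem_erase hj
  have h2 := Finset.ne_of_mem_erase (Finset.mem_of_mem_erase hj)
  simp [h1, h2]

theorem onQubit_conjTranspose (q : Fin n) (M : Matrix (Fin 2) (Fin 2) ℂ) :
    (onQubit q M)ᴴ = onQubit q Mᴴ := by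
  ext x y
  simp only [Matrix.conjTranspose_apply, onQubit, Matrix.of_apply, eq_comm (a := y _)]
  split_ifs <;> simp

theorem onPair_conjTranspose (q r : Fin n) (M : Matrix (Fin 2 × Fin 2) (Fin 2 × Fin 2) ℂ) :
    (onPair q r M)ᴴ = onPair q r Mᴴ := by
  ext x y
  simp only [Matrix.conjTranspose_apply, onPair, Matrix.of_apply, eq_comm (a := y _)]
  split_ifs <;> simp

theorem fill1_sum {κ : Type*} [Fintype κ] (q : Fin n) (a : Fin n → Fin 4) (c : κ → ℂ)
    (M : κ → Matrix (Fin 2) (Fin 2) ℂ) :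
    fill1 q a (∑ k, c k • M k) = ∑ k, c k • fill1 q a (M k) := by
  ext x y
  simp only [fill1, Matrix.of_apply, Matrix.sum_apply, Matrix.smul_apply, smul_eq_mul,
    Finset.sum_mul]
  exact Finset.sum_congr rfl fun k _ => by ring

theorem fill2_sum {κ : Type*} [Fintype κ] (q r : Fin n) (a : Fin n → Fin 4) (c : κ → ℂ)
    (M : κ → Matrix (Fin 2 × Fin 2) (Fin 2 × Fin 2) ℂ) :
    fill2 q r a (∑ k, c k • M k) = ∑ k, c k • fill2 q r a (M k) := by
  ext x y
  simp only [fill2, Matrix.of_apply, Matrix.sum_apply, Matrix.smul_apply, smul_eq_mul,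
    Finset.sum_mul]
  exact Finset.sum_congr rfl fun k _ => by ring

/-- A set of qubits on which an operation acts, with the Pauli labels `κ` of these qubits: a
Pauli string can be read off and overwritten there. -/
structure Site (n : ℕ) (κ : Type) where
  rd : (Fin n → Fin 4) → κ
  ov : (Fin n → Fin 4) → κ → (Fin n → Fin 4)
  supp : Finset (Fin n)
  rd_ov : ∀ a k, rd (ov a k) = k
  ov_ov : ∀ a k l, ov (ov a k) l = ov a l
  ov_rd : ∀ a, ov a (rd a) = a
  ov_apply : ∀ a k j, j ∉ supp → ov a k j = a j
  rd_update : ∀ a j u, j ∉ supp → rd (Function.update a j u) = rd a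
  ov_update : ∀ a j u k, j ∉ supp → ov (Function.update a j u) k = Function.update (ov a k) j u
  rd_ne : ∀ a b j, j ∈ supp → a j ≠ b j → rd a ≠ rd b

/-- A single qubit. -/
def site1 (q : Fin n) : Site n (Fin 4) where
  rd a := a q
  ov a k := Function.update a q k
  supp := {q}
  rd_ov := by simp
  ov_ov := by simp
  ov_rd := by simp
  ov_apply a k j hj := by
    rw [Finset.mem_singleton] at hj
    simp [hj]
  rd_update a j u hj := by
    rw [Finset.mem_singleton] at hj
    simp [Ne.symm hj]
  ov_update a j u k hj := by
    rw [Finset.mem_singleton] at hj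
    rw [Function.update_comm hj]
  rd_ne a b j hj h := by
    rw [Finset.mem_singleton] at hj
    subst hj
    exact h

/-- An ordered pair of distinct qubits. -/
def site2 (q r : Fin n) (hqr : q ≠ r) : Site n (Fin 4 × Fin 4) where
  rd a := (a q, a r)
  ov a k := Function.update (Function.update a q k.1) r k.2
  supp := {q, r}
  rd_ov a k := by simp [hqr]
  ov_ov a k l := by
    ext j
    by_cases hr : j = r
    · subst hr; simp
    · by_cases hq : j = q
      · subst hq; simp [hr]
      · simp [hq, hr]
  ov_rd := by simp
  ov_apply a k j hj := by
    simp only [Finset.mem_insert, Finset.mem_singleton, not_or] at hj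
    simp [hj.1, hj.2]
  rd_update a j u hj := by
    simp only [Finset.mem_insert, Finset.mem_singleton, not_or] at hj
    simp [Ne.symm hj.1, Ne.symm hj.2]
  ov_update a j u k hj := by
    simp only [Finset.mem_insert, Finset.mem_singleton, not_or] at hj
    rw [Function.update_comm hj.1, Function.update_comm hj.2]
  rd_ne a b j hj h := by
    simp only [Finset.mem_insert, Finset.mem_singleton] at hj
    intro h2
    rw [Prod.mk.injEq] at h2
    rcases hj with rfl | rfl
    · exact h h2.1
    · exact h h2.2

/-- The Heisenberg picture of the map `Φ` acts on the Pauli labels of the site `S` by `g`. -/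
def IsKernel {κ : Type} [Fintype κ] (S : Site n κ) (g : κ → κ → ℝ) (Φ : NOp n → NOp n) : Prop :=
  ∀ X a, (Φ X * pauliString a).trace
    = ∑ k, (g (S.rd a) k : ℂ) * (X * pauliString (S.ov a k)).trace

theorem trace_conj_mul (K X P : NOp n) : (conj K X * P).trace = (X * (Kᴴ * P * K)).trace := by
  rw [conj, Matrix.mul_assoc, Matrix.mul_assoc, Matrix.trace_mul_comm]
  simp only [Matrix.mul_assoc]

theorem isKernel_onQubit (q : Fin n) (M : Matrix (Fin 2) (Fin 2) ℂ) :
    IsKernel (site1 q) (basis1.ptm M) (conj (onQubit q M)) := by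
  intro X a
  have h : pauliString a = fill1 q a (basis1.B (a q)) := by
    change _ = fill1 q a (pauli (a q))
    rw [fill1_pauli]; simp
  rw [trace_conj_mul, h, onQubit_conjTranspose, onQubit_mul_fill1, fill1_mul_onQubit,
    basis1.conj_eq, fill1_sum, Finset.mul_sum, Matrix.trace_sum]
  refine Finset.sum_congr rfl fun k _ => ?_
  rw [Matrix.mul_smul, Matrix.trace_smul, smul_eq_mul]
  change _ * (X * fill1 q a (pauli k)).trace = _
  rw [fill1_pauli]
  rfl

theorem isKernel_onPair {q r : Fin n} (hqr : q ≠ r) (M : Matrix (Fin 2 × Fin 2) (Fin 2 × Fin 2) ℂ) :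
    IsKernel (site2 q r hqr) (basis2.ptm M) (conj (onPair q r M)) := by
  intro X a
  have h : pauliString a = fill2 q r a (basis2.B (a q, a r)) := by
    change _ = fill2 q r a (pauli (a q) ⊗ₖ pauli (a r))
    rw [fill2_pauli hqr a (a q, a r)]; simp
  rw [trace_conj_mul, h, onPair_conjTranspose, onPair_mul_fill2 hqr, fill2_mul_onPair hqr,
    basis2.conj_eq, fill2_sum, Finset.mul_sum, Matrix.trace_sum]
  refine Finset.sum_congr rfl fun k _ => ?_
  rw [Matrix.mul_smul, Matrix.trace_smul, smul_eq_mul]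
  change _ * (X * fill2 q r a (pauli k.1 ⊗ₖ pauli k.2)).trace = _
  rw [fill2_pauli hqr]
  rfl

/-- The map applied last meets the observable first, so its kernel stands on the left. -/
theorem IsKernel.comp {κ : Type} [Fintype κ] {S : Site n κ} {g h : κ → κ → ℝ}
    {Φ Ψ : NOp n → NOp n} (hg : IsKernel S g Φ) (hh : IsKernel S h Ψ) :
    IsKernel S (fun k l => ∑ j, g k j * h j l) (fun X => Φ (Ψ X)) := by
  intro X a
  rw [hg]
  simp only [hh X, S.rd_ov, S.ov_ov, Finset.mul_sum]
  rw [Finset.sum_comm]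
  refine Finset.sum_congr rfl fun l _ => ?_
  push_cast
  rw [Finset.sum_mul]
  exact Finset.sum_congr rfl fun j _ => by ring

theorem pauliString_trace_mul (a b : Fin n → Fin 4) :
    (pauliString a * pauliString b).trace = if a = b then 2 ^ n else 0 := by
  have h : (pauliString a * pauliString b).trace = ∏ j, (pauli (a j) * pauli (b j)).trace := by
    simp only [Matrix.trace, Matrix.diag, Matrix.mul_apply, pauliString, Matrix.of_apply,
      ← Finset.prod_mul_distrib]
    rw [Finset.prod_univ_sum]
    simp only [Fintype.piFinset_univ]
    refine Finset.sum_congr rfl fun x _ => ?_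
    rw [Finset.prod_univ_sum]
    simp only [Fintype.piFinset_univ]
  rw [h]
  simp only [pauli_trace_mul]
  split_ifs with hab
  · subst hab; simp
  · obtain ⟨j, hj⟩ := Function.ne_iff.1 hab
    exact Finset.prod_eq_zero (Finset.mem_univ j) (by simp [hj])

/-- The kernel is determined by the map, by orthogonality of Pauli strings. Hence it depends on no
more parameters than the channel does. -/
theorem IsKernel.eq_trace {κ : Type} [Fintype κ] [DecidableEq κ] {S : Site n κ} {g : κ → κ → ℝ}
    {Φ : NOp n → NOp n} (hg : IsKernel S g Φ) (k l : κ) :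
    g k l = (Φ (pauliString (S.ov 0 l)) * pauliString (S.ov 0 k)).trace.re / 2 ^ n := by
  rw [hg]
  simp only [S.rd_ov, S.ov_ov, pauliString_trace_mul]
  have : ∀ i, (S.ov 0 l = S.ov 0 i) ↔ l = i := by
    intro i
    constructor
    · intro h
      rw [← S.rd_ov 0 l, h, S.rd_ov]
    · rintro rfl; rfl
  simp only [this]
  have h2 : ((2 : ℂ) ^ n) = ((2 ^ n : ℝ) : ℂ) := by push_cast; rfl
  simp only [mul_ite, mul_zero, Finset.sum_ite_eq, Finset.mem_univ, if_true, h2,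
    ← Complex.ofReal_mul, Complex.ofReal_re]
  field_simp

theorem localUnitary_single (q : Fin n) (v : Fin n → U2) :
    Circuit.localUnitary {q} v = onQubit q (v q : Matrix (Fin 2) (Fin 2) ℂ) := by
  ext x y
  simp only [Circuit.localUnitary, onQubit, Matrix.of_apply, Finset.mem_singleton]
  rw [← Finset.mul_prod_erase Finset.univ _ (Finset.mem_univ q), if_pos rfl]
  split_ifs with h
  · rw [Finset.prod_eq_one, mul_one]
    intro j hj
    have := Finset.ne_of_mem_erase hj
    rw [if_neg this, h j this, Matrix.one_apply_eq]
  · push Not at h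
    obtain ⟨j, hj, hxy⟩ := h
    rw [Finset.prod_eq_zero (Finset.mem_erase.2 ⟨hj, Finset.mem_univ j⟩), mul_zero]
    rw [if_neg hj, Matrix.one_apply_ne hxy]

theorem localUnitary_pair {q r : Fin n} (hqr : q ≠ r) (v : Fin n → U2) :
    Circuit.localUnitary {q, r} v = onPair q r
      ((v q : Matrix (Fin 2) (Fin 2) ℂ) ⊗ₖ (v r : Matrix (Fin 2) (Fin 2) ℂ)) := by
  ext x y
  simp only [Circuit.localUnitary, onPair, Matrix.of_apply, Finset.mem_insert,
    Finset.mem_singleton, Matrix.kroneckerMap_apply]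
  rw [← Finset.mul_prod_erase Finset.univ _ (Finset.mem_univ q),
    ← Finset.mul_prod_erase (Finset.univ.erase q) _ (Finset.mem_erase.2 ⟨hqr.symm, Finset.mem_univ r⟩),
    if_pos (Or.inl rfl), if_pos (Or.inr rfl), ← mul_assoc]
  split_ifs with h
  · rw [Finset.prod_eq_one, mul_one]
    intro j hj
    have h1 := Finset.ne_of_mem_erase hj
    have h2 := Finset.ne_of_mem_erase (Finset.mem_of_mem_erase hj)
    rw [if_neg (by tauto), h j h2 h1, Matrix.one_apply_eq]
  · push Not at h
    obtain ⟨j, hj, hr, hxy⟩ := h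
    rw [Finset.prod_eq_zero (Finset.mem_erase.2 ⟨hr, Finset.mem_erase.2 ⟨hj, Finset.mem_univ j⟩⟩),
      mul_zero]
    rw [if_neg (by tauto), Matrix.one_apply_ne hxy]

/-- The action of a feedforward operation on Pauli labels. -/
def feedKernel (φ ψ : ℝ) (k l : Fin 4) : ℝ :=
  basis1.ptm !![1, 0; 0, 0] k l + basis1.ptm (feedGate φ ψ * !![0, 0; 0, 1]) k l

theorem isKernel_feedChannel (φ ψ : ℝ) (q : Fin n) :
    IsKernel (site1 q) (feedKernel φ ψ) (feedChannel φ ψ q) := by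
  intro X a
  rw [feedChannel, Matrix.add_mul, Matrix.trace_add, isKernel_onQubit, isKernel_onQubit,
    ← Finset.sum_add_distrib]
  refine Finset.sum_congr rfl fun k _ => ?_
  rw [feedKernel]; push_cast; ring

theorem feedKernel_eq (φ ψ : ℝ) : feedKernel φ ψ =
    ![![1, 0, 0, 0],
      ![-(Real.sin φ * Real.cos φ * Real.sin ψ), 0, 0, Real.sin φ * Real.cos φ * Real.sin ψ],
      ![Real.sin φ * Real.cos φ * Real.cos ψ, 0, 0, -(Real.sin φ * Real.cos φ * Real.cos ψ)],
      ![Real.sin φ ^ 2, 0, 0, Real.cos φ ^ 2]] := by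
  have he : Complex.exp (Complex.I * ψ) = Real.cos ψ + Real.sin ψ * Complex.I := by
    rw [mul_comm, Complex.exp_mul_I]; push_cast; rfl
  have he' : Complex.exp (-(Complex.I * ψ)) = Real.cos ψ - Real.sin ψ * Complex.I := by
    rw [← mul_neg, ← Complex.ofReal_neg, mul_comm, Complex.exp_mul_I]; simp; ring
  have hφ := Real.sin_sq_add_cos_sq φ
  have hψ := Real.sin_sq_add_cos_sq ψ
  have hN : basis1.N = 2 := rfl
  ext k l
  rw [feedKernel, OpBasis.ptm, OpBasis.ptm, feedGate, he, he', hN]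
  simp only [basis1]
  generalize Real.sin φ = s at *
  generalize Real.cos φ = c at *
  generalize Real.sin ψ = s' at *
  generalize Real.cos ψ = c' at *
  fin_cases k <;> fin_cases l <;>
    simp [pauli, Matrix.trace_fin_two, Matrix.mul_apply, Fin.sum_univ_two] <;> nlinarith

end DynCircuit

namespace DynCircuit

open Matrix MeasureTheory

/-! ### Propagation of lower bounds on second moments -/

variable {n : ℕ}

/-- The product of the weights `b j` over the support of the Pauli string `a`. -/
def suppProd (b : Fin n → ℝ) (a : Fin n → Fin 4) : ℝ := ∏ j, if a j = 0 then 1 else b j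

/-- The expectation values of the Pauli matrices in the state `|0⟩`. -/
def zeroState : Fin 4 → ℝ := ![1, 0, 0, 1]

/-- The second moments `m a b` of the Pauli coefficients of a random state are diagonal on the
qubits in `t`, those of the state `|0⟩` on all other qubits, and bounded below in terms of the
weights `b`. -/
structure Spread (t : Finset (Fin n)) (b : Fin n → ℝ)
    (m : (Fin n → Fin 4) → (Fin n → Fin 4) → ℝ) : Prop where
  nonneg : ∀ j, 0 ≤ b j
  le_one : ∀ j, b j ≤ 1
  untouched : ∀ j, j ∉ t → b j = 0
  diag : ∀ j, j ∈ t → ∀ u v, u j ≠ v j → m u v = 0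
  zero : ∀ j, j ∉ t → ∀ u v, m u v
    = zeroState (u j) * zeroState (v j) * m (Function.update u j 0) (Function.update v j 0)
  low : ∀ a, suppProd b a ≤ m a a

/-- The second moments after an operation with second moments `Γ` on the site `S`, followed by
random gates with transition probabilities `τ`. -/
def stepMoment {κ : Type} [Fintype κ] [DecidableEq κ] (S : Site n κ) (τ : κ → κ → ℝ)
    (Γ : κ → κ → κ → ℝ) (m : (Fin n → Fin 4) → (Fin n → Fin 4) → ℝ) (a b : Fin n → Fin 4) : ℝ :=
  if S.rd a = S.rd b then ∑ e, τ (S.rd a) e * ∑ k, ∑ l, Γ e k l * m (S.ov a k) (S.ov b l) else 0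

theorem suppProd_nonneg {b : Fin n → ℝ} (hb : ∀ j, 0 ≤ b j) (a : Fin n → Fin 4) :
    0 ≤ suppProd b a := Finset.prod_nonneg fun j _ => by split_ifs <;> simp [hb]

/-- Everything except the lower bound is the same for all operations: the twirl makes the site
diagonal, and a qubit outside the site keeps its label. Only `hlow` depends on the kind of
operation. -/
theorem Spread.step {κ : Type} [Fintype κ] [DecidableEq κ] {t : Finset (Fin n)} {b b' : Fin n → ℝ}
    {m : (Fin n → Fin 4) → (Fin n → Fin 4) → ℝ} (h : Spread t b m) (S : Site n κ)
    (τ : κ → κ → ℝ) (Γ : κ → κ → κ → ℝ) (h0 : ∀ j, 0 ≤ b' j) (h1 : ∀ j, b' j ≤ 1)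
    (hb' : ∀ j, j ∉ S.supp → b' j = b j)
    (hlow : ∀ a, suppProd b' a ≤ stepMoment S τ Γ m a a) :
    Spread (t ∪ S.supp) b' (stepMoment S τ Γ m) where
  nonneg := h0
  le_one := h1
  untouched j hj := by
    rw [Finset.mem_union, not_or] at hj
    rw [hb' j hj.2, h.untouched j hj.1]
  diag j hj u v huv := by
    rw [stepMoment]
    by_cases hjs : j ∈ S.supp
    · rw [if_neg (S.rd_ne u v j hjs huv)]
    · have hjt : j ∈ t := (Finset.mem_union.1 hj).resolve_right hjs
      split_ifs
      · refine Finset.sum_eq_zero fun e _ => ?_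
        rw [Finset.sum_eq_zero, mul_zero]
        refine fun k _ => Finset.sum_eq_zero fun l _ => ?_
        rw [h.diag j hjt, mul_zero]
        rwa [S.ov_apply _ _ _ hjs, S.ov_apply _ _ _ hjs]
      · rfl
  zero j hj u v := by
    rw [Finset.mem_union, not_or] at hj
    simp only [stepMoment, S.rd_update _ _ _ hj.2]
    split_ifs
    · rw [Finset.mul_sum]
      refine Finset.sum_congr rfl fun e _ => ?_
      rw [mul_left_comm]
      congr 1
      rw [Finset.mul_sum]
      refine Finset.sum_congr rfl fun k _ => ?_
      rw [Finset.mul_sum]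
      refine Finset.sum_congr rfl fun l _ => ?_
      rw [h.zero j hj.1, S.ov_apply _ _ _ hj.2, S.ov_apply _ _ _ hj.2, S.ov_update _ _ _ _ hj.2,
        S.ov_update _ _ _ _ hj.2]
      ring
    · rw [mul_zero]
  low := hlow

/-- The part of `suppProd` outside the qubit `q`. -/
def rest1 (b : Fin n → ℝ) (q : Fin n) (a : Fin n → Fin 4) : ℝ :=
  ∏ j ∈ Finset.univ.erase q, if a j = 0 then 1 else b j

/-- The part of `suppProd` outside the qubits `q` and `r`. -/
def rest2 (b : Fin n → ℝ) (q r : Fin n) (a : Fin n → Fin 4) : ℝ :=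
  ∏ j ∈ (Finset.univ.erase q).erase r, if a j = 0 then 1 else b j

theorem suppProd_site1 (b b' : Fin n → ℝ) (q : Fin n) (hb : ∀ j, j ≠ q → b' j = b j)
    (a : Fin n → Fin 4) (k : Fin 4) :
    suppProd b' ((site1 q).ov a k) = (if k = 0 then 1 else b' q) * rest1 b q a := by
  rw [suppProd, ← Finset.mul_prod_erase Finset.univ _ (Finset.mem_univ q)]
  congr 1
  · simp [site1]
  · refine Finset.prod_congr rfl fun j hj => ?_
    have := Finset.ne_of_mem_erase hj
    simp [site1, this, hb j this]

theorem suppProd_site2 (b b' : Fin n → ℝ) {q r : Fin n} (hqr : q ≠ r)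
    (hb : ∀ j, j ≠ q → j ≠ r → b' j = b j) (a : Fin n → Fin 4) (k : Fin 4 × Fin 4) :
    suppProd b' ((site2 q r hqr).ov a k)
      = (if k.1 = 0 then 1 else b' q) * (if k.2 = 0 then 1 else b' r) * rest2 b q r a := by
  rw [suppProd, ← Finset.mul_prod_erase Finset.univ _ (Finset.mem_univ q),
    ← Finset.mul_prod_erase (Finset.univ.erase q) _ (Finset.mem_erase.2 ⟨hqr.symm, Finset.mem_univ r⟩),
    mul_assoc]
  congr 1
  · simp [site2, hqr]
  · congr 1
    · simp [site2]
    · refine Finset.prod_congr rfl fun j hj => ?_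
      have h1 := Finset.ne_of_mem_erase hj
      have h2 := Finset.ne_of_mem_erase (Finset.mem_of_mem_erase hj)
      simp [site2, h1, h2, hb j h2 h1]

theorem rest1_nonneg {b : Fin n → ℝ} (hb : ∀ j, 0 ≤ b j) (q : Fin n) (a : Fin n → Fin 4) :
    0 ≤ rest1 b q a := Finset.prod_nonneg fun j _ => by split_ifs <;> simp [hb]

theorem rest2_nonneg {b : Fin n → ℝ} (hb : ∀ j, 0 ≤ b j) (q r : Fin n) (a : Fin n → Fin 4) :
    0 ≤ rest2 b q r a := Finset.prod_nonneg fun j _ => by split_ifs <;> simp [hb]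

theorem stepMoment_of_rd_one {κ : Type} [Fintype κ] [DecidableEq κ] (S : Site n κ) (τ : κ → κ → ℝ)
    (Γ : κ → κ → κ → ℝ) (m : (Fin n → Fin 4) → (Fin n → Fin 4) → ℝ) (o : κ)
    (hτ : ∀ e, τ o e = if e = o then 1 else 0)
    (hΓ : ∀ k l, Γ o k l = if k = o ∧ l = o then 1 else 0) (a : Fin n → Fin 4) (ha : S.rd a = o) :
    stepMoment S τ Γ m a a = m a a := by
  rw [stepMoment, if_pos rfl, ha, Finset.sum_eq_single o, Finset.sum_eq_single o,
    Finset.sum_eq_single o]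
  · have ho : S.ov a o = a := ha ▸ S.ov_rd a
    rw [hτ, hΓ, ho]
    simp
  · intro l _ hl; simp [hΓ, hl]
  · simp
  · intro k _ hk; simp [hΓ, hk]
  · simp
  · intro e _ he; simp [hτ, he]
  · simp

theorem twirl1_zero_left (e : Fin 4) : twirl1 0 e = if e = 0 then 1 else 0 := by simp [twirl1]

theorem twirl2_zero_left (e : Fin 4 × Fin 4) : twirl2 0 e = if e = 0 then 1 else 0 := by
  obtain ⟨x, y⟩ := e
  simp only [twirl2, Prod.fst_zero, Prod.snd_zero, twirl1_zero_left, Prod.mk_eq_zero]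
  split_ifs <;> simp_all

theorem sum_twirl1 (a : Fin 4) : ∑ e, twirl1 a e = 1 := by
  by_cases ha : a = 0 <;> simp [twirl1, ha, Fin.sum_univ_four]; norm_num

/-- Used when the qubit has been touched: only the diagonal entries of Γ contribute to the new
moment. -/
theorem Spread.diag_site1 {t : Finset (Fin n)} {b : Fin n → ℝ}
    {m : (Fin n → Fin 4) → (Fin n → Fin 4) → ℝ} (h : Spread t b m) {q : Fin n} (hq : q ∈ t)
    (a : Fin n → Fin 4) {k l : Fin 4} (hkl : k ≠ l) :
    m ((site1 q).ov a k) ((site1 q).ov a l) = 0 := h.diag q hq _ _ (by simpa [site1] using hkl)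

/-- On a touched qubit the new moment is an average of old ones, each at least the old bound: a
label 0 only drops a factor `b q` ≤ 1. On an untouched qubit the weight is 0 and positivity
suffices. -/
theorem Spread.low_single {t : Finset (Fin n)} {b : Fin n → ℝ}
    {m : (Fin n → Fin 4) → (Fin n → Fin 4) → ℝ} (h : Spread t b m) (q : Fin n)
    (Γ : Fin 4 → Fin 4 → Fin 4 → ℝ) (hΓ0 : ∀ k l, Γ 0 k l = if k = 0 ∧ l = 0 then 1 else 0)
    (hΓn : ∀ e k, 0 ≤ Γ e k k) (hΓs : ∀ e, ∑ k, Γ e k k = 1)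
    (hpos : ∀ a, 0 ≤ stepMoment (site1 q) twirl1 Γ m a a) (a : Fin n → Fin 4) :
    suppProd b a ≤ stepMoment (site1 q) twirl1 Γ m a a := by
  by_cases ha : a q = 0
  · rw [stepMoment_of_rd_one (site1 q) twirl1 Γ m 0 twirl1_zero_left hΓ0 a ha]
    exact h.low a
  have hsp := fun k => suppProd_site1 b b q (fun _ _ => rfl) a k
  have hs : suppProd b a = b q * rest1 b q a := by
    have := hsp (a q)
    rw [if_neg ha] at this
    rw [← this]
    simp [site1]
  by_cases hq : q ∈ t
  · have hR := rest1_nonneg h.nonneg q a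
    have hm : ∀ k, suppProd b a ≤ m ((site1 q).ov a k) ((site1 q).ov a k) := by
      intro k
      refine le_trans ?_ (h.low _)
      rw [hsp, hs]
      refine mul_le_mul_of_nonneg_right ?_ hR
      split_ifs
      · exact h.le_one q
      · exact le_rfl
    rw [stepMoment, if_pos rfl]
    have h2 : ∀ e, suppProd b a ≤ ∑ k, ∑ l, Γ e k l * m ((site1 q).ov a k) ((site1 q).ov a l) := by
      intro e
      calc suppProd b a = ∑ k, Γ e k k * suppProd b a := by rw [← Finset.sum_mul, hΓs, one_mul]
        _ ≤ ∑ k, Γ e k k * m ((site1 q).ov a k) ((site1 q).ov a k) :=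
            Finset.sum_le_sum fun k _ => mul_le_mul_of_nonneg_left (hm k) (hΓn e k)
        _ = _ := by
            refine Finset.sum_congr rfl fun k _ => ?_
            rw [Finset.sum_eq_single k]
            · intro l _ hl; rw [h.diag_site1 hq a (Ne.symm hl), mul_zero]
            · simp
    calc suppProd b a = ∑ e, twirl1 (a q) e * suppProd b a := by
          rw [← Finset.sum_mul, sum_twirl1, one_mul]
      _ ≤ _ := Finset.sum_le_sum fun e _ => mul_le_mul_of_nonneg_left (h2 e) (twirl1_nonneg _ _)
  · rw [hs, h.untouched q hq, zero_mul]
    exact hpos a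

/-- No case distinction on touched qubits is needed. The cross terms between labels I and Z from the
X and Y rows cancel those from the Z row, leaving (sin²φ m_I + cos²φ m_Z)/3. The first term carries
the full weight of the remaining qubits. -/
theorem Spread.low_feed {t : Finset (Fin n)} {b : Fin n → ℝ}
    {m : (Fin n → Fin 4) → (Fin n → Fin 4) → ℝ} (h : Spread t b m) (q : Fin n) (φ ψ : ℝ)
    (a : Fin n → Fin 4) :
    suppProd (Function.update b q (Real.sin φ ^ 2 / 3)) a ≤ stepMoment (site1 q) twirl1
      (fun e k l => feedKernel φ ψ e k * feedKernel φ ψ e l) m a a := by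
  set b' := Function.update b q (Real.sin φ ^ 2 / 3) with hb'
  have hsp' := suppProd_site1 b b' q (fun j hj => by simp [hb', hj]) a (a q)
  have hsp := fun k => suppProd_site1 b b q (fun _ _ => rfl) a k
  have ho : (site1 q).ov a (a q) = a := (site1 q).ov_rd a
  rw [ho] at hsp'
  by_cases ha : a q = 0
  · rw [stepMoment_of_rd_one (site1 q) twirl1 _ m 0 twirl1_zero_left ?_ a ha]
    · refine le_trans (le_of_eq ?_) (h.low a)
      have := hsp (a q)
      rw [ho] at this
      rw [hsp', this, if_pos ha, if_pos ha]
    · intro k l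
      rw [feedKernel_eq]
      fin_cases k <;> fin_cases l <;> simp
  · rw [if_neg ha] at hsp'
    rw [hsp', stepMoment, if_pos rfl]
    have h0 := h.low ((site1 q).ov a 0)
    rw [hsp, if_pos rfl, one_mul] at h0
    have h3 := (suppProd_nonneg h.nonneg ((site1 q).ov a 3)).trans (h.low ((site1 q).ov a 3))
    have hφ := Real.sin_sq_add_cos_sq φ
    have hψ := Real.sin_sq_add_cos_sq ψ
    have hrd : (site1 q).rd a = a q := rfl
    rw [hrd]
    simp only [Fin.sum_univ_four, feedKernel_eq, twirl1, if_neg ha]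
    have hbq : b' q = Real.sin φ ^ 2 / 3 := by simp [hb']
    rw [hbq]
    simp
    generalize m ((site1 q).ov a 0) ((site1 q).ov a 0) = m0 at *
    generalize m ((site1 q).ov a 0) ((site1 q).ov a 3) = m03 at *
    generalize m ((site1 q).ov a 3) ((site1 q).ov a 0) = m30 at *
    generalize m ((site1 q).ov a 3) ((site1 q).ov a 3) = m3 at *
    generalize Real.sin φ = s at *
    generalize Real.cos φ = c at *
    generalize Real.sin ψ = s' at *
    generalize Real.cos ψ = c' at *
    generalize rest1 b q a = R at *
    have e1 : s ^ 2 / 3 * R ≤ s ^ 2 / 3 * m0 := mul_le_mul_of_nonneg_left h0 (by positivity)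
    have e2 : 0 ≤ c ^ 2 / 3 * m3 := by positivity
    have e3 : s ^ 2 / 3 * R ≤ s ^ 2 / 3 * m0 + c ^ 2 / 3 * m3 := by linarith
    refine e3.trans (le_of_eq ?_)
    linear_combination -(s ^ 2 * c ^ 2 / 3 * (m0 - m03 - m30 + m3)) * hψ
      - (s ^ 2 * m0 / 3 + c ^ 2 * m3 / 3) * hφ

theorem twirl2_sum_mul_le {e : Fin 4 × Fin 4} {A B : Fin 4 × Fin 4 → ℝ} (h : ∀ j, A j ≤ B j) :
    ∑ j, twirl2 e j * A j ≤ ∑ j, twirl2 e j * B j :=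
  Finset.sum_le_sum fun j _ => mul_le_mul_of_nonneg_left (h j) (twirl2_nonneg _ _)

/-- The weights after a two-qubit gate. -/
def pairWeight (κ : ℝ) (b : Fin n → ℝ) (q r : Fin n) : Fin n → ℝ :=
  Function.update (Function.update b q (κ * max (b q) (b r))) r (κ * max (b q) (b r))

theorem Spread.low_pair {t : Finset (Fin n)} {b : Fin n → ℝ}
    {m : (Fin n → Fin 4) → (Fin n → Fin 4) → ℝ} (h : Spread t b m) {q r : Fin n} (hqr : q ≠ r)
    (Γ : Fin 4 × Fin 4 → Fin 4 × Fin 4 → Fin 4 × Fin 4 → ℝ) (κ : ℝ) (hκ0 : 0 ≤ κ) (hκ : κ ≤ 1 / 5)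
    (hΓ0 : ∀ k l, Γ 0 k l = if k = 0 ∧ l = 0 then 1 else 0)
    (hΓn : ∀ e k, 0 ≤ Γ e k k)
    (hΓl : ∀ e ≠ 0, κ ≤ ∑ j, twirl2 e j * ∑ c, Γ j (c, 0) (c, 0))
    (hΓr : ∀ e ≠ 0, κ ≤ ∑ j, twirl2 e j * ∑ c, Γ j (0, c) (0, c))
    (hAn : ∀ e c, 0 ≤ ∑ k, ∑ l, zeroState k * zeroState l * Γ e (c, k) (c, l))
    (hA : ∀ e ≠ 0, (if e.1 ≠ 0 ∧ e.2 ≠ 0 then 1 / 9 else 1 / 3 : ℝ)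
      ≤ ∑ j, twirl2 e j * ∑ c, ∑ k, ∑ l, zeroState k * zeroState l * Γ j (c, k) (c, l))
    (hAn' : ∀ e c, 0 ≤ ∑ k, ∑ l, zeroState k * zeroState l * Γ e (k, c) (l, c))
    (hA' : ∀ e ≠ 0, (if e.1 ≠ 0 ∧ e.2 ≠ 0 then 1 / 9 else 1 / 3 : ℝ)
      ≤ ∑ j, twirl2 e j * ∑ c, ∑ k, ∑ l, zeroState k * zeroState l * Γ j (k, c) (l, c))
    (hpos : ∀ a, 0 ≤ stepMoment (site2 q r hqr) twirl2 Γ m a a) (a : Fin n → Fin 4) :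
    suppProd (pairWeight κ b q r) a ≤ stepMoment (site2 q r hqr) twirl2 Γ m a a := by
  set S := site2 q r hqr with hS
  set b' := pairWeight κ b q r with hb'
  set M := max (b q) (b r) with hM
  have hbq : b' q = κ * M := by simp [hb', pairWeight, hqr, hM]
  have hbr : b' r = κ * M := by simp [hb', pairWeight, hM]
  have hsp' := suppProd_site2 b b' hqr
    (fun j hq hr => by simp [hb', pairWeight, hq, hr]) a (S.rd a)
  have hsp := fun k => suppProd_site2 b b hqr (fun _ _ _ => rfl) a k
  have ho : (site2 q r hqr).ov a (S.rd a) = a := S.ov_rd a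
  rw [ho] at hsp'
  set R := rest2 b q r a with hRdef
  have hR : 0 ≤ R := rest2_nonneg h.nonneg q r a
  by_cases ha : S.rd a = 0
  · rw [stepMoment_of_rd_one S twirl2 Γ m 0 twirl2_zero_left hΓ0 a ha]
    refine le_trans (le_of_eq ?_) (h.low a)
    have := hsp (S.rd a)
    rw [ho] at this
    rw [hsp', this, ha]
    simp
  set e := S.rd a with he
  have hM0 : 0 ≤ M := (h.nonneg q).trans (le_max_left _ _)
  have hM1 : M ≤ 1 := max_le (h.le_one q) (h.le_one r)
  have hκM0 : 0 ≤ κ * M := mul_nonneg hκ0 hM0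
  have hκM1 : κ * M ≤ 1 := by nlinarith
  rw [hbq, hbr] at hsp'
  -- If the string meets both qubits, the target contains (κM)², which is at most κM because κM ≤ 1.
  have hW1 : suppProd b' a ≤ κ * M * R := by
    rw [hsp']
    refine mul_le_mul_of_nonneg_right ?_ hR
    by_cases h1 : e.1 = 0 <;> by_cases h2 : e.2 = 0
    · exact absurd (Prod.ext h1 h2) ha
    · simp [h1, h2]
    · simp [h1, h2]
    · simp only [h1, h2, if_false]; nlinarith
  -- Here κ ≤ 1/5 enters: κM ≤ M/3, and (κM)² ≤ M²/25 ≤ M/9.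
  have hW2 : suppProd b' a ≤ (if e.1 ≠ 0 ∧ e.2 ≠ 0 then 1 / 9 else 1 / 3 : ℝ) * (M * R) := by
    rw [hsp', ← mul_assoc]
    refine mul_le_mul_of_nonneg_right ?_ hR
    by_cases h1 : e.1 = 0 <;> by_cases h2 : e.2 = 0
    · exact absurd (Prod.ext h1 h2) ha
    · simp [h1, h2]; nlinarith
    · simp [h1, h2]; nlinarith
    · simp only [h1, h2, if_false, ne_eq, not_false_eq_true, and_self, if_true]
      have : κ * M ≤ 1 / 5 * M := mul_le_mul_of_nonneg_right hκ hM0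
      nlinarith [mul_le_mul this this hκM0 (by positivity)]
  have hmq : ∀ c, b q * R ≤ m (S.ov a (c, 0)) (S.ov a (c, 0)) := by
    intro c
    refine le_trans ?_ (h.low _)
    rw [hS, hsp]
    simp only [if_true, mul_one]
    refine mul_le_mul_of_nonneg_right ?_ hR
    split_ifs
    · exact h.le_one q
    · exact le_rfl
  have hmr : ∀ c, b r * R ≤ m (S.ov a (0, c)) (S.ov a (0, c)) := by
    intro c
    refine le_trans ?_ (h.low _)
    rw [hS, hsp]
    simp only [if_true, one_mul]
    refine mul_le_mul_of_nonneg_right ?_ hR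
    split_ifs
    · exact h.le_one r
    · exact le_rfl
  have hmn : ∀ k, 0 ≤ m (S.ov a k) (S.ov a k) := fun k =>
    (suppProd_nonneg h.nonneg _).trans (h.low _)
  have hdq : q ∈ t → ∀ k l : Fin 4 × Fin 4, k.1 ≠ l.1 → m (S.ov a k) (S.ov a l) = 0 :=
    fun hq k l hkl => h.diag q hq _ _ (by simpa [hS, site2, hqr] using hkl)
  have hdr : r ∈ t → ∀ k l : Fin 4 × Fin 4, k.2 ≠ l.2 → m (S.ov a k) (S.ov a l) = 0 :=
    fun hq k l hkl => h.diag r hq _ _ (by simpa [hS, site2] using hkl)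
  by_cases hq : q ∈ t <;> by_cases hr : r ∈ t
  -- Both qubits are scrambled, so the moments are diagonal. Keeping only the labels trivial on `r`,
  -- or only those trivial on `q`, yields the two bounds whose maximum is needed.
  · refine hW1.trans ?_
    rw [stepMoment, if_pos rfl]
    have hd : ∀ j, ∑ k, ∑ l, Γ j k l * m (S.ov a k) (S.ov a l)
        = ∑ k, Γ j k k * m (S.ov a k) (S.ov a k) := by
      intro j
      refine Finset.sum_congr rfl fun k _ => ?_
      rw [Finset.sum_eq_single k]
      · intro l _ hl
        by_cases h1 : k.1 = l.1
        · rw [hdr hr k l fun h2 => hl (Prod.ext h1 h2).symm, mul_zero]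
        · rw [hdq hq k l h1, mul_zero]
      · simp
    simp only [hd]
    have hsub1 : ∀ j, (∑ c, Γ j (c, 0) (c, 0)) * (b q * R)
        ≤ ∑ k, Γ j k k * m (S.ov a k) (S.ov a k) := by
      intro j
      rw [Fintype.sum_prod_type, Finset.sum_mul]
      refine Finset.sum_le_sum fun c _ => ?_
      refine (mul_le_mul_of_nonneg_left (hmq c) (hΓn j _)).trans ?_
      exact Finset.single_le_sum
        (f := fun y => Γ j (c, y) (c, y) * m (S.ov a (c, y)) (S.ov a (c, y)))
        (fun y _ => mul_nonneg (hΓn _ _) (hmn _)) (Finset.mem_univ 0)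
    have hsub2 : ∀ j, (∑ c, Γ j (0, c) (0, c)) * (b r * R)
        ≤ ∑ k, Γ j k k * m (S.ov a k) (S.ov a k) := by
      intro j
      rw [Fintype.sum_prod_type_right, Finset.sum_mul]
      refine Finset.sum_le_sum fun c _ => ?_
      refine (mul_le_mul_of_nonneg_left (hmr c) (hΓn j _)).trans ?_
      exact Finset.single_le_sum
        (f := fun y => Γ j (y, c) (y, c) * m (S.ov a (y, c)) (S.ov a (y, c)))
        (fun y _ => mul_nonneg (hΓn _ _) (hmn _)) (Finset.mem_univ 0)
    have h1 : κ * (b q * R) ≤ ∑ j, twirl2 e j * ∑ k, Γ j k k * m (S.ov a k) (S.ov a k) := by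
      refine le_trans (mul_le_mul_of_nonneg_right (hΓl e ha) (mul_nonneg (h.nonneg q) hR)) ?_
      rw [Finset.sum_mul]
      simp only [mul_assoc]
      exact twirl2_sum_mul_le hsub1
    have h2 : κ * (b r * R) ≤ ∑ j, twirl2 e j * ∑ k, Γ j k k * m (S.ov a k) (S.ov a k) := by
      refine le_trans (mul_le_mul_of_nonneg_right (hΓr e ha) (mul_nonneg (h.nonneg r) hR)) ?_
      rw [Finset.sum_mul]
      simp only [mul_assoc]
      exact twirl2_sum_mul_le hsub2
    rcases max_choice (b q) (b r) with hm | hm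
    · rw [hM, hm, mul_assoc]; exact h1
    · rw [hM, hm, mul_assoc]; exact h2
  -- Here `r` is still in |0⟩. The moments factor through `zeroState`, and the cross terms of I and
  -- Z assemble into squares, which the gate-independent bound controls.
  · have hbr0 := h.untouched r hr
    have hMq : M = b q := by rw [hM, hbr0]; exact max_eq_left (h.nonneg q)
    refine hW2.trans ?_
    rw [stepMoment, if_pos rfl, hMq]
    refine le_trans (mul_le_mul_of_nonneg_right (hA e ha) (mul_nonneg (h.nonneg q) hR)) ?_
    rw [Finset.sum_mul]
    simp only [mul_assoc]
    refine twirl2_sum_mul_le fun j => ?_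
    have hz : ∀ k l : Fin 4 × Fin 4, m (S.ov a k) (S.ov a l)
        = if k.1 = l.1 then zeroState k.2 * zeroState l.2 *
          m (S.ov a (k.1, 0)) (S.ov a (k.1, 0)) else 0 := by
      intro k l
      split_ifs with hkl
      · rw [h.zero r hr]
        simp [hS, site2, hkl]
      · exact hdq hq k l hkl
    rw [Fintype.sum_prod_type, Finset.sum_mul]
    refine Finset.sum_le_sum fun c _ => ?_
    have : ∑ y, ∑ l, Γ j (c, y) l * m (S.ov a (c, y)) (S.ov a l)
        = (∑ k, ∑ l, zeroState k * zeroState l * Γ j (c, k) (c, l)) *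
          m (S.ov a (c, 0)) (S.ov a (c, 0)) := by
      rw [Finset.sum_mul]
      refine Finset.sum_congr rfl fun k _ => ?_
      rw [Fintype.sum_prod_type, Finset.sum_mul, Finset.sum_eq_single c]
      · refine Finset.sum_congr rfl fun l _ => ?_
        rw [hz]; simp; ring
      · intro c' _ hc'
        refine Finset.sum_eq_zero fun l _ => ?_
        rw [hz, if_neg (Ne.symm hc'), mul_zero]
      · simp
    rw [this]
    simp only [← mul_assoc]
    have := mul_le_mul_of_nonneg_left (hmq c) (hAn j c)
    simpa only [← mul_assoc] using this
  -- The mirror case, with `q` still in |0⟩.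
  · have hbq0 := h.untouched q hq
    have hMr : M = b r := by rw [hM, hbq0]; exact max_eq_right (h.nonneg r)
    refine hW2.trans ?_
    rw [stepMoment, if_pos rfl, hMr]
    refine le_trans (mul_le_mul_of_nonneg_right (hA' e ha) (mul_nonneg (h.nonneg r) hR)) ?_
    rw [Finset.sum_mul]
    simp only [mul_assoc]
    refine twirl2_sum_mul_le fun j => ?_
    have hz : ∀ k l : Fin 4 × Fin 4, m (S.ov a k) (S.ov a l)
        = if k.2 = l.2 then zeroState k.1 * zeroState l.1 *
          m (S.ov a (0, k.2)) (S.ov a (0, k.2)) else 0 := by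
      intro k l
      split_ifs with hkl
      · have hu : ∀ k : Fin 4 × Fin 4, Function.update (S.ov a k) q 0 = S.ov a (0, k.2) := by
          intro k
          simp only [hS, site2]
          rw [Function.update_comm hqr.symm, Function.update_idem]
        rw [h.zero q hq, hu, hu, hkl]
        simp [hS, site2, hqr]
      · exact hdr hr k l hkl
    rw [Fintype.sum_prod_type_right, Finset.sum_mul]
    refine Finset.sum_le_sum fun c _ => ?_
    have : ∑ y, ∑ l, Γ j (y, c) l * m (S.ov a (y, c)) (S.ov a l)
        = (∑ k, ∑ l, zeroState k * zeroState l * Γ j (k, c) (l, c)) *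
          m (S.ov a (0, c)) (S.ov a (0, c)) := by
      rw [Finset.sum_mul]
      refine Finset.sum_congr rfl fun k _ => ?_
      rw [Fintype.sum_prod_type, Finset.sum_comm, Finset.sum_mul, Finset.sum_eq_single c]
      · refine Finset.sum_congr rfl fun l _ => ?_
        rw [hz]; simp; ring
      · intro c' _ hc'
        refine Finset.sum_eq_zero fun l _ => ?_
        rw [hz, if_neg (Ne.symm hc'), mul_zero]
      · simp
    rw [this]
    simp only [← mul_assoc]
    have := mul_le_mul_of_nonneg_left (hmr c) (hAn' j c)
    simpa only [← mul_assoc] using this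
  -- With both qubits untouched the new weights are 0, so positivity is enough.
  · refine le_trans hW1 ?_
    have : M = 0 := by rw [hM, h.untouched q hq, h.untouched r hr, max_self]
    rw [this, mul_zero, zero_mul]
    exact hpos a

end DynCircuit

namespace DynCircuit

open Matrix MeasureTheory ProbabilityTheory

/-! ### Independence of the operations -/

/-- An intersection of events pulled back from the two factors is a rectangle, whose measure
factors. -/
theorem iIndep_prod {ι Ω Ω' : Type*} {mΩ : MeasurableSpace Ω} {mΩ' : MeasurableSpace Ω'}
    {μ : Measure Ω} {ν : Measure Ω'} [IsProbabilityMeasure μ] [IsProbabilityMeasure ν]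
    {m : ι → MeasurableSpace Ω} {m' : ι → MeasurableSpace Ω'}
    (hm : iIndep m μ) (hm' : iIndep m' ν) :
    iIndep (Sum.elim (fun i => (m i).comap Prod.fst) (fun i => (m' i).comap Prod.snd))
      (μ.prod ν) := by
  rw [iIndep_iff]
  intro s f hf
  -- Indices outside `s` get the dummy value ∅, which lets `choose` return a total family.
  have hA : ∀ i, ∃ A, Sum.inl i ∈ s → MeasurableSet[m i] A ∧ Prod.fst ⁻¹' A = f (Sum.inl i) := by
    intro i
    by_cases hi : Sum.inl i ∈ s
    · obtain ⟨A, h1, h2⟩ := hf _ hi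
      exact ⟨A, fun _ => ⟨h1, h2⟩⟩
    · exact ⟨∅, fun h => absurd h hi⟩
  have hC : ∀ i, ∃ A, Sum.inr i ∈ s → MeasurableSet[m' i] A ∧ Prod.snd ⁻¹' A = f (Sum.inr i) := by
    intro i
    by_cases hi : Sum.inr i ∈ s
    · obtain ⟨A, h1, h2⟩ := hf _ hi
      exact ⟨A, fun _ => ⟨h1, h2⟩⟩
    · exact ⟨∅, fun h => absurd h hi⟩
  choose A hA using hA
  choose C hC using hC
  have hset : ⋂ i ∈ s, f i = (⋂ i ∈ s.toLeft, A i) ×ˢ (⋂ i ∈ s.toRight, C i) := by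
    ext ⟨x, y⟩
    simp only [Set.mem_iInter, Set.mem_prod, Finset.mem_toLeft, Finset.mem_toRight, Sum.forall]
    refine and_congr (forall_congr' fun i => forall_congr' fun hi => ?_)
      (forall_congr' fun i => forall_congr' fun hi => ?_)
    · rw [← (hA i hi).2]; rfl
    · rw [← (hC i hi).2]; rfl
  rw [hset, Measure.prod_prod, hm.meas_biInter fun i hi => (hA i (Finset.mem_toLeft.1 hi)).1,
    hm'.meas_biInter fun i hi => (hC i (Finset.mem_toRight.1 hi)).1]
  conv_rhs => rw [← Finset.toLeft_disjSum_toRight (u := s), Finset.prod_disjSum]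
  congr 1
  · refine Finset.prod_congr rfl fun i hi => ?_
    rw [← (hA i (Finset.mem_toLeft.1 hi)).2, ← Set.prod_univ, Measure.prod_prod, measure_univ,
      mul_one]
  · refine Finset.prod_congr rfl fun i hi => ?_
    rw [← (hC i (Finset.mem_toRight.1 hi)).2, ← Set.univ_prod, Measure.prod_prod, measure_univ,
      one_mul]

variable {n p m : ℕ}

/-- The σ-algebra of the parameters of operation `i`. -/
@[reducible] def blockAlg (owner : Fin p → Fin m) (i : Fin m) : MeasurableSpace (Params p) :=
  MeasurableSpace.comap (fun (θ : Params p) (l : {l : Fin p // owner l = i}) => θ l)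
    inferInstance

/-- The σ-algebras of the parameters and of the inserted gates of all operations. -/
@[reducible] def opAlg (n : ℕ) (owner : Fin p → Fin m) :
    Fin m ⊕ Fin m → MeasurableSpace (Params p × (Fin m → Fin n → U2)) :=
  Sum.elim (fun i => (blockAlg owner i).comap Prod.fst)
    (fun i => (MeasurableSpace.comap (fun V : Fin m → Fin n → U2 => V i) inferInstance).comap
      Prod.snd)

/-- The number of the operation to which a σ-algebra belongs. -/
def opTime : Fin m ⊕ Fin m → ℕ := Sum.elim Fin.val Fin.val

/-- The σ-algebra of everything that happens before operation number `t`. -/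
@[reducible] def pastAlg (n : ℕ) (owner : Fin p → Fin m) (t : ℕ) :
    MeasurableSpace (Params p × (Fin m → Fin n → U2)) :=
  ⨆ s ∈ {s | opTime s < t}, opAlg n owner s

/-- The joint law of the parameters and the inserted gates. -/
def jointLaw (n m : ℕ) (D : Measure (Params p)) (E : Measure U2) :
    Measure (Params p × (Fin m → Fin n → U2)) :=
  D.prod (Measure.pi fun _ => Measure.pi fun _ => E)

instance (D : Measure (Params p)) [IsProbabilityMeasure D] (E : Measure U2)
    [IsProbabilityMeasure E] : IsProbabilityMeasure (jointLaw n m D E) := by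
  unfold jointLaw; infer_instance

theorem blockAlg_le (owner : Fin p → Fin m) (i : Fin m) : blockAlg owner i ≤ MeasurableSpace.pi := by
  refine Measurable.comap_le ?_
  exact measurable_pi_lambda _ fun l => measurable_pi_apply _

theorem opAlg_le (owner : Fin p → Fin m) (s : Fin m ⊕ Fin m) :
    opAlg n owner s ≤ Prod.instMeasurableSpace := by
  rcases s with i | i
  · exact (MeasurableSpace.comap_mono (blockAlg_le owner i)).trans measurable_fst.comap_le
  · exact (MeasurableSpace.comap_mono (measurable_pi_apply i).comap_le).trans
      measurable_snd.comap_le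

theorem pastAlg_le (owner : Fin p → Fin m) (t : ℕ) : pastAlg n owner t ≤ Prod.instMeasurableSpace :=
  iSup₂_le fun s _ => opAlg_le owner s

theorem opAlg_le_pastAlg (owner : Fin p → Fin m) {s : Fin m ⊕ Fin m} {t : ℕ} (h : opTime s < t) :
    opAlg n owner s ≤ pastAlg n owner t :=
  le_iSup₂_of_le (f := fun s (_ : s ∈ {s | opTime s < t}) => opAlg n owner s) s h le_rfl

theorem pastAlg_mono (owner : Fin p → Fin m) {t t' : ℕ} (h : t ≤ t') :
    pastAlg n owner t ≤ pastAlg n owner t' :=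
  iSup₂_le fun _ hs => opAlg_le_pastAlg owner (lt_of_lt_of_le hs h)

theorem iIndep_opAlg {D : Measure (Params p)} [IsProbabilityMeasure D] {E : Measure U2}
    [IsProbabilityMeasure E] {owner : Fin p → Fin m}
    (h : iIndepFun (fun (i : Fin m) (θ : Params p) (l : {l : Fin p // owner l = i}) => θ l) D) :
    iIndep (opAlg n owner) (jointLaw n m D E) := by
  refine iIndep_prod h.iIndep ?_
  have := iIndepFun_pi (μ := fun _ : Fin m => Measure.pi fun _ : Fin n => E)
    (X := fun _ => id) fun _ => aemeasurable_id
  exact this.iIndep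

theorem indep_past {D : Measure (Params p)} [IsProbabilityMeasure D] {E : Measure U2}
    [IsProbabilityMeasure E] {owner : Fin p → Fin m}
    (h : iIndepFun (fun (i : Fin m) (θ : Params p) (l : {l : Fin p // owner l = i}) => θ l) D)
    (i : Fin m) :
    Indep (⨆ s ∈ {s | opTime s = i.val}, opAlg n owner s) (pastAlg n owner i)
      (jointLaw n m D E) := by
  refine indep_iSup_of_disjoint (opAlg_le owner) (iIndep_opAlg h) ?_
  rw [Set.disjoint_left]
  intro s h1 h2
  exact absurd h2 (by simp only [Set.mem_ofPred_eq] at h1 ⊢; omega)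

/-- Operation `i` is independent of its past; within the operation, the product form of `jointLaw`
separates parameters from inserted gates. -/
theorem integral_step_term {D : Measure (Params p)} [IsProbabilityMeasure D] {E : Measure U2}
    [IsProbabilityMeasure E] {owner : Fin p → Fin m}
    (h : iIndepFun (fun (i : Fin m) (θ : Params p) (l : {l : Fin p // owner l = i}) => θ l) D)
    (i : Fin m) {v : (Fin n → U2) → ℝ} (hv : Measurable v)
    {g : Params p → ℝ} (hg : Measurable[blockAlg owner i] g)
    {x : Params p × (Fin m → Fin n → U2) → ℝ} (hx : Measurable[pastAlg n owner i] x) :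
    ∫ w, v (w.2 i) * g w.1 * x w ∂(jointLaw n m D E)
      = (∫ V, v V ∂(Measure.pi fun _ => E)) * (∫ θ, g θ ∂D) * ∫ w, x w ∂(jointLaw n m D E) := by
  have hle1 : opAlg n owner (Sum.inr i) ≤ ⨆ s ∈ {s | opTime s = i.val}, opAlg n owner s :=
    le_iSup₂_of_le (f := fun s (_ : s ∈ {s | opTime s = i.val}) => opAlg n owner s) (Sum.inr i)
      rfl le_rfl
  have hle2 : opAlg n owner (Sum.inl i) ≤ ⨆ s ∈ {s | opTime s = i.val}, opAlg n owner s :=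
    le_iSup₂_of_le (f := fun s (_ : s ∈ {s | opTime s = i.val}) => opAlg n owner s) (Sum.inl i)
      rfl le_rfl
  have hv1 : Measurable[opAlg n owner (Sum.inr i)]
      (fun w : Params p × (Fin m → Fin n → U2) => v (w.2 i)) :=
    (hv.comp (comap_measurable (fun V : Fin m → Fin n → U2 => V i))).comp (comap_measurable _)
  have hg1 : Measurable[opAlg n owner (Sum.inl i)]
      (fun w : Params p × (Fin m → Fin n → U2) => g w.1) :=
    hg.comp (comap_measurable _)
  have hvg : Measurable[⨆ s ∈ {s | opTime s = i.val}, opAlg n owner s]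
      (fun w : Params p × (Fin m → Fin n → U2) => v (w.2 i) * g w.1) :=
    (hv1.mono hle1 le_rfl).mul (hg1.mono hle2 le_rfl)
  have hind : IndepFun (fun w : Params p × (Fin m → Fin n → U2) => v (w.2 i) * g w.1) x
      (jointLaw n m D E) := by
    rw [IndepFun_iff_Indep]
    exact indep_of_indep_of_le_left (indep_of_indep_of_le_right (indep_past h i) hx.comap_le)
      hvg.comap_le
  have hmvg : Measurable (fun w : Params p × (Fin m → Fin n → U2) => v (w.2 i) * g w.1) :=
    hvg.mono (iSup₂_le fun s _ => opAlg_le owner s) le_rfl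
  have hmx : Measurable x := hx.mono (pastAlg_le owner _) le_rfl
  rw [hind.integral_fun_mul_eq_mul_integral hmvg.aestronglyMeasurable hmx.aestronglyMeasurable]
  congr 1
  have hswap : ∀ w : Params p × (Fin m → Fin n → U2), v (w.2 i) * g w.1 = g w.1 * v (w.2 i) :=
    fun _ => mul_comm _ _
  simp only [hswap]
  rw [jointLaw, integral_prod_mul g (fun V : Fin m → Fin n → U2 => v (V i)), mul_comm]
  congr 1
  have hmp := measurePreserving_eval (fun _ : Fin m => Measure.pi fun _ : Fin n => E) i
  have hmap := integral_map hmp.measurable.aemeasurable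
    (f := v) (by rw [hmp.map_eq]; exact hv.aestronglyMeasurable)
  rw [hmp.map_eq] at hmap
  exact hmap.symm

/-- A real function is bounded. -/
def Bdd {Ω : Type*} (f : Ω → ℝ) : Prop := ∃ C, ∀ w, |f w| ≤ C

theorem Bdd.mul {Ω : Type*} {f g : Ω → ℝ} (hf : Bdd f) (hg : Bdd g) :
    Bdd fun w => f w * g w := by
  obtain ⟨C, hC⟩ := hf
  obtain ⟨C', hC'⟩ := hg
  refine ⟨C * C', fun w => ?_⟩
  rw [abs_mul]
  exact mul_le_mul (hC w) (hC' w) (abs_nonneg _) ((abs_nonneg _).trans (hC w))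

theorem Bdd.sum {Ω ι : Type*} {s : Finset ι} {f : ι → Ω → ℝ} (hf : ∀ i, Bdd (f i)) :
    Bdd fun w => ∑ i ∈ s, f i w := by
  choose C hC using hf
  exact ⟨∑ i ∈ s, C i, fun w => (Finset.abs_sum_le_sum_abs _ _).trans
    (Finset.sum_le_sum fun i _ => hC i w)⟩

theorem Bdd.integrable {Ω : Type*} [MeasurableSpace Ω] {μ : Measure Ω} [IsProbabilityMeasure μ]
    {f : Ω → ℝ} (hf : Bdd f) (hm : Measurable f) : Integrable f μ := by
  obtain ⟨C, hC⟩ := hf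
  exact Integrable.of_bound hm.aestronglyMeasurable C (Filter.Eventually.of_forall hC)

/-- The product of the two expansions integrates term by term. The gate moments force equal labels
read on the site and equal intermediate labels j = j', which is the form of `stepMoment`. -/
theorem integral_step {D : Measure (Params p)} [IsProbabilityMeasure D] {E : Measure U2}
    [IsProbabilityMeasure E] {owner : Fin p → Fin m}
    (h : iIndepFun (fun (i : Fin m) (θ : Params p) (l : {l : Fin p // owner l = i}) => θ l) D)
    (i : Fin m) {κ : Type} [Fintype κ] [DecidableEq κ] (S : Site n κ) (τ : κ → κ → ℝ)
    {v : (Fin n → U2) → κ → κ → ℝ} (hv : ∀ k l, Measurable fun V => v V k l)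
    (hvb : ∀ k l, Bdd fun V => v V k l)
    (hτ : ∀ a e b f, ∫ V, v V a e * v V b f ∂(Measure.pi fun _ => E)
      = if a = b ∧ e = f then τ a e else 0)
    {g : Params p → κ → κ → ℝ} (hg : ∀ k l, Measurable[blockAlg owner i] fun θ => g θ k l)
    (hgb : ∀ k l, Bdd fun θ => g θ k l)
    {x x' : (Fin n → Fin 4) → Params p × (Fin m → Fin n → U2) → ℝ}
    (hx : ∀ a, Measurable[pastAlg n owner i] (x a)) (hxb : ∀ a, Bdd (x a))
    (hx' : ∀ a w, x' a w = ∑ k, (∑ j, v (w.2 i) (S.rd a) j * g w.1 j k) * x (S.ov a k) w)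
    (a b : Fin n → Fin 4) :
    ∫ w, x' a w * x' b w ∂(jointLaw n m D E)
      = stepMoment S τ (fun e k l => ∫ θ, g θ e k * g θ e l ∂D)
          (fun a b => ∫ w, x a w * x b w ∂(jointLaw n m D E)) a b := by
  have hexp : ∀ w, x' a w * x' b w = ∑ j, ∑ k, ∑ l, ∑ j',
      (v (w.2 i) (S.rd a) j * v (w.2 i) (S.rd b) j') * (g w.1 j k * g w.1 j' l) *
        (x (S.ov a k) w * x (S.ov b l) w) := by
    intro w
    rw [hx', hx']
    simp only [Finset.sum_mul]
    rw [Finset.sum_comm]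
    refine Finset.sum_congr rfl fun j _ => Finset.sum_congr rfl fun k _ => ?_
    rw [Finset.mul_sum]
    refine Finset.sum_congr rfl fun l _ => ?_
    rw [Finset.mul_sum]
    exact Finset.sum_congr rfl fun j' _ => by ring
  have hxm : ∀ a, Measurable (x a) := fun a => (hx a).mono (pastAlg_le owner _) le_rfl
  have hgm : ∀ k l, Measurable fun θ => g θ k l := fun k l =>
    (hg k l).mono (blockAlg_le owner i) le_rfl
  have hint : ∀ j k l j', Integrable (fun w : Params p × (Fin m → Fin n → U2) =>
      (v (w.2 i) (S.rd a) j * v (w.2 i) (S.rd b) j') * (g w.1 j k * g w.1 j' l) *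
        (x (S.ov a k) w * x (S.ov b l) w)) (jointLaw n m D E) := by
    intro j k l j'
    have hv2 : ∀ k l, Measurable fun w : Params p × (Fin m → Fin n → U2) => v (w.2 i) k l :=
      fun k l => (hv k l).comp ((measurable_pi_apply i).comp measurable_snd)
    have hg2 : ∀ k l, Measurable fun w : Params p × (Fin m → Fin n → U2) => g w.1 k l :=
      fun k l => (hgm k l).comp measurable_fst
    have hvb2 : ∀ k l, Bdd fun w : Params p × (Fin m → Fin n → U2) => v (w.2 i) k l :=
      fun k l => (hvb k l).imp fun C hC w => hC _
    have hgb2 : ∀ k l, Bdd fun w : Params p × (Fin m → Fin n → U2) => g w.1 k l :=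
      fun k l => (hgb k l).imp fun C hC w => hC _
    refine Bdd.integrable ?_ ?_
    · exact (((hvb2 _ _).mul (hvb2 _ _)).mul ((hgb2 _ _).mul (hgb2 _ _))).mul
        ((hxb _).mul (hxb _))
    · exact (((hv2 _ _).mul (hv2 _ _)).mul ((hg2 _ _).mul (hg2 _ _))).mul ((hxm _).mul (hxm _))
  have hterm : ∀ j k l j', ∫ w : Params p × (Fin m → Fin n → U2),
      (v (w.2 i) (S.rd a) j * v (w.2 i) (S.rd b) j') * (g w.1 j k * g w.1 j' l) *
        (x (S.ov a k) w * x (S.ov b l) w) ∂(jointLaw n m D E)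
      = (if S.rd a = S.rd b ∧ j = j' then τ (S.rd a) j else 0) * (∫ θ, g θ j k * g θ j' l ∂D) *
        ∫ w, x (S.ov a k) w * x (S.ov b l) w ∂(jointLaw n m D E) := by
    intro j k l j'
    rw [integral_step_term h i (v := fun V => v V (S.rd a) j * v V (S.rd b) j')
      ((hv _ _).mul (hv _ _)) (g := fun θ => g θ j k * g θ j' l) ((hg _ _).mul (hg _ _))
      (x := fun w => x (S.ov a k) w * x (S.ov b l) w) ((hx _).mul (hx _)), hτ]
  simp only [hexp]
  rw [integral_finsetSum _ fun j _ => integrable_finsetSum _ fun k _ =>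
    integrable_finsetSum _ fun l _ => integrable_finsetSum _ fun j' _ => hint j k l j']
  simp only [integral_finsetSum _ fun k _ => integrable_finsetSum _ fun l _ =>
    integrable_finsetSum _ fun j' _ => hint _ k l j',
    integral_finsetSum _ fun l _ => integrable_finsetSum _ fun j' _ => hint _ _ l j',
    integral_finsetSum _ fun j' _ => hint _ _ _ j', hterm]
  rw [stepMoment]
  split_ifs with hab
  · refine Finset.sum_congr rfl fun j _ => ?_
    rw [Finset.mul_sum]
    refine Finset.sum_congr rfl fun k _ => ?_
    rw [Finset.mul_sum]
    refine Finset.sum_congr rfl fun l _ => ?_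
    rw [Finset.sum_eq_single j]
    · simp [hab]; ring
    · intro j' _ hj'; simp [Ne.symm hj']
    · simp
  · simp [hab]

end DynCircuit

namespace DynCircuit

open Matrix MeasureTheory ProbabilityTheory

variable {n p m : ℕ}

/-! ### The transfer matrices of all operations -/

/-- An operation, followed by random single-qubit gates on its qubits, in terms of Pauli
labels. -/
structure OpModel (op : Op n p) (φ ψ : ℝ) (E : Measure U2) where
  κ : Type
  [fin : Fintype κ]
  [dec : DecidableEq κ]
  S : Site n κ
  supp_eq : S.supp = op.support
  τ : κ → κ → ℝ
  v : (Fin n → U2) → κ → κ → ℝ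
  v_meas : ∀ k l, Measurable fun V => v V k l
  v_bdd : ∀ k l, Bdd fun V => v V k l
  v_moment : ∀ a e b f, ∫ V, v V a e * v V b f ∂(Measure.pi fun _ => E)
    = if a = b ∧ e = f then τ a e else 0
  v_kernel : ∀ V, IsKernel S (v V) (conj (Circuit.localUnitary op.support V))
  v_one : ∀ V l, v V (S.rd 0) l = if l = S.rd 0 then 1 else 0
  g : Params p → κ → κ → ℝ
  g_meas : ∀ k l, Measurable fun θ => g θ k l
  g_bdd : ∀ k l, Bdd fun θ => g θ k l
  g_kernel : ∀ θ, IsKernel S (g θ) (op.channel φ ψ θ)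
  g_one : ∀ θ l, g θ (S.rd 0) l = if l = S.rd 0 then 1 else 0

attribute [instance] OpModel.fin OpModel.dec

theorem integral_eval (E : Measure U2) [IsProbabilityMeasure E] (q : Fin n) {f : U2 → ℝ}
    (hf : Measurable f) : ∫ V : Fin n → U2, f (V q) ∂(Measure.pi fun _ => E) = ∫ V, f V ∂E := by
  have hmp := measurePreserving_eval (fun _ : Fin n => E) q
  have hmap := integral_map hmp.measurable.aemeasurable
    (f := f) (by rw [hmp.map_eq]; exact hf.aestronglyMeasurable)
  rw [hmp.map_eq] at hmap
  exact hmap.symm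

theorem measurable_rot (a c : Fin 4) : Measurable fun V => rot V a c :=
  (continuous_rot a c).measurable

theorem single_moment {E : Measure U2} (hE : IsTwoDesign E) (q : Fin n) (a e b f : Fin 4) :
    ∫ V : Fin n → U2, rot (V q) a e * rot (V q) b f ∂(Measure.pi fun _ => E)
      = if a = b ∧ e = f then twirl1 a e else 0 := by
  have := hE.1
  rw [integral_eval E q (f := fun V => rot V a e * rot V b f)
    ((measurable_rot _ _).mul (measurable_rot _ _)), hE.second_moment]

/-- The gates on distinct qubits are independent, so the moment is a product. -/
theorem pair_moment {E : Measure U2} (hE : IsTwoDesign E) {q r : Fin n} (hqr : q ≠ r)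
    (a e b f : Fin 4 × Fin 4) :
    ∫ V : Fin n → U2, (rot (V q) a.1 e.1 * rot (V r) a.2 e.2) *
        (rot (V q) b.1 f.1 * rot (V r) b.2 f.2) ∂(Measure.pi fun _ => E)
      = if a = b ∧ e = f then twirl2 a e else 0 := by
  have := hE.1
  have hind : IndepFun (fun V : Fin n → U2 => V q) (fun V : Fin n → U2 => V r)
      (Measure.pi fun _ => E) :=
    (iIndepFun_pi (μ := fun _ : Fin n => E) (X := fun _ => id) fun _ => aemeasurable_id).indepFun
      hqr
  have h1 : ∀ x y z u, Measurable fun V : U2 => rot V x y * rot V z u := fun _ _ _ _ =>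
    (measurable_rot _ _).mul (measurable_rot _ _)
  have hind2 := hind.comp (h1 a.1 e.1 b.1 f.1) (h1 a.2 e.2 b.2 f.2)
  have h2 := hind2.integral_fun_mul_eq_mul_integral
    ((h1 _ _ _ _).comp (measurable_pi_apply q)).aestronglyMeasurable
    ((h1 _ _ _ _).comp (measurable_pi_apply r)).aestronglyMeasurable
  simp only [Function.comp_def] at h2
  rw [single_moment hE q, single_moment hE r] at h2
  have h3 : ∀ V : Fin n → U2, (rot (V q) a.1 e.1 * rot (V r) a.2 e.2) *
        (rot (V q) b.1 f.1 * rot (V r) b.2 f.2) =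
      (rot (V q) a.1 e.1 * rot (V q) b.1 f.1) * (rot (V r) a.2 e.2 * rot (V r) b.2 f.2) := by
    intro V; ring
  simp only [h3]
  rw [h2]
  simp only [Prod.ext_iff, twirl2]
  split_ifs <;> first
    | rfl
    | (simp; done)
    | (exfalso; tauto)

/-- Random single-qubit gates on one qubit. -/
def singleModel {E : Measure U2} (hE : IsTwoDesign E) (φ ψ : ℝ) {op : Op n p} {q : Fin n}
    (hq : op.support = {q}) (g : Params p → Fin 4 → Fin 4 → ℝ)
    (g_meas : ∀ k l, Measurable fun θ => g θ k l) (g_bdd : ∀ k l, Bdd fun θ => g θ k l)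
    (g_kernel : ∀ θ, IsKernel (site1 q) (g θ) (op.channel φ ψ θ))
    (g_one : ∀ θ l, g θ 0 l = if l = 0 then 1 else 0) : OpModel op φ ψ E where
  κ := Fin 4
  S := site1 q
  supp_eq := hq.symm
  τ := twirl1
  v V k l := rot (V q) k l
  v_meas k l := (measurable_rot k l).comp (measurable_pi_apply q)
  v_bdd k l := ⟨1, fun V => abs_rot_le _ _ _⟩
  v_moment := single_moment hE q
  v_kernel V := by rw [hq, localUnitary_single]; exact isKernel_onQubit q _
  v_one V l := by
    change rot (V q) 0 l = _
    rw [rot_zero_left]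
    by_cases hl : l = 0
    · exact (if_pos hl.symm).trans (if_pos hl).symm
    · exact (if_neg (Ne.symm hl)).trans (if_neg hl).symm
  g := g
  g_meas := g_meas
  g_bdd := g_bdd
  g_kernel := g_kernel
  g_one := g_one

/-- The transfer matrices of an operation. -/
def opModel {E : Measure U2} (hE : IsTwoDesign E) (φ ψ : ℝ) : (op : Op n p) → OpModel op φ ψ E
  | .single q U hU => singleModel hE φ ψ (q := q) rfl (fun θ k l => rot (U θ) k l)
      (fun k l => (measurable_rot k l).comp hU) (fun k l => ⟨1, fun _ => abs_rot_le _ _ _⟩)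
      (fun θ => isKernel_onQubit q _) (fun θ l => by simp [rot_zero_left, eq_comm])
  | .feedforward q => singleModel hE φ ψ (q := q) rfl (fun _ => feedKernel φ ψ)
      (fun _ _ => measurable_const) (fun k l => ⟨_, fun _ => le_rfl⟩)
      (fun _ => isKernel_feedChannel φ ψ q)
      (fun _ l => by rw [feedKernel_eq]; fin_cases l <;> simp)
  | .pair q r hqr U hU =>
    { κ := Fin 4 × Fin 4
      S := site2 q r hqr
      supp_eq := rfl
      τ := twirl2
      v := fun V k l => rot (V q) k.1 l.1 * rot (V r) k.2 l.2
      v_meas := fun k l => ((measurable_rot _ _).comp (measurable_pi_apply q)).mul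
        ((measurable_rot _ _).comp (measurable_pi_apply r))
      v_bdd := fun k l => Bdd.mul ⟨1, fun V => abs_rot_le _ _ _⟩ ⟨1, fun V => abs_rot_le _ _ _⟩
      v_moment := pair_moment hE hqr
      v_kernel := fun V => by
        have h := isKernel_onPair hqr
          ((V q : Matrix (Fin 2) (Fin 2) ℂ) ⊗ₖ (V r : Matrix (Fin 2) (Fin 2) ℂ))
        rw [← localUnitary_pair hqr] at h
        intro X a
        have h2 := h X a
        simp only [ptm_kronecker] at h2
        exact h2
      v_one := fun V l => by
        change rot (V q) 0 l.1 * rot (V r) 0 l.2 = _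
        rw [rot_zero_left, rot_zero_left]
        by_cases hl : l = (0, 0)
        · refine Eq.trans ?_ (if_pos hl).symm
          simp [hl]
        · refine Eq.trans ?_ (if_neg hl).symm
          by_cases h1 : 0 = l.1
          · have h2 : ¬ 0 = l.2 := fun h2 => hl (Prod.ext h1.symm h2.symm)
            simp [h2]
          · simp [h1]
      g := fun θ k l => rot2 (U θ) k l
      g_meas := fun k l => (continuous_rot2 k l).measurable.comp hU
      g_bdd := fun k l => ⟨1, fun _ => abs_rot2_le _ _ _⟩
      g_kernel := fun θ => isKernel_onPair hqr _
      g_one := fun θ l => by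
        change rot2 (U θ) 0 l = if l = 0 then 1 else 0
        rw [rot2_zero_left]; simp [eq_comm] }

/-- The weights after an operation. -/
def nextWeight (κ φ : ℝ) (b : Fin n → ℝ) : Op n p → Fin n → ℝ
  | .single _ _ _ => b
  | .feedforward q => Function.update b q (Real.sin φ ^ 2 / 3)
  | .pair q r _ _ _ => pairWeight κ b q r

theorem integral_sq_ancilla {D : Measure (Params p)} [IsProbabilityMeasure D] {κ : Type}
    {g : Params p → κ → ℝ} (hg : ∀ k, Measurable fun θ => g θ k) (hb : ∀ k, Bdd fun θ => g θ k)
    (c : Fin 4 → κ) :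
    ∑ k, ∑ l, zeroState k * zeroState l * ∫ θ, g θ (c k) * g θ (c l) ∂D
      = ∫ θ, (g θ (c 0) + g θ (c 3)) ^ 2 ∂D := by
  have hi : ∀ k l, Integrable (fun θ => g θ k * g θ l) D := fun k l =>
    ((hb k).mul (hb l)).integrable ((hg k).mul (hg l))
  have h : ∀ θ, (g θ (c 0) + g θ (c 3)) ^ 2
      = ∑ k, ∑ l, zeroState k * zeroState l * (g θ (c k) * g θ (c l)) := by
    intro θ
    simp [Fin.sum_univ_four, zeroState]
    ring
  simp only [h]
  rw [integral_finsetSum _ fun k _ => integrable_finsetSum _ fun l _ => (hi _ _).const_mul _]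
  refine Finset.sum_congr rfl fun k _ => ?_
  rw [integral_finsetSum _ fun l _ => (hi _ _).const_mul _]
  exact Finset.sum_congr rfl fun l _ => (integral_const_mul _ _).symm

/-- Positivity of the new diagonal moments is taken as a hypothesis because it is not visible from
the recursion; `evolution` obtains it from their being integrals of squares. -/
theorem Spread.opStep {E : Measure U2} (hE : IsTwoDesign E) (φ ψ : ℝ)
    {D : Measure (Params p)} [IsProbabilityMeasure D] {α β : ℝ}
    (hα : α ∈ Set.Icc (0 : ℝ) 1) (hβ : β ∈ Set.Icc (0 : ℝ) (1 - α)) (op : Op n p)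
    (hT : op.PairHasTransferMatrix D (transferMatrix α β))
    {t : Finset (Fin n)} {b : Fin n → ℝ} {M : (Fin n → Fin 4) → (Fin n → Fin 4) → ℝ}
    (h : Spread t b M)
    (hpos : ∀ a, 0 ≤ stepMoment (opModel hE φ ψ op).S (opModel hE φ ψ op).τ
      (fun e k l => ∫ θ, (opModel hE φ ψ op).g θ e k * (opModel hE φ ψ op).g θ e l ∂D) M a a) :
    Spread (t ∪ op.support) (nextWeight (α / 5) φ b op) (stepMoment (opModel hE φ ψ op).S
      (opModel hE φ ψ op).τ
      (fun e k l => ∫ θ, (opModel hE φ ψ op).g θ e k * (opModel hE φ ψ op).g θ e l ∂D) M) := by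
  rw [← (opModel hE φ ψ op).supp_eq]
  have hs : 0 ≤ Real.sin φ ^ 2 / 3 ∧ Real.sin φ ^ 2 / 3 ≤ 1 :=
    ⟨by positivity, by linarith [Real.sin_sq_le_one φ]⟩
  have hκ0 : 0 ≤ α / 5 := by linarith [hα.1]
  have hκ1 : α / 5 ≤ 1 / 5 := by linarith [hα.2]
  cases op with
  | single q U hU =>
    refine h.step _ _ _ h.nonneg h.le_one (fun _ _ => rfl) fun a => ?_
    have hi : ∀ e k, Integrable (fun θ => rot (U θ) e k * rot (U θ) e k) D := fun e k =>
      Bdd.integrable (Bdd.mul ⟨1, fun _ => abs_rot_le _ _ _⟩ ⟨1, fun _ => abs_rot_le _ _ _⟩)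
        (((measurable_rot _ _).comp hU).mul ((measurable_rot _ _).comp hU))
    refine h.low_single q (fun e k l => ∫ θ, rot (U θ) e k * rot (U θ) e l ∂D) ?_ ?_ ?_ hpos a
    · intro k l
      simp only [rot_zero_left]
      by_cases hk : k = 0 <;> by_cases hl : l = 0 <;> simp [hk, hl, eq_comm]
    · intro e k
      exact integral_nonneg fun θ => mul_self_nonneg _
    · intro e
      rw [← integral_finsetSum _ fun k _ => hi e k]
      simp [sum_rot_row]
  | feedforward q =>
    have hΓ : (fun e k l => ∫ _ : Params p, feedKernel φ ψ e k * feedKernel φ ψ e l ∂D)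
        = fun e k l => feedKernel φ ψ e k * feedKernel φ ψ e l := by ext; simp
    refine h.step _ _ _ ?_ ?_ ?_ fun a => ?_
    · intro j
      by_cases hj : j = q
      · subst hj; simpa [nextWeight] using hs.1
      · simpa [nextWeight, hj] using h.nonneg j
    · intro j
      by_cases hj : j = q
      · subst hj; simpa [nextWeight] using hs.2
      · simpa [nextWeight, hj] using h.le_one j
    · intro j hj
      have : j ≠ q := by simpa [opModel, singleModel, site1] using hj
      simp [nextWeight, this]
    · have := h.low_feed q φ ψ a
      rw [← hΓ] at this
      exact this
  | pair q r hqr U hU =>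
    have hM0 : 0 ≤ max (b q) (b r) := (h.nonneg q).trans (le_max_left _ _)
    have hM1 : max (b q) (b r) ≤ 1 := max_le (h.le_one q) (h.le_one r)
    have hw0 : 0 ≤ α / 5 * max (b q) (b r) := mul_nonneg hκ0 hM0
    have hw1 : α / 5 * max (b q) (b r) ≤ 1 := by nlinarith
    have hgm : ∀ e k, Measurable fun θ => rot2 (U θ) e k := fun e k =>
      (continuous_rot2 e k).measurable.comp hU
    have hgb : ∀ e k, Bdd fun θ => rot2 (U θ) e k := fun e k => ⟨1, fun _ => abs_rot2_le _ _ _⟩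
    -- The ancilla estimates hold for each gate separately and are averaged over θ.
    have hsum : ∀ (F : Params p → Fin 4 × Fin 4 → Fin 4 → ℝ)
        (_ : ∀ j c, Integrable (fun θ => F θ j c) D) (e : Fin 4 × Fin 4) (x : ℝ)
        (_ : ∀ θ, x ≤ ∑ j, twirl2 e j * ∑ c, F θ j c),
        x ≤ ∑ j, twirl2 e j * ∑ c, ∫ θ, F θ j c ∂D := by
      intro F hF e x hx
      have h2 : ∑ j, twirl2 e j * ∑ c, ∫ θ, F θ j c ∂D
          = ∫ θ, ∑ j, twirl2 e j * ∑ c, F θ j c ∂D := by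
        rw [integral_finsetSum _ fun j _ =>
          (integrable_finsetSum _ fun c _ => hF j c).const_mul _]
        refine Finset.sum_congr rfl fun j _ => ?_
        rw [integral_const_mul, integral_finsetSum _ fun c _ => hF j c]
      rw [h2]
      calc x = ∫ _ : Params p, x ∂D := by simp
        _ ≤ _ := integral_mono (integrable_const _) (integrable_finsetSum _ fun j _ =>
          (integrable_finsetSum _ fun c _ => hF j c).const_mul _) hx
    have hisq : ∀ j k l, Integrable (fun θ => (rot2 (U θ) j k + rot2 (U θ) j l) ^ 2) D := by
      intro j k l
      refine Bdd.integrable ⟨4, fun θ => ?_⟩ (((hgm _ _).add (hgm _ _)).pow_const 2)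
      have h1 := abs_le.1 (abs_rot2_le (U θ) j k)
      have h2 := abs_le.1 (abs_rot2_le (U θ) j l)
      rw [abs_of_nonneg (sq_nonneg _)]
      nlinarith
    refine h.step _ _ _ ?_ ?_ ?_ fun a => ?_
    · intro j
      simp only [nextWeight, pairWeight, Function.update_apply]
      split_ifs
      · exact hw0
      · exact hw0
      · exact h.nonneg j
    · intro j
      simp only [nextWeight, pairWeight, Function.update_apply]
      split_ifs
      · exact hw1
      · exact hw1
      · exact h.le_one j
    · intro j hj
      have : j ≠ q ∧ j ≠ r := by simpa [opModel, site2] using hj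
      simp [nextWeight, pairWeight, this.1, this.2]
    · refine h.low_pair hqr (fun e k l => ∫ θ, rot2 (U θ) e k * rot2 (U θ) e l ∂D) (α / 5) hκ0 hκ1
        ?_ ?_ ?_ ?_ ?_ ?_ ?_ ?_ hpos a
      · intro k l
        simp only [rot2_zero_left]
        by_cases hk : k = 0 <;> by_cases hl : l = 0 <;> simp [hk, hl, eq_comm]
      · intro e k
        exact integral_nonneg fun θ => mul_self_nonneg _
      · intro e he
        simpa only [← sq] using transfer_bound_left D hU hα hβ hT e he
      · intro e he
        simpa only [← sq] using transfer_bound_right D hU hα hβ hT e he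
      · intro e c
        rw [integral_sq_ancilla (g := fun θ => rot2 (U θ) e) (hgm e) (hgb e) fun k => (c, k)]
        exact integral_nonneg fun θ => sq_nonneg _
      · intro e he
        have hrw := fun j c => integral_sq_ancilla (D := D) (g := fun θ => rot2 (U θ) j) (hgm j)
          (hgb j) fun k => (c, k)
        simp only [hrw]
        refine hsum (fun θ j c => (rot2 (U θ) j (c, 0) + rot2 (U θ) j (c, 3)) ^ 2)
          (fun j c => hisq _ _ _) e _ fun θ => ?_
        exact ancilla_bound (U θ).2 e he
      · intro e c
        rw [integral_sq_ancilla (g := fun θ => rot2 (U θ) e) (hgm e) (hgb e) fun k => (k, c)]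
        exact integral_nonneg fun θ => sq_nonneg _
      · intro e he
        have hrw := fun j c => integral_sq_ancilla (D := D) (g := fun θ => rot2 (U θ) j) (hgm j)
          (hgb j) fun k => (k, c)
        simp only [hrw]
        refine hsum (fun θ j c => (rot2 (U θ) j (0, c) + rot2 (U θ) j (3, c)) ^ 2)
          (fun j c => hisq _ _ _) e _ fun θ => ?_
        exact ancilla_bound' (U θ).2 e he

end DynCircuit

namespace DynCircuit

open Matrix MeasureTheory ProbabilityTheory

variable {n p m : ℕ}

/-! ### Evolution of the second moments along the circuit -/

/-- The intermediate values of `Fin.foldl`. -/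
def seqFold {α : Type*} (m : ℕ) (f : α → Fin m → α) (x : α) : ℕ → α
  | 0 => x
  | t + 1 => if h : t < m then f (seqFold m f x t) ⟨t, h⟩ else seqFold m f x t

theorem seqFold_succ {α : Type*} (f : α → Fin m → α) (x : α) (i : Fin m) :
    seqFold m f x (i + 1) = f (seqFold m f x i) i := by
  rw [seqFold, dif_pos i.2]

theorem foldl_eq_seqFold {α : Type*} (m : ℕ) (f : α → Fin m → α) (x : α) :
    Fin.foldl m f x = seqFold m f x m := by
  induction m with
  | zero => simp [seqFold]
  | succ m ih =>
    -- `Fin.foldl_succ_last` removes the last operation, so the two sequences have to agree up to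
    -- time m only.
    have haux : ∀ t ≤ m, seqFold (m + 1) f x t = seqFold m (fun y i => f y i.castSucc) x t := by
      intro t
      induction t with
      | zero => intro _; rfl
      | succ t iht =>
        intro ht
        rw [seqFold, seqFold, dif_pos (by omega), dif_pos (by omega), iht (by omega)]
        rfl
    rw [Fin.foldl_succ_last, ih]
    have h := seqFold_succ f x (Fin.last m)
    rw [Fin.val_last, haux m le_rfl] at h
    exact h.symm

/-- The state before operation number `t`, with inserted single-qubit gates. -/
def stateAt (C : Circuit n p m) (φ ψ : ℝ) (w : Params p × (Fin m → Fin n → U2)) : ℕ → NOp n :=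
  seqFold m (fun σ i => conj (Circuit.localUnitary (C i).support (w.2 i))
    ((C i).channel φ ψ w.1 σ)) (Matrix.single 0 0 1)

/-- The Pauli coefficients of the state before operation number `t`. -/
def coefAt (C : Circuit n p m) (φ ψ : ℝ) (t : ℕ) (a : Fin n → Fin 4)
    (w : Params p × (Fin m → Fin n → U2)) : ℝ :=
  (stateAt C φ ψ w t * pauliString a).trace.re

/-- The qubits on which the first `t` operations act. -/
def touchedAt (C : Circuit n p m) : ℕ → Finset (Fin n) :=
  seqFold m (fun s i => s ∪ (C i).support) ∅

/-- The weights before operation number `t`. -/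
def weightAt (C : Circuit n p m) (κ φ : ℝ) : ℕ → Fin n → ℝ :=
  seqFold m (fun b i => nextWeight κ φ b (C i)) 0

theorem coefAt_succ {E : Measure U2} (hE : IsTwoDesign E) (C : Circuit n p m) (φ ψ : ℝ) (i : Fin m)
    (a : Fin n → Fin 4) (w : Params p × (Fin m → Fin n → U2)) :
    coefAt C φ ψ (i + 1) a w = ∑ k, (∑ j, (opModel hE φ ψ (C i)).v (w.2 i)
        ((opModel hE φ ψ (C i)).S.rd a) j * (opModel hE φ ψ (C i)).g w.1 j k) *
      coefAt C φ ψ i ((opModel hE φ ψ (C i)).S.ov a k) w := by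
  have h := (((opModel hE φ ψ (C i)).v_kernel (w.2 i)).comp
    ((opModel hE φ ψ (C i)).g_kernel w.1)) (stateAt C φ ψ w i) a
  rw [coefAt, stateAt, seqFold_succ]
  rw [stateAt] at h
  rw [h, Complex.re_sum]
  refine Finset.sum_congr rfl fun k _ => ?_
  rw [Complex.re_ofReal_mul]
  rfl

theorem coefAt_zero (C : Circuit n p m) (φ ψ : ℝ) (a : Fin n → Fin 4)
    (w : Params p × (Fin m → Fin n → U2)) :
    coefAt C φ ψ 0 a w = ∏ j, zeroState (a j) := by
  have h : ∀ k, pauli k 0 0 = ((zeroState k : ℝ) : ℂ) := by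
    intro k; fin_cases k <;> simp [pauli, zeroState]
  have h2 : (Matrix.single (0 : Bits n) (0 : Bits n) (1 : ℂ) * pauliString a).trace
      = ((∏ j, zeroState (a j) : ℝ) : ℂ) := by
    rw [Matrix.trace_single_mul]
    simp [pauliString, h]
  rw [coefAt, stateAt, seqFold, h2, Complex.ofReal_re]

theorem prod_zeroState (a : Fin n → Fin 4) (j : Fin n) :
    ∏ i, zeroState (a i) = zeroState (a j) * ∏ i, zeroState (Function.update a j 0 i) := by
  rw [← Finset.mul_prod_erase Finset.univ _ (Finset.mem_univ j),
    ← Finset.mul_prod_erase Finset.univ (fun i => zeroState (Function.update a j 0 i))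
      (Finset.mem_univ j)]
  have h0 : zeroState 0 = 1 := rfl
  rw [Function.update_self, h0, one_mul]
  congr 1
  exact Finset.prod_congr rfl fun i hi => by rw [Function.update_of_ne (Finset.ne_of_mem_erase hi)]

/-- With all weights 0, the lower bound has content only for the identity string, where both sides
are 1. -/
theorem spread_zero : Spread (∅ : Finset (Fin n)) 0
    (fun a b => (∏ j, zeroState (a j)) * ∏ j, zeroState (b j)) where
  nonneg _ := le_rfl
  le_one _ := zero_le_one
  untouched _ _ := rfl
  diag j hj := absurd hj (Finset.notMem_empty j)
  zero j _ u v := by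
    rw [prod_zeroState u j, prod_zeroState v j]
    ring
  low a := by
    by_cases ha : a = 0
    · subst ha
      simp [suppProd, zeroState]
    · obtain ⟨j, hj⟩ := Function.ne_iff.1 ha
      rw [suppProd, Finset.prod_eq_zero (Finset.mem_univ j)]
      · exact mul_self_nonneg _
      · have hj' : a j ≠ 0 := hj
        simp [hj']

theorem measurable_block_of_dependsOn (owner : Fin p → Fin m) (i : Fin m) {f : Params p → ℝ}
    (hf : Measurable f) (hd : DependsOn f {l | owner l = i}) : Measurable[blockAlg owner i] f := by
  -- Parameters outside the block are set to 0, which does not affect `f`.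
  set e : ({l : Fin p // owner l = i} → ℝ) → Params p :=
    fun y l => if h : owner l = i then y ⟨l, h⟩ else 0 with he
  have hem : Measurable e := by
    refine measurable_pi_lambda _ fun l => ?_
    simp only [he]
    split_ifs with h
    · exact measurable_pi_apply _
    · exact measurable_const
  have hfe : f = (f ∘ e) ∘ fun (θ : Params p) (l : {l : Fin p // owner l = i}) => θ l := by
    ext θ
    refine hd fun l hl => ?_
    change owner l = i at hl
    simp [he, hl]
  rw [hfe]
  exact (hf.comp hem).comp (comap_measurable _)

/-- The hypothesis restricts the parameters of the channel, not of the gate, whose global phase may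
depend on more. The kernel sees only the channel. -/
theorem OpModel.measurable_block {E : Measure U2} {φ ψ : ℝ} {op : Op n p} (M : OpModel op φ ψ E)
    (owner : Fin p → Fin m) (i : Fin m) (hd : DependsOn (op.channel φ ψ) {l | owner l = i})
    (k l : M.κ) : Measurable[blockAlg owner i] fun θ => M.g θ k l := by
  refine measurable_block_of_dependsOn owner i (M.g_meas k l) fun θ θ' h => ?_
  rw [(M.g_kernel θ).eq_trace, (M.g_kernel θ').eq_trace, hd h]

/-- The induction carries measurability with respect to the past and boundedness along with
`Spread`, since the moment recursion needs both. The identity coefficient stays 1 by trace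
preservation. -/
theorem evolution {C : Circuit n p m} {φ ψ : ℝ} {D : Measure (Params p)} [IsProbabilityMeasure D]
    {owner : Fin p → Fin m} (hd : ∀ i, DependsOn ((C i).channel φ ψ) {l | owner l = i})
    (hind : iIndepFun
      (fun (i : Fin m) (θ : Params p) (l : {l : Fin p // owner l = i}) => θ l) D)
    {E : Measure U2} (hE : IsTwoDesign E)
    {α β : ℝ} (hα : α ∈ Set.Icc (0 : ℝ) 1) (hβ : β ∈ Set.Icc (0 : ℝ) (1 - α))
    (hT : ∀ i, (C i).PairHasTransferMatrix D (transferMatrix α β)) (t : ℕ) (ht : t ≤ m) :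
    (∀ a, Measurable[pastAlg n owner t] (coefAt C φ ψ t a)) ∧ (∀ a, Bdd (coefAt C φ ψ t a)) ∧
    (∀ w, coefAt C φ ψ t 0 w = 1) ∧
    Spread (touchedAt C t) (weightAt C (α / 5) φ t)
      (fun a b => ∫ w, coefAt C φ ψ t a w * coefAt C φ ψ t b w ∂(jointLaw n m D E)) := by
  have hEp := hE.1
  induction t with
  | zero =>
    refine ⟨fun a => ?_, fun a => ?_, fun w => ?_, ?_⟩
    · simp only [funext (coefAt_zero C φ ψ a)]
      exact measurable_const
    · simp only [funext (coefAt_zero C φ ψ a)]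
      exact ⟨_, fun _ => le_rfl⟩
    · rw [coefAt_zero]; simp [zeroState]
    · have h := spread_zero (n := n)
      simpa [coefAt_zero, touchedAt, weightAt, seqFold] using h
  | succ t ih =>
    obtain ⟨hmeas, hbdd, hone, hspread⟩ := ih (by omega)
    set i : Fin m := ⟨t, ht⟩ with hi
    have hit : t = i.val := rfl
    rw [hit] at hmeas hbdd hone hspread ⊢
    set M := opModel hE φ ψ (C i) with hM
    have hrec := coefAt_succ hE C φ ψ i
    rw [← hM] at hrec
    have hgblock := M.measurable_block owner i (hd i)
    have hmom := integral_step hind i M.S M.τ M.v_meas M.v_bdd M.v_moment hgblock M.g_bdd hmeas hbdd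
      hrec
    refine ⟨fun a => ?_, fun a => ?_, fun w => ?_, ?_⟩
    · simp only [funext (hrec a)]
      refine Finset.measurable_sum _ fun k _ => Measurable.mul ?_ ?_
      · refine Finset.measurable_sum _ fun j _ => Measurable.mul ?_ ?_
        · have h1 : Measurable[opAlg n owner (Sum.inr i)]
              (fun w : Params p × (Fin m → Fin n → U2) => M.v (w.2 i) (M.S.rd a) j) :=
            ((M.v_meas _ _).comp (comap_measurable (fun V : Fin m → Fin n → U2 => V i))).comp
              (comap_measurable _)
          exact h1.mono (opAlg_le_pastAlg owner (Nat.lt_succ_self _)) le_rfl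
        · have h1 : Measurable[opAlg n owner (Sum.inl i)]
              (fun w : Params p × (Fin m → Fin n → U2) => M.g w.1 j k) :=
            (hgblock j k).comp (comap_measurable _)
          exact h1.mono (opAlg_le_pastAlg owner (Nat.lt_succ_self _)) le_rfl
      · exact (hmeas _).mono (pastAlg_mono owner (Nat.le_succ _)) le_rfl
    · simp only [funext (hrec a)]
      refine Bdd.sum fun k => Bdd.mul (Bdd.sum fun j => Bdd.mul ?_ ?_) (hbdd _)
      · exact (M.v_bdd _ _).imp fun C hC w => hC _
      · exact (M.g_bdd _ _).imp fun C hC w => hC _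
    · rw [hrec, Finset.sum_eq_single (M.S.rd 0)]
      · simp [M.v_one, M.g_one, M.S.ov_rd, hone]
      · intro k _ hk
        simp [M.v_one, M.g_one, hk]
      · simp
    · have htouch : touchedAt C (i + 1) = touchedAt C i ∪ (C i).support := by
        simp only [touchedAt]; rw [seqFold_succ]
      have hweight : weightAt C (α / 5) φ (i + 1)
          = nextWeight (α / 5) φ (weightAt C (α / 5) φ i) (C i) := by
        simp only [weightAt]; rw [seqFold_succ]
      rw [htouch, hweight]
      simp only [hmom]
      refine hspread.opStep hE φ ψ hα hβ (C i) (hT i) fun a => ?_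
      rw [← hM, ← hmom]
      exact integral_nonneg fun w => mul_self_nonneg _

end DynCircuit

namespace DynCircuit

open Matrix MeasureTheory ProbabilityTheory

variable {n p m : ℕ}

/-! ### Weights along paths -/

theorem nextWeight_bounds {κ φ : ℝ} (hκ0 : 0 ≤ κ) (hκ1 : κ ≤ 1) {b : Fin n → ℝ}
    (hb : ∀ j, 0 ≤ b j ∧ b j ≤ Real.sin φ ^ 2 / 3) (op : Op n p) (j : Fin n) :
    0 ≤ nextWeight κ φ b op j ∧ nextWeight κ φ b op j ≤ Real.sin φ ^ 2 / 3 := by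
  have hs : (0 : ℝ) ≤ Real.sin φ ^ 2 / 3 := by positivity
  cases op with
  | single q U hU => exact hb j
  | feedforward q =>
    simp only [nextWeight, Function.update_apply]
    split_ifs
    · exact ⟨hs, le_rfl⟩
    · exact hb j
  | pair q r hqr U hU =>
    have hM : 0 ≤ κ * max (b q) (b r) ∧ κ * max (b q) (b r) ≤ Real.sin φ ^ 2 / 3 :=
      ⟨mul_nonneg hκ0 (le_max_of_le_left (hb q).1),
        (mul_le_of_le_one_left (le_max_of_le_left (hb q).1) hκ1).trans
          (max_le (hb q).2 (hb r).2)⟩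
    simp only [nextWeight, pairWeight, Function.update_apply]
    split_ifs
    · exact hM
    · exact hM
    · exact hb j

/-- Weights never exceed sin²φ/3, so a further feedforward operation on the path cannot lower them.
-/
theorem le_nextWeight {κ φ : ℝ} {b : Fin n → ℝ}
    (hb : ∀ j, 0 ≤ b j ∧ b j ≤ Real.sin φ ^ 2 / 3) (op : Op n p) {x y : Fin n}
    (hxy : y = x ∨ (x ∈ op.support ∧ y ∈ op.support)) (h : ¬ (op.IsPair ∧ x ∈ op.support)) :
    b x ≤ nextWeight κ φ b op y := by
  cases op with
  | single q U hU =>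
    simp only [Op.support, Finset.mem_singleton] at hxy
    have : y = x := hxy.elim id fun h => h.2.trans h.1.symm
    rw [this]; rfl
  | feedforward q =>
    simp only [Op.support, Finset.mem_singleton] at hxy
    have : y = x := hxy.elim id fun h => h.2.trans h.1.symm
    subst this
    simp only [nextWeight, Function.update_apply]
    split_ifs
    · exact (hb y).2
    · exact le_rfl
  | pair q r hqr U hU =>
    have hx : x ∉ (Op.pair q r hqr U hU : Op n p).support := fun hx => h ⟨trivial, hx⟩
    have : y = x := hxy.resolve_right fun h => hx h.1
    subst this
    simp only [Op.support, Finset.mem_insert, Finset.mem_singleton, not_or] at hx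
    simp [nextWeight, pairWeight, hx.1, hx.2]

theorem le_nextWeight_pair {κ φ : ℝ} (hκ0 : 0 ≤ κ) (b : Fin n → ℝ) (op : Op n p) {x y : Fin n}
    (hxy : y = x ∨ (x ∈ op.support ∧ y ∈ op.support)) (hp : op.IsPair) (hx : x ∈ op.support) :
    κ * b x ≤ nextWeight κ φ b op y := by
  have hy : y ∈ op.support := hxy.elim (fun h => h ▸ hx) And.right
  cases op with
  | single q U hU => exact hp.elim
  | feedforward q => exact hp.elim
  | pair q r hqr U hU =>
    simp only [Op.support, Finset.mem_insert, Finset.mem_singleton] at hx hy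
    have h1 : nextWeight κ φ b (Op.pair q r hqr U hU : Op n p) y = κ * max (b q) (b r) := by
      rcases hy with rfl | rfl <;> simp [nextWeight, pairWeight, hqr]
    rw [h1]
    refine mul_le_mul_of_nonneg_left ?_ hκ0
    rcases hx with rfl | rfl
    · exact le_max_left _ _
    · exact le_max_right _ _

theorem weightAt_succ (C : Circuit n p m) (κ φ : ℝ) (i : Fin m) :
    weightAt C κ φ (i + 1) = nextWeight κ φ (weightAt C κ φ i) (C i) := by
  simp only [weightAt]; rw [seqFold_succ]

theorem touchedAt_succ (C : Circuit n p m) (i : Fin m) :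
    touchedAt C (i + 1) = touchedAt C i ∪ (C i).support := by
  simp only [touchedAt]; rw [seqFold_succ]

theorem weightAt_bounds (C : Circuit n p m) {κ φ : ℝ} (hκ0 : 0 ≤ κ) (hκ1 : κ ≤ 1) (s : ℕ)
    (hs : s ≤ m) (j : Fin n) :
    0 ≤ weightAt C κ φ s j ∧ weightAt C κ φ s j ≤ Real.sin φ ^ 2 / 3 := by
  induction s generalizing j with
  | zero => exact ⟨le_rfl, by change (0 : ℝ) ≤ _; positivity⟩
  | succ s ih =>
    rw [weightAt_succ C κ φ ⟨s, hs⟩]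
    exact nextWeight_bounds hκ0 hκ1 (fun j => ih (by omega) j) _ j

open Classical in
-- The feedforward operation starts the path with weight sin²φ/3, and each two-qubit gate met later
-- costs at most one factor κ.
theorem weightAt_path {C : Circuit n p m} {κ φ : ℝ} (hκ0 : 0 ≤ κ) (hκ1 : κ ≤ 1) {t : Fin m}
    {l : Fin (m + 1) → Fin n} {j : Fin n} (h : C.IsPath t l j) (s : ℕ) (hts : t.val + 1 ≤ s)
    (hs : s < m + 1) :
    l ⟨s, hs⟩ ∈ touchedAt C s ∧
      Real.sin φ ^ 2 / 3 * κ ^ (Finset.univ.filter fun u : Fin m => u.val < s ∧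
        (t < u ∧ (C u).IsPair ∧ l u.castSucc ∈ (C u).support)).card ≤ weightAt C κ φ s (l ⟨s, hs⟩) := by
  have hs0 : (0 : ℝ) ≤ Real.sin φ ^ 2 / 3 := by positivity
  induction s, hts using Nat.le_induction with
  | base =>
    have hff := h.1
    change (C t).IsFeedforwardAt (l ⟨t.val + 1, hs⟩) at hff
    rw [touchedAt_succ, weightAt_succ]
    generalize C t = op at hff
    cases op with
    | single q U hU => exact hff.elim
    | pair q r hqr U hU => exact hff.elim
    | feedforward q =>
      have hq : q = l ⟨t.val + 1, hs⟩ := hff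
      rw [← hq]
      refine ⟨Finset.mem_union_right _ (Finset.mem_singleton_self q), ?_⟩
      rw [nextWeight, Function.update_self]
      exact mul_le_of_le_one_right hs0 (pow_le_one₀ hκ0 hκ1)
  | succ s hts ih =>
    have hsm : s < m := by omega
    obtain ⟨iht, ihw⟩ := ih (by omega)
    set i : Fin m := ⟨s, hsm⟩ with hi
    have hstep := h.2.1 i (by rw [Fin.lt_def]; exact hts)
    have hcast : i.castSucc = ⟨s, by omega⟩ := rfl
    have hsucc : i.succ = ⟨s + 1, hs⟩ := rfl
    have hb := weightAt_bounds C (φ := φ) hκ0 hκ1 s hsm.le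
    rw [touchedAt_succ C i, weightAt_succ C κ φ i, ← hsucc]
    rw [← hcast] at iht ihw
    refine ⟨?_, ?_⟩
    · rcases hstep with h1 | h1
      · rw [h1]; exact Finset.mem_union_left _ iht
      · exact Finset.mem_union_right _ h1.2
    · by_cases hP : (C i).IsPair ∧ l i.castSucc ∈ (C i).support
      · refine le_trans ?_ (le_nextWeight_pair hκ0 _ _ hstep hP.1 hP.2)
        refine le_trans ?_ (mul_le_mul_of_nonneg_left ihw hκ0)
        rw [mul_left_comm, ← pow_succ']
        refine mul_le_mul_of_nonneg_left (pow_le_pow_of_le_one hκ0 hκ1 ?_) hs0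
        -- The current gate `i` lies in the new set of encountered gates and not in the old one,
        -- which pays for the extra factor κ.
        refine Nat.succ_le_of_lt (Finset.card_lt_card ?_)
        rw [Finset.ssubset_iff_of_subset]
        · exact ⟨i, Finset.mem_filter.2 ⟨Finset.mem_univ _, Nat.lt_succ_self s, hts, hP⟩,
            fun h => lt_irrefl s (Finset.mem_filter.1 h).2.1⟩
        · intro u hu
          simp only [Finset.mem_filter, Finset.mem_univ, true_and] at hu ⊢
          exact ⟨by omega, hu.2⟩
      · refine le_trans ?_ (le_nextWeight hb _ hstep hP)
        refine le_trans ?_ ihw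
        refine mul_le_mul_of_nonneg_left (pow_le_pow_of_le_one hκ0 hκ1 ?_) hs0
        refine Finset.card_le_card fun u hu => ?_
        simp only [Finset.mem_filter, Finset.mem_univ, true_and] at hu ⊢
        exact ⟨by omega, hu.2⟩

/-- Replacing ≤ f by < f + 1 makes a witness available from the infimum. -/
theorem exists_path_of_worstFeedforwardDistance_le {C : Circuit n p m} {f : ℕ}
    (hf : C.worstFeedforwardDistance ≤ (f : ℕ∞)) (j : Fin n) :
    ∃ t l, C.IsPath t l j ∧ C.pathLength t l ≤ f := by
  have h1 : C.feedforwardDistance j < ((f + 1 : ℕ) : ℕ∞) :=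
    ((le_iSup C.feedforwardDistance j).trans hf).trans_lt (by exact_mod_cast Nat.lt_succ_self f)
  simp only [Circuit.feedforwardDistance, iInf_lt_iff] at h1
  obtain ⟨t, l, hp, hl⟩ := h1
  exact ⟨t, l, hp, Nat.lt_succ_iff.1 (by exact_mod_cast hl)⟩

theorem final_weight {C : Circuit n p m} {f : ℕ}
    (hf : C.worstFeedforwardDistance ≤ (f : ℕ∞)) {κ φ : ℝ} (hκ0 : 0 ≤ κ) (hκ1 : κ ≤ 1)
    (j : Fin n) :
    j ∈ touchedAt C m ∧ Real.sin φ ^ 2 / 3 * κ ^ f ≤ weightAt C κ φ m j := by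
  obtain ⟨t, l, hp, hl⟩ := exists_path_of_worstFeedforwardDistance_le hf j
  obtain ⟨h1, h2⟩ := weightAt_path (φ := φ) hκ0 hκ1 hp m t.2 (Nat.lt_succ_self m)
  have hlast : l ⟨m, Nat.lt_succ_self m⟩ = j := hp.2.2
  rw [hlast] at h1 h2
  refine ⟨h1, le_trans ?_ h2⟩
  refine mul_le_mul_of_nonneg_left (pow_le_pow_of_le_one hκ0 hκ1 ?_) (by positivity)
  refine le_trans ?_ hl
  refine Finset.card_le_card fun u hu => ?_
  simp only [Finset.mem_filter, Finset.mem_univ, true_and] at hu ⊢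
  exact hu.2

theorem le_suppProd {b : Fin n → ℝ} {x : ℝ} (hx : 0 ≤ x) (hb : ∀ j, x ≤ b j)
    (a : Fin n → Fin 4) : x ^ weight a ≤ suppProd b a := by
  have h : x ^ weight a = ∏ j, if a j = 0 then 1 else x := by
    rw [weight, Finset.prod_ite, Finset.prod_const_one, one_mul, Finset.prod_const]
  rw [h, suppProd]
  refine Finset.prod_le_prod (fun j _ => ?_) fun j _ => ?_
  · split_ifs <;> simp [hx]
  · split_ifs
    · exact le_rfl
    · exact hb j

/-! ### Pauli coefficients of observables -/

theorem trace_sum_pauliString_mul (c : (Fin n → Fin 4) → ℝ) (b : Fin n → Fin 4) :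
    ((∑ a, (c a : ℂ) • pauliString a) * pauliString b).trace = 2 ^ n * (c b : ℂ) := by
  rw [Finset.sum_mul, Matrix.trace_sum, Finset.sum_eq_single b]
  · rw [Matrix.smul_mul, Matrix.trace_smul, pauliString_trace_mul, if_pos rfl, smul_eq_mul, mul_comm]
  · intro a _ ha
    rw [Matrix.smul_mul, Matrix.trace_smul, pauliString_trace_mul, if_neg ha, smul_zero]
  · simp

theorem pauliString_zero : pauliString (0 : Fin n → Fin 4) = 1 := by
  ext x y
  simp only [pauliString, Matrix.of_apply, Pi.zero_apply]
  have h0 : pauli 0 = 1 := rfl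
  rw [h0]
  by_cases hxy : x = y
  · subst hxy; simp
  · obtain ⟨j, hj⟩ := Function.ne_iff.1 hxy
    rw [Matrix.one_apply_ne hxy]
    exact Finset.prod_eq_zero (Finset.mem_univ j) (Matrix.one_apply_ne hj)

theorem pauliString_conjTranspose (a : Fin n → Fin 4) :
    (pauliString a).conjTranspose = pauliString a := by
  ext x y
  simp only [pauliString, Matrix.conjTranspose_apply, Matrix.of_apply]
  rw [star_prod]
  exact Finset.prod_congr rfl fun j _ => congrFun (congrFun (pauli_herm (a j)) (x j)) (y j)

theorem pauli_flip {k : Fin 4} (hk : k ≠ 0) (s : Fin 2) : pauli k (1 - s) (1 - s) = -pauli k s s := by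
  fin_cases k <;> fin_cases s <;> simp_all [pauli]

/-- Flipping bit j in both indices preserves the entries of `extendOp A M`. It negates the relevant
entries of the Pauli string, since the diagonal of X, Y or Z is odd under the flip. The trace is
therefore its own negative. -/
theorem extendOp_trace_mul_pauliString (A : Finset (Fin n))
    (M : Matrix (A → Fin 2) (A → Fin 2) ℂ) (a : Fin n → Fin 4) {j : Fin n} (hj : j ∉ A)
    (ha : a j ≠ 0) : (extendOp A M * pauliString a).trace = 0 := by
  set fl : Bits n → Bits n := fun x => Function.update x j (1 - x j) with hfl
  have hfl2 : ∀ x, fl (fl x) = x := fun x => by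
    simp only [hfl, Function.update_self, Function.update_idem, sub_sub_cancel,
      Function.update_eq_self]
  have hflA : ∀ x, (fun i : A => fl x i) = fun i : A => x i := fun x => by
    ext i
    have : (i : Fin n) ≠ j := fun h => hj (h ▸ i.2)
    simp [hfl, this]
  have hext : ∀ x y, extendOp A M (fl x) (fl y) = extendOp A M x y := fun x y => by
    simp only [extendOp, Matrix.of_apply, hflA]
    have : (∀ i, i ∉ A → fl x i = fl y i) ↔ ∀ i, i ∉ A → x i = y i := by
      refine forall_congr' fun i => imp_congr_right fun _ => ?_
      by_cases hij : i = j
      · subst hij; simp [hfl]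
      · simp [hfl, hij]
    simp only [this]
  have hpauli : ∀ x y, x j = y j → pauliString a (fl x) (fl y) = -pauliString a x y := by
    intro x y hxy
    simp only [pauliString, Matrix.of_apply]
    rw [← Finset.mul_prod_erase Finset.univ _ (Finset.mem_univ j),
      ← Finset.mul_prod_erase Finset.univ (fun i => pauli (a i) (x i) (y i)) (Finset.mem_univ j),
      ← neg_mul]
    congr 1
    · simp only [hfl, Function.update_self]
      rw [hxy, pauli_flip ha]
    · refine Finset.prod_congr rfl fun i hi => ?_
      simp [hfl, Finset.ne_of_mem_erase hi]
  have hzero : ∀ x y, x j ≠ y j → extendOp A M x y = 0 := fun x y hxy => by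
    rw [extendOp, Matrix.of_apply, if_neg fun h => hxy (h j hj)]
  have hterm : ∀ x y, extendOp A M (fl x) (fl y) * pauliString a (fl y) (fl x)
      = -(extendOp A M x y * pauliString a y x) := fun x y => by
    rw [hext]
    by_cases hxy : x j = y j
    · rw [hpauli y x hxy.symm, mul_neg]
    · rw [hzero x y hxy]; simp
  let e : Bits n ≃ Bits n := ⟨fl, fl, hfl2, hfl2⟩
  have hsum : (extendOp A M * pauliString a).trace
      = ∑ x, ∑ y, extendOp A M x y * pauliString a y x := by
    simp only [Matrix.trace, Matrix.diag, Matrix.mul_apply]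
  have hneg : ∑ x, ∑ y, extendOp A M x y * pauliString a y x
      = -∑ x, ∑ y, extendOp A M x y * pauliString a y x := by
    conv_lhs => rw [← e.sum_comp]
    rw [← Finset.sum_neg_distrib]
    refine Finset.sum_congr rfl fun x _ => ?_
    rw [← e.sum_comp, ← Finset.sum_neg_distrib]
    exact Finset.sum_congr rfl fun y _ => hterm x y
  rw [hsum]
  exact self_eq_neg.1 hneg

theorem IsKLocal.coeff_eq_zero {k : ℕ} {H : NOp n} (hH : IsKLocal k H)
    {c : (Fin n → Fin 4) → ℝ} (hc : H = ∑ a, (c a : ℂ) • pauliString a) {a : Fin n → Fin 4}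
    (ha : k < weight a) : c a = 0 := by
  obtain ⟨r, h, hh, hsum⟩ := hH
  have h1 : (H * pauliString a).trace = 0 := by
    rw [hsum, Finset.sum_mul, Matrix.trace_sum]
    refine Finset.sum_eq_zero fun i _ => ?_
    obtain ⟨A, hA, M, hM⟩ := (hh i).2
    -- A string of weight above k has a nontrivial factor outside every set of at most k qubits.
    obtain ⟨j, hj, hjA⟩ := Finset.exists_mem_notMem_of_card_lt_card (hA.trans_lt ha)
    rw [hM]
    exact extendOp_trace_mul_pauliString A M a hjA (Finset.mem_filter.1 hj).2
  rw [hc, trace_sum_pauliString_mul] at h1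
  simpa using h1

theorem hsNormSq_tracelessPart {H : NOp n} {c : (Fin n → Fin 4) → ℝ}
    (hc : H = ∑ a, (c a : ℂ) • pauliString a) :
    hsNormSq (tracelessPart H) = ∑ a with a ≠ 0, c a ^ 2 := by
  set c' : (Fin n → Fin 4) → ℝ := fun a => if a = 0 then 0 else c a with hc'
  have htr : H.trace = 2 ^ n * (c 0 : ℂ) := by
    have := trace_sum_pauliString_mul c 0
    rwa [← hc, pauliString_zero, mul_one] at this
  have hT : tracelessPart H = ∑ a, (c' a : ℂ) • pauliString a := by
    have h2 : (2 : ℂ) ^ n ≠ 0 := pow_ne_zero n two_ne_zero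
    rw [tracelessPart, htr, mul_div_cancel_left₀ _ h2, hc,
      ← Finset.add_sum_erase Finset.univ _ (Finset.mem_univ (0 : Fin n → Fin 4)),
      ← Finset.add_sum_erase Finset.univ (fun a => (c' a : ℂ) • pauliString a)
        (Finset.mem_univ (0 : Fin n → Fin 4)), pauliString_zero, add_sub_cancel_left]
    simp only [hc', if_true, Complex.ofReal_zero, zero_smul, zero_add]
    exact Finset.sum_congr rfl fun a ha => by rw [if_neg (Finset.ne_of_mem_erase ha)]
  have hherm : (tracelessPart H).conjTranspose = tracelessPart H := by
    rw [hT, Matrix.conjTranspose_sum]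
    refine Finset.sum_congr rfl fun a _ => ?_
    rw [Matrix.conjTranspose_smul, pauliString_conjTranspose]
    simp
  have htr2 : (tracelessPart H * tracelessPart H).trace = 2 ^ n * ((∑ a, c' a ^ 2 : ℝ) : ℂ) := by
    conv_lhs => enter [1, 2]; rw [hT]
    rw [Finset.mul_sum, Matrix.trace_sum, Complex.ofReal_sum, Finset.mul_sum]
    refine Finset.sum_congr rfl fun a _ => ?_
    rw [Matrix.mul_smul, Matrix.trace_smul, hT, trace_sum_pauliString_mul, smul_eq_mul]
    push_cast
    ring
  have hre : ((2 : ℂ) ^ n * ((∑ a, c' a ^ 2 : ℝ) : ℂ)).re = 2 ^ n * ∑ a, c' a ^ 2 := by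
    have : ((2 : ℂ) ^ n) = ((2 ^ n : ℝ) : ℂ) := by push_cast; rfl
    rw [this, ← Complex.ofReal_mul, Complex.ofReal_re]
  rw [hsNormSq, hherm, htr2, hre, mul_div_cancel_left₀ _ (by positivity), Finset.sum_filter]
  refine Finset.sum_congr rfl fun a _ => ?_
  by_cases ha : a = 0 <;> simp [hc', ha]

/-! ### The variance of the loss -/

theorem variance_sum_of_uncorrelated {Ω ι : Type*} [MeasurableSpace Ω] [Fintype ι] [DecidableEq ι]
    {μ : Measure Ω} [IsProbabilityMeasure μ] {X : ι → Ω → ℝ} (hm : ∀ a, Measurable (X a))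
    (hb : ∀ a, Bdd (X a)) (o : ι) (ho : ∀ w, X o w = 1)
    (h : ∀ a b, a ≠ b → ∫ w, X a w * X b w ∂μ = 0) (c : ι → ℝ) :
    variance (fun w => ∑ a, c a * X a w) μ
      = ∑ a with a ≠ o, c a ^ 2 * ∫ w, X a w * X a w ∂μ := by
  have hcb : ∀ a, Bdd fun w => c a * X a w := fun a =>
    Bdd.mul (f := fun _ => c a) ⟨_, fun _ => le_rfl⟩ (hb a)
  have hcm : ∀ a, Measurable fun w => c a * X a w := fun a => (hm a).const_mul _
  have hsb : Bdd fun w => ∑ a, c a * X a w := Bdd.sum hcb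
  have hsm : Measurable fun w => ∑ a, c a * X a w := Finset.measurable_sum _ fun a _ => hcm a
  -- Orthogonality to the constant variable `X o` = 1 says that the mean vanishes.
  have hmean : ∀ a, a ≠ o → ∫ w, X a w ∂μ = 0 := fun a ha => by
    have := h a o ha
    simpa [ho] using this
  have h1 : ∫ w, ∑ a, c a * X a w ∂μ = c o := by
    rw [integral_finsetSum _ fun a _ => (hcb a).integrable (hcm a), Finset.sum_eq_single o]
    · simp [ho]
    · intro a _ ha
      rw [integral_const_mul, hmean a ha, mul_zero]
    · simp
  have h2 : ∫ w, (∑ a, c a * X a w) ^ 2 ∂μ = ∑ a, c a ^ 2 * ∫ w, X a w * X a w ∂μ := by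
    have he : ∀ w, (∑ a, c a * X a w) ^ 2 = ∑ a, ∑ b, (c a * c b) * (X a w * X b w) := fun w => by
      rw [sq, Finset.sum_mul_sum]
      exact Finset.sum_congr rfl fun a _ => Finset.sum_congr rfl fun b _ => by ring
    have hint : ∀ a b, Integrable (fun w => (c a * c b) * (X a w * X b w)) μ := fun a b =>
      (((hb a).mul (hb b)).integrable ((hm a).mul (hm b))).const_mul _
    simp only [he]
    rw [integral_finsetSum _ fun a _ => integrable_finsetSum _ fun b _ => hint a b]
    refine Finset.sum_congr rfl fun a _ => ?_
    rw [integral_finsetSum _ fun b _ => hint a b, Finset.sum_eq_single a]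
    · rw [integral_const_mul, sq]
    · intro b _ hab
      rw [integral_const_mul, h a b hab.symm, mul_zero]
    · simp
  have hL2 : MemLp (fun w => ∑ a, c a * X a w) 2 μ := by
    obtain ⟨K, hK⟩ := hsb
    exact MemLp.of_bound hsm.aestronglyMeasurable K (Filter.Eventually.of_forall hK)
  have hXo : ∫ w, X o w * X o w ∂μ = 1 := by simp [ho]
  rw [variance_eq_sub hL2]
  simp only [Pi.pow_apply]
  rw [h1, h2, ← Finset.add_sum_erase Finset.univ _ (Finset.mem_univ o), hXo, mul_one,
    add_sub_cancel_left]
  refine Finset.sum_congr ?_ fun _ _ => rfl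
  ext a
  simp

theorem variance_loss {C : Circuit n p m} {φ ψ : ℝ} {D : Measure (Params p)} {E : Measure U2}
    (hid : IdentDistrib
      (fun θ : Params p => Circuit.entries (C.run φ ψ θ))
      (fun w : Params p × (Fin m → Fin n → U2) => Circuit.entries (C.runWith φ ψ w.2 w.1))
      D (jointLaw n m D E))
    {H : NOp n} {c : (Fin n → Fin 4) → ℝ} (hc : H = ∑ a, (c a : ℂ) • pauliString a) :
    variance (C.loss φ ψ H) D
      = variance (fun w => ∑ a, c a * coefAt C φ ψ m a w) (jointLaw n m D E) := by
  -- The loss is a measurable function of the channel entries, so equality in law of the channels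
  -- carries over to its variance.
  set g : (Bits n → Bits n → Bits n → Bits n → ℂ) → ℝ := fun e =>
    (∑ x, ∑ y, e 0 0 x y * H y x).re with hg
  have hgm : Measurable g := by
    refine Complex.measurable_re.comp ?_
    refine Finset.measurable_sum _ fun x _ => Finset.measurable_sum _ fun y _ => ?_
    refine Measurable.mul_const ?_ _
    fun_prop
  have hgl : ∀ Φ : NOp n → NOp n, g (Circuit.entries Φ) = (Φ (Matrix.single 0 0 1) * H).trace.re := by
    intro Φ
    simp only [hg, Circuit.entries, Matrix.trace, Matrix.diag, Matrix.mul_apply]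
  have h := (hid.comp hgm).variance_eq
  have h1 : g ∘ (fun θ : Params p => Circuit.entries (C.run φ ψ θ)) = C.loss φ ψ H := by
    ext θ; exact hgl _
  have h2 : g ∘ (fun w : Params p × (Fin m → Fin n → U2) =>
      Circuit.entries (C.runWith φ ψ w.2 w.1)) = fun w => ∑ a, c a * coefAt C φ ψ m a w := by
    ext w
    have hrun : C.runWith φ ψ w.2 w.1 (Matrix.single 0 0 1) = stateAt C φ ψ w m := by
      rw [Circuit.runWith, foldl_eq_seqFold, stateAt]
    rw [Function.comp_apply, hgl, hrun, hc, Finset.mul_sum, Matrix.trace_sum, Complex.re_sum]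
    refine Finset.sum_congr rfl fun a _ => ?_
    rw [Matrix.mul_smul, Matrix.trace_smul, smul_eq_mul, Complex.re_ofReal_mul, coefAt]
  rwa [h1, h2] at h

end DynCircuit

end

/-! ### Proof of the two variance bounds -/

theorem mainTheorem1 {n p m : ℕ} (C : DynCircuit.Circuit n p m) (φ ψ : ℝ)
    (D : MeasureTheory.Measure (DynCircuit.Params p)) [MeasureTheory.IsProbabilityMeasure D]
    (hctrl : C.IndependentlyControlled φ ψ D)
    (hscr : C.LocallyScrambling φ ψ D)
    (α β : ℝ) (hα : α ∈ Set.Icc (0 : ℝ) 1) (hβ : β ∈ Set.Icc (0 : ℝ) (1 - α))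
    (hT : ∀ i, (C i).PairHasTransferMatrix D (DynCircuit.transferMatrix α β))
    (f : ℕ) (hf : C.worstFeedforwardDistance ≤ (f : ℕ∞))
    (k : ℕ) (H : DynCircuit.NOp n) (hH : DynCircuit.IsKLocal k H)
    (c : (Fin n → Fin 4) → ℝ) (hc : H = ∑ a, (c a : ℂ) • DynCircuit.pauliString a) :
    (∑ a with a ≠ 0,
        c a ^ 2 * (Real.sin φ ^ 2 / 3) ^ DynCircuit.weight a * (α / 5) ^ (k * f)
      ≤ ProbabilityTheory.variance (C.loss φ ψ H) D) ∧
    (DynCircuit.hsNormSq (DynCircuit.tracelessPart H) *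
        (Real.sin φ ^ 2 / 3) ^ k * (α / 5) ^ (k * f)
      ≤ ProbabilityTheory.variance (C.loss φ ψ H) D) := by
  obtain ⟨owner, hd, hind⟩ := hctrl
  obtain ⟨E, hE, hid⟩ := hscr
  have hEp := hE.1
  have hκ0 : 0 ≤ α / 5 := div_nonneg hα.1 (by norm_num)
  have hκ1 : α / 5 ≤ 1 := by linarith [hα.2]
  have hs0 : (0 : ℝ) ≤ Real.sin φ ^ 2 / 3 := by positivity
  have hs1 : Real.sin φ ^ 2 / 3 ≤ 1 := by linarith [Real.sin_sq_le_one φ]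
  obtain ⟨hmeas, hbdd, hone, hspread⟩ := DynCircuit.evolution hd hind hE hα hβ hT m le_rfl
  have hfin := fun j => DynCircuit.final_weight (φ := φ) hf hκ0 hκ1 j
  have hlow : ∀ a : Fin n → Fin 4, DynCircuit.weight a ≤ k →
      (Real.sin φ ^ 2 / 3) ^ DynCircuit.weight a * (α / 5) ^ (k * f)
        ≤ ∫ w, DynCircuit.coefAt C φ ψ m a w * DynCircuit.coefAt C φ ψ m a w
          ∂(DynCircuit.jointLaw n m D E) := by
    intro a ha
    refine le_trans ?_ (hspread.low a)
    refine le_trans ?_ (DynCircuit.le_suppProd (mul_nonneg hs0 (pow_nonneg hκ0 f))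
      (fun j => (hfin j).2) a)
    rw [mul_pow, ← pow_mul]
    -- The product of weights gives the exponent f·|a|, at most kf; the base α/5 is at most 1.
    refine mul_le_mul_of_nonneg_left (pow_le_pow_of_le_one hκ0 hκ1 ?_) (pow_nonneg hs0 _)
    rw [mul_comm f]
    exact Nat.mul_le_mul_right f ha
  have hvar : ProbabilityTheory.variance (C.loss φ ψ H) D = ∑ a with a ≠ 0, c a ^ 2 *
      ∫ w, DynCircuit.coefAt C φ ψ m a w * DynCircuit.coefAt C φ ψ m a w
        ∂(DynCircuit.jointLaw n m D E) := by
    rw [DynCircuit.variance_loss hid hc]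
    refine DynCircuit.variance_sum_of_uncorrelated
      (fun a => (hmeas a).mono (DynCircuit.pastAlg_le owner m) le_rfl) hbdd 0 hone
      (fun a b hab => ?_) c
    -- Every qubit has been touched at the end, so differing labels on any qubit make the
    -- coefficients uncorrelated.
    obtain ⟨j, hj⟩ := Function.ne_iff.1 hab
    exact hspread.diag j (hfin j).1 a b hj
  have hzero : ∀ a : Fin n → Fin 4, ¬ DynCircuit.weight a ≤ k → c a = 0 := fun a ha =>
    hH.coeff_eq_zero hc (not_le.1 ha)
  rw [hvar, DynCircuit.hsNormSq_tracelessPart hc]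
  constructor
  · refine Finset.sum_le_sum fun a _ => ?_
    by_cases ha : DynCircuit.weight a ≤ k
    · rw [mul_assoc]
      exact mul_le_mul_of_nonneg_left (hlow a ha) (sq_nonneg _)
    · simp [hzero a ha]
  · rw [Finset.sum_mul, Finset.sum_mul]
    refine Finset.sum_le_sum fun a _ => ?_
    by_cases ha : DynCircuit.weight a ≤ k
    · rw [mul_assoc]
      refine mul_le_mul_of_nonneg_left (le_trans ?_ (hlow a ha)) (sq_nonneg _)
      exact mul_le_mul_of_nonneg_right (pow_le_pow_of_le_one hs0 hs1 ha) (pow_nonneg hκ0 _)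
    · simp [hzero a ha]
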